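/- Let $\mathbb R^{2,1}$ be $\mathbb R^3$ with $\langle x,y\rangle=x^1y^1+x^2y^2-x^3y^3$, let $\mathbb H^2=\{\langle x,x\rangle=-1,\ x^3>0\}$, and identify $\partial_\infty\mathbb H^2$ with $S^1=\partial\mathbb D=\{(\eta,1):|\eta|=1\}$. Let $\mathcal G$ be the space of unoriented geodesics of $\mathbb H^2$, and write $\mathcal G_B$ for the set of geodesics meeting $B$. A measured geodesic lamination is a locally finite Borel measure $\mu$ on $\mathcal G$ whose support is a (closed) set of pairwise disjoint geodesics. It is bounded if $\sup_I\mu(\mathcal G_I)<\infty$, the supremum being over the geodesic segments $I$ of length at most $1$ transverse to the support. A left earthquake along a lamination is a surjective map $E:\mathbb H^2\to\mathbb H^2$ that agrees on each stratum $S$ with an orientation-preserving isometry $E_S$, such that for any two distinct strata $S,S'$ the map $E_S^{-1}\circ E_{S'}$ is a (possibly trivial) hyperbolic translation whose axis weakly separates $S$ and $S'$ and which translates to the left as seen from $S$. Its earthquake measure gives to $\mathcal G_{[x,y]}$, for $x,y$ on no weighted leaf, the limit (equivalently, the infimum), over finer and finer partitions of $[x,y]$, of the sum of the translation lengths of the comparison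 maps of consecutive partition points. A closed set $D$ is future-convex if it is an intersection of future half-spaces bounded by spacelike planes, $D\neq\emptyset,\mathbb R^{2,1}$; its support function is $U(x)=\sup_{p\in D}\langle p,x\rangle$, and the support function at infinity is the restriction of $U$ to $\partial\mathbb D$. A domain of dependence is the largest future-convex domain $D$ for which some given spacelike $C^1$ surface $S\subseteq D$ is a Cauchy surface (every inextensible causal path in $\mathrm{int}\,D$ meets $S$ exactly once). It has dual lamination $\mu$ if there are $y_0\in\mathbb R^{2,1}$ and $x_0\in\mathbb H^2$ on no weighted leaf of $\mu$ such that, for every $x\in\mathbb H^2$, the point $$y(x)=y_0+\int_{\mathcal G_{[x_0,x]}}\boldsymbol\sigma\,d\mu$$ lies on the spacelike boundary of $D$ and $y(x)+x^\perp$ is a support plane of $D$; here $\boldsymbol\sigma(l)$ is the unit spacelike normal of $l$ pointing in the direction from $x_0$ to $x$. Let $\mu$ be a bounded measured geodesic lamination of $\mathbb H^2$. For $t\ge 0$ let $E^{t\mu}$ be a left earthquake with earthquake measure $t\mu$, with $E^{0}=\mathrm{id}$ (the normalization of the $E^{t\mu}$ by isometries being otherwise arbitrary), and suppose that the extensions of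 the $E^{t\mu}$ to $S^1$ are differentiable in $t$ at $t=0$ (from the right) at every point of $S^1$, with derivative the infinitesimal earthquake $$\hat\varphi(\eta)=\left.\frac{d}{dt}\right|_{t=0}E^{t\mu}(\eta)=i\eta\,\varphi(\eta),\qquad \eta\in S^1 .$$ Then $\varphi:S^1\to\mathbb R$ is the support function at infinity of a domain of dependence $D$ in $\mathbb R^{2,1}$ with dual lamination $\mu$. -/

import Mathlib

open MeasureTheory Filter Topology Set
open scoped ENNReal NNReal

noncomputable section

namespace Mink

/-! ### Minkowski space, the hyperboloid and the circle at infinity -/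

/-- The underlying vector space of Minkowski space `ℝ^{2,1}`; the third coordinate `x 2` is time. -/
abbrev V : Type := Fin 3 → ℝ

/-- The Minkowski product `x¹y¹ + x²y² - x³y³`. -/
def mink (x y : V) : ℝ := x 0 * y 0 + x 1 * y 1 - x 2 * y 2

/-- The Minkowski cross product, characterized by `⟨a ⊠ b, c⟩ = det (a, b, c)`. -/
def mcross (a b : V) : V :=
  ![a 1 * b 2 - a 2 * b 1, a 2 * b 0 - a 0 * b 2, -(a 0 * b 1 - a 1 * b 0)]

/-- The hyperbolic plane, as the hyperboloid of future unit timelike vectors. -/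
abbrev Hyp : Type := {x : V // mink x x = -1 ∧ 0 < x 2}

/-- The projection `(x¹, x², x³) ↦ (x¹, x²)`, with values in `ℝ² = ℂ`. -/
def horiz (p : V) : ℂ := ⟨p 0, p 1⟩

/-- The Klein model: radial projection of the hyperboloid to the unit disc at height one. -/
def klein (x : Hyp) : ℂ := ((x.1 2)⁻¹ : ℝ) • horiz x.1

/-- The point `(η, 1)` of the circle `∂𝔻` at height one in the light cone. -/
def null (η : Circle) : V := ![(η : ℂ).re, (η : ℂ).im, 1]

/-- The geodesic segment `[x, y]` of the hyperbolic plane (radial projection of the line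
segment). -/
def seg (x y : Hyp) : Set Hyp := {z | ∃ a b : ℝ, 0 ≤ a ∧ 0 ≤ b ∧ z.1 = a • x.1 + b • y.1}

/-- The hyperbolic distance, `cosh d(x, y) = -⟨x, y⟩`. -/
def hdist (x y : Hyp) : ℝ := Real.arcosh (-mink x.1 y.1)

/-! ### Geodesics and measured geodesic laminations -/

/-- The space `𝒢 = ((S¹ × S¹) ∖ diag) / ((a, b) ∼ (b, a))` of unoriented geodesics. -/
def Geodesic : Type := {s : Sym2 Circle // ¬ s.IsDiag}

/-- The quotient topology. -/
instance : TopologicalSpace Geodesic :=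
  inferInstanceAs (TopologicalSpace {s : Sym2 Circle // ¬ s.IsDiag})

instance : MeasurableSpace Geodesic := borel Geodesic

instance : BorelSpace Geodesic := ⟨rfl⟩

/-- The points of the hyperbolic plane on the geodesic with endpoints `a`, `b`. -/
def Geodesic.points (l : Geodesic) : Set Hyp :=
  {x | ∃ a b : Circle, l.1 = s(a, b) ∧ ∃ u v : ℝ, 0 < u ∧ 0 < v ∧
    x.1 = u • null a + v • null b}

/-- `𝒢_B`, the geodesics that meet `B`. -/
def meeting (B : Set Hyp) : Set Geodesic := {l | (l.points ∩ B).Nonempty}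

/-- A geodesic lamination: a closed set of pairwise disjoint geodesics. -/
def IsGeodesicLamination (L : Set Geodesic) : Prop :=
  IsClosed L ∧ L.Pairwise fun l l' => Disjoint l.points l'.points

/-- A measured geodesic lamination: a locally finite Borel measure on the space of geodesics
whose support is a geodesic lamination. -/
def IsMeasuredLamination (μ : Measure Geodesic) : Prop :=
  IsLocallyFiniteMeasure μ ∧ IsGeodesicLamination μ.support

/-- The Thurston norm: the supremum of `μ (𝒢_I)` over the geodesic segments `I = [x, y]` of
length at most one that are transverse to the support of `μ`. -/
def thurstonNorm (μ : Measure Geodesic) : ℝ≥0∞ :=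
  ⨆ (x : Hyp) (y : Hyp) (_ : hdist x y ≤ 1)
    (_ : ∀ l ∈ μ.support, ¬ seg x y ⊆ l.points), μ (meeting (seg x y))

/-- The point `x` lies on no weighted leaf of `μ`. -/
def OffWeightedLeaves (μ : Measure Geodesic) (x : Hyp) : Prop :=
  ∀ l : Geodesic, x ∈ l.points → μ {l} = 0

/-- The stratum of the lamination `L` through `x`: the leaf through `x`, if there is one, and
otherwise the connected component of `x` in the complement of the leaves. -/
def stratum (L : Set Geodesic) (x : Hyp) : Set Hyp :=
  {y | ∃ l ∈ L, x ∈ l.points ∧ y ∈ l.points} ∪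
    connectedComponentIn (⋃ l ∈ L, l.points)ᶜ x

/-- The strata of a lamination. -/
def IsStratum (L : Set Geodesic) (S : Set Hyp) : Prop := ∃ x, S = stratum L x

/-! ### Earthquakes -/

/-- The group `SO₀(2,1)` of orientation and time preserving linear isometries, that is, of
orientation preserving isometries of the hyperbolic plane. -/
def IsSO0 (A : V ≃ₗ[ℝ] V) : Prop :=
  (∀ x y, mink (A x) (A y) = mink x y) ∧ LinearMap.det (A : V →ₗ[ℝ] V) = 1 ∧
    ∀ x : Hyp, 0 < A x.1 2

/-- For `⟨σ, σ⟩ = 1`, the hyperbolic translation of signed length `s` whose axis is the geodesic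
`σ^⊥` and whose generator is `x ↦ x ⊠ σ`. For `s ≥ 0` it translates to the left as seen from the
side `⟨·, σ⟩ ≤ 0` of the axis. -/
def translation (σ : V) (s : ℝ) (x : V) : V :=
  mink x σ • σ + Real.cosh s • (x - mink x σ • σ) + Real.sinh s • mcross x σ

/-- `B` is a (possibly trivial) hyperbolic translation whose axis weakly separates `S` from `S'`
and which translates to the left as seen from `S`. -/
def IsLeftTranslation (S S' : Set Hyp) (B : V ≃ₗ[ℝ] V) : Prop :=
  ∃ (σ : V) (s : ℝ), mink σ σ = 1 ∧ 0 ≤ s ∧ (∀ x ∈ S, mink x.1 σ ≤ 0) ∧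
    (∀ x ∈ S', 0 ≤ mink x.1 σ) ∧ ∀ x, B x = translation σ s x

/-- The translation length of a hyperbolic element of `SO₀(2,1)`, read off from
`tr B = 1 + 2 cosh (length)`. -/
def translationLength (B : V ≃ₗ[ℝ] V) : ℝ :=
  Real.arcosh ((LinearMap.trace ℝ V (B : V →ₗ[ℝ] V) - 1) / 2)

/-- The comparison map `A⁻¹ ∘ A'`. -/
def comparison (A A' : V ≃ₗ[ℝ] V) : V ≃ₗ[ℝ] V := A'.trans A.symm

/-- `E` is a left earthquake along the lamination `L`, equal on every stratum `S` to the
isometry `A S`. -/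
def IsLeftEarthquake (L : Set Geodesic) (E : Hyp → Hyp) (A : Set Hyp → V ≃ₗ[ℝ] V) : Prop :=
  Function.Surjective E ∧
  (∀ S, IsStratum L S → IsSO0 (A S) ∧ ∀ x ∈ S, (E x).1 = A S x.1) ∧
  ∀ S S', IsStratum L S → IsStratum L S' → S ≠ S' →
    IsLeftTranslation S S' (comparison (A S) (A S'))

/-- The sums of the translation lengths of the successive comparison maps of an earthquake, over
all the partitions `x = p 0, p 1, …, p n = y` of the segment `[x, y]`. -/
def partitionSums (L : Set Geodesic) (A : Set Hyp → V ≃ₗ[ℝ] V) (x y : Hyp) : Set ℝ :=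
  {r | ∃ (n : ℕ) (p : ℕ → Hyp), p 0 = x ∧ p n = y ∧ (∀ i < n, p (i + 1) ∈ seg (p i) y) ∧
    r = ∑ i ∈ Finset.range n,
      translationLength (comparison (A (stratum L (p i))) (A (stratum L (p (i + 1)))))}

/-- `E` is a left earthquake with earthquake measure `ν`. The sums of translation lengths decrease
when a partition is refined, so that their limit, the mass that the earthquake measure gives to
the geodesics across `[x, y]`, is their infimum. Endpoints on weighted leaves are left out,
because there an earthquake is ambiguous. -/
def IsEarthquakeAlong (ν : Measure Geodesic) (E : Hyp → Hyp) : Prop :=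
  ∃ A : Set Hyp → V ≃ₗ[ℝ] V, IsLeftEarthquake ν.support E A ∧
    ∀ x y : Hyp, OffWeightedLeaves ν x → OffWeightedLeaves ν y →
      IsGLB (partitionSums ν.support A x y) (ν (meeting (seg x y))).toReal

/-- `f` is the continuous extension of `E` to the circle at infinity. -/
def IsBoundaryExtension (E : Hyp → Hyp) (f : Circle → Circle) : Prop :=
  ∀ η : Circle, Tendsto (fun x => klein (E x)) (comap klein (𝓝 (η : ℂ))) (𝓝 (f η : ℂ))

/-- The vector field `η ↦ iη φ(η)` on the circle is an infinitesimal earthquake along `μ`: it is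
the derivative at `t = 0` of the boundary values of earthquakes `E t` with earthquake
measures `t μ`, `t ≥ 0`, where `E 0` is the identity. The normalization of the `E t` by isometries
is arbitrary. -/
def IsInfinitesimalEarthquake (μ : Measure Geodesic) (φ : Circle → ℝ) : Prop :=
  ∃ (E : ℝ → Hyp → Hyp) (f : ℝ → Circle → Circle),
    (∀ t, 0 ≤ t → IsEarthquakeAlong (t.toNNReal • μ) (E t)) ∧
    (∀ t, 0 ≤ t → IsBoundaryExtension (E t) (f t)) ∧
    E 0 = id ∧
    ∀ η : Circle, HasDerivWithinAt (fun t => (f t η : ℂ))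
      (Complex.I * (η : ℂ) * (φ η : ℂ)) (Ici 0) 0

/-! ### Future-convex domains and domains of dependence -/

/-- A future-convex domain: an intersection of future half-spaces bounded by spacelike planes
(neither empty nor the whole space). -/
def IsFutureConvex (D : Set V) : Prop :=
  D.Nonempty ∧ D ≠ univ ∧
    ∃ C : Set (Hyp × ℝ), D = {p | ∀ c ∈ C, mink p c.1.1 ≤ c.2}

/-- The spacelike plane `y + x^⊥` is a support plane of `D`: it misses the interior of `D`, and
its translates by vectors `v` in the future of `x^⊥` meet the interior. -/
def IsSupportPlane (D : Set V) (y : V) (x : Hyp) : Prop :=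
  (∀ p ∈ interior D, mink (p - y) x.1 ≠ 0) ∧
    ∀ v : V, mink v x.1 < 0 → ∃ p ∈ interior D, mink (p - (y + v)) x.1 = 0

/-- The spacelike boundary `∂ₛ D`. -/
def spacelikeBoundary (D : Set V) : Set V :=
  {p ∈ frontier D | ∃ (y : V) (x : Hyp), IsSupportPlane D y x ∧ mink (p - y) x.1 = 0}

/-- The support function `U(x) = sup_{p ∈ D} ⟨p, x⟩`, with values in the extended reals. -/
def supportFunction (D : Set V) (x : V) : EReal := ⨆ p ∈ D, (mink p x : EReal)

/-- A differentiable inextensible causal path in the open set `U`, parametrized by the real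
line: its velocity is causal and it has no endpoint in `U`. -/
def IsInextensibleCausalPath (U : Set V) (γ : ℝ → V) : Prop :=
  Differentiable ℝ γ ∧ (∀ t, γ t ∈ U) ∧
  (∀ t, deriv γ t ≠ 0 ∧ mink (deriv γ t) (deriv γ t) ≤ 0) ∧
  (∀ p ∈ U, ¬ Tendsto γ atTop (𝓝 p)) ∧ ∀ p ∈ U, ¬ Tendsto γ atBot (𝓝 p)

/-- A spacelike surface of class `C¹`. A Cauchy surface of a future-convex domain meets every
vertical line exactly once, so that only entire graphs have to be considered. -/
def IsSpacelikeSurface (S : Set V) : Prop :=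
  ∃ f : ℂ → ℝ, ContDiff ℝ 1 f ∧ (∀ z, ‖fderiv ℝ f z‖ < 1) ∧ S = {p | p 2 = f (horiz p)}

/-- `S` is a Cauchy surface of `D`: every inextensible causal path in (the interior of) `D` meets
`S` exactly once. -/
def IsCauchySurface (S D : Set V) : Prop :=
  IsSpacelikeSurface S ∧ S ⊆ D ∧
    ∀ γ : ℝ → V, IsInextensibleCausalPath (interior D) γ → ∃! t, γ t ∈ S

/-- A domain of dependence: the largest future-convex domain that has some given surface `S` as a
Cauchy surface. -/
def IsDomainOfDependence (D : Set V) : Prop :=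
  ∃ S : Set V, IsFutureConvex D ∧ IsCauchySurface S D ∧
    ∀ D' : Set V, IsFutureConvex D' → IsCauchySurface S D' → D' ⊆ D

/-! ### The dual lamination -/

/-- The unit spacelike normal of the geodesic with (ordered) endpoints `a`, `b`. -/
def normal (a b : Circle) : V := (mink (null a) (null b))⁻¹ • mcross (null a) (null b)

lemma normal_swap (a b : Circle) : normal b a = -normal a b := by
  unfold normal
  rw [show mink (null b) (null a) = mink (null a) (null b) by simp only [mink]; ring,
    show mcross (null b) (null a) = -mcross (null a) (null b) by
      ext i; fin_cases i <;> simp [mcross] <;> ring, smul_neg]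

lemma mink_neg_left (x y : V) : mink (-x) y = -mink x y := by
  simp only [mink, Pi.neg_apply]; ring

/-- For a geodesic `l` that crosses `[x₀, x]`, the unit spacelike vector orthogonal to `l` and
pointing outward in the direction from `x₀` to `x` (and `0` if `l` contains the segment). -/
def sigma (x₀ x : Hyp) (l : Geodesic) : V :=
  Sym2.lift ⟨fun a b =>
    Real.sign (mink (normal a b) x.1 - mink (normal a b) x₀.1) • normal a b, fun a b => by
      beta_reduce
      rw [normal_swap a b, mink_neg_left, mink_neg_left, neg_sub_neg, ← neg_sub, Real.sign_neg,
        neg_smul, smul_neg]⟩ l.1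

/-- `D = D(μ, x₀, y₀)`: for every `x` in the hyperbolic plane, the point
`y(x) = y₀ + ∫_{𝒢[x₀, x]} σ dμ` lies on the spacelike boundary of `D`, and `y(x) + x^⊥` is a
support plane of `D`. -/
def IsMessDomain (μ : Measure Geodesic) (x₀ : Hyp) (y₀ : V) (D : Set V) : Prop :=
  ∀ x : Hyp, IntegrableOn (sigma x₀ x) (meeting (seg x₀ x)) μ ∧
    y₀ + ∫ l in meeting (seg x₀ x), sigma x₀ x l ∂μ ∈ spacelikeBoundary D ∧
    IsSupportPlane D (y₀ + ∫ l in meeting (seg x₀ x), sigma x₀ x l ∂μ) x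

/-- `μ` is the dual lamination of `D`: `D = D(μ, x₀, y₀)` for some `y₀` and some base point `x₀`
on no weighted leaf. -/
def HasDualLamination (D : Set V) (μ : Measure Geodesic) : Prop :=
  ∃ (x₀ : Hyp) (y₀ : V), OffWeightedLeaves μ x₀ ∧ IsMessDomain μ x₀ y₀ D

end Mink

end

namespace Mink

/-! ### Algebra of Minkowski space -/

/-! The proof computes the infinitesimal earthquake explicitly and recognizes the result as the
support function at infinity of the domain that Mess's construction attaches to `μ`.

Infinitesimal earthquake. Fix `x₀` off the weighted leaves, a boundary point `η`, and the ray from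
`x₀` to `η` with direction the null vector `N` (a positive multiple of `null η`). Seen from the
stratum of `x₀`, a far point of the ray is moved by a product of left translations about axes that
cross the ray. A translation of length `s` with normal `σ` has generator `v ↦ v ⊠ σ`, and modulo `N`
it moves `N` by `s ⟨N, σ⟩` times the unit vector `τ` orthogonal to the ray. To first order the
displacements add up, and since the translation lengths over fine partitions converge to `t μ`, the
sum is `t ∫ |⟨N, l⟩| dμ`, with `l` standing for a unit normal of the leaf. The errors are quadratic
in `t`: leaves across a short segment are almost parallel, moving the base point along the ray
contracts displacements exponentially, and the Thurston norm bounds the mass per unit length. This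
is `Frame.cmp_step`, `Frame.cmp_chain`, `Frame.cmp_block`, `Frame.ray_estimate`, and, after passing
to the boundary, `boundary_estimate`.

The isometries carried by the stratum of `x₀` are arbitrary, but the boundary maps are
differentiable in `t` by hypothesis. Three null directions determine an isometry, so these
isometries have a derivative at `0` (`differentiable_of_three_null`). It is skew, hence a cross
product with some vector `y₀`. Altogether (`IsInfinitesimalEarthquake.exists_tendsto`) `φ(η) = ⟨y₀,
η⟩ + lim ∫ |⟨η, l⟩| dμ(l)`, the integral running over the geodesics that meet longer and longer
pieces of the ray from `x₀` to `η`.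

The domain. Let `y(x) = y₀ + ∫ σ dμ` over the geodesics meeting `[x₀, x]`, and let `D` be the
intersection of the half-spaces `⟨p, x⟩ ≤ ⟨y(x), x⟩`. A comparison leaf by leaf gives `y(x) ∈ D`
(`messPoint_mem`), so `D` has support planes `y(x) + x^⊥` and dual lamination `μ`. Along the ray to
`η` the quantity `⟨y(x), η⟩` is exactly the expression above, so the support function at infinity is
`φ` (`supportFunction_messDomain`). Conversely `D` is cut out by the null half-spaces `⟨p, η⟩ ≤
φ(η)` alone (`mem_messDomain_of_forall_null`): the value at a point of a leaf is a positive
combination of the values at the two ends of the leaf, and a complementary region is controlled by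
the first leaves seen from a point in it, or by infinity.

Domain of dependence. The points at unit distance above the boundary of a future-convex set form the
graph of a convex function with a quadratic upper bound, hence a `C¹` spacelike surface
(`IsUnitLevel.exists_gradient`, `contDiff_of_gradient`). For `D` it contains all `y(x) + x`, so it
approaches the null support planes, and this forces every inextensible causal path to cross it
(`IsUnitLevel.isCauchySurface`). The surface determines `D`: a null line through a point with `⟨p,
η⟩ > φ(η)` in direction `η` keeps that inequality and never meets the surface
(`IsFutureConvex.isDomainOfDependence`). -/

lemma mink_comm (x y : V) : mink x y = mink y x := by simp only [mink]; ring

lemma mink_add_left (x y z : V) : mink (x + y) z = mink x z + mink y z := by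
  simp only [mink, Pi.add_apply]; ring

lemma mink_add_right (x y z : V) : mink x (y + z) = mink x y + mink x z := by
  simp only [mink, Pi.add_apply]; ring

lemma mink_sub_left (x y z : V) : mink (x - y) z = mink x z - mink y z := by
  simp only [mink, Pi.sub_apply]; ring

lemma mink_sub_right (x y z : V) : mink x (y - z) = mink x y - mink x z := by
  simp only [mink, Pi.sub_apply]; ring

lemma mink_smul_left (c : ℝ) (x y : V) : mink (c • x) y = c * mink x y := by
  simp only [mink, Pi.smul_apply, smul_eq_mul]; ring

lemma mink_smul_right (c : ℝ) (x y : V) : mink x (c • y) = c * mink x y := by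
  simp only [mink, Pi.smul_apply, smul_eq_mul]; ring

lemma mink_neg_right (x y : V) : mink x (-y) = -mink x y := by
  simp only [mink, Pi.neg_apply]; ring

lemma mink_zero_left (x : V) : mink 0 x = 0 := by simp [mink]

lemma mink_zero_right (x : V) : mink x 0 = 0 := by simp [mink]

lemma mcross_add_left (a b c : V) : mcross (a + b) c = mcross a c + mcross b c := by
  ext i; fin_cases i <;> simp [mcross] <;> ring

lemma mcross_add_right (a b c : V) : mcross a (b + c) = mcross a b + mcross a c := by
  ext i; fin_cases i <;> simp [mcross] <;> ring

lemma mcross_smul_left (k : ℝ) (a b : V) : mcross (k • a) b = k • mcross a b := by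
  ext i; fin_cases i <;> simp [mcross] <;> ring

lemma mcross_smul_right (k : ℝ) (a b : V) : mcross a (k • b) = k • mcross a b := by
  ext i; fin_cases i <;> simp [mcross] <;> ring

lemma mcross_self (a : V) : mcross a a = 0 := by
  ext i; fin_cases i <;> simp [mcross] <;> ring

lemma mcross_swap (a b : V) : mcross a b = -mcross b a := by
  ext i; fin_cases i <;> simp [mcross] <;> ring

lemma mink_mcross_left_self (a b : V) : mink (mcross a b) a = 0 := by
  simp [mink, mcross]; ring

lemma mink_mcross_right_self (a b : V) : mink (mcross a b) b = 0 := by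
  simp [mink, mcross]; ring

lemma mink_mcross_cycle (a b c : V) : mink (mcross a b) c = mink (mcross b c) a := by
  simp [mink, mcross]; ring

lemma mink_mcross_mcross (a b : V) :
    mink (mcross a b) (mcross a b) = mink a b ^ 2 - mink a a * mink b b := by
  simp [mink, mcross]; ring

lemma mcross_mcross (a b c : V) : mcross (mcross a b) c = mink b c • a - mink a c • b := by
  ext i; fin_cases i <;> simp [mcross, mink] <;> ring

/-- Cramer's rule in terms of the cross product. -/
lemma cramer (a b c w : V) : mink (mcross a b) c • w =
    mink w (mcross b c) • a + mink w (mcross c a) • b + mink w (mcross a b) • c := by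
  ext i; fin_cases i <;> simp [mcross, mink] <;> ring

/-! ### Causal vectors -/

lemma horizontal_inner_le {v w : V} (hv : mink v v ≤ 0) (hw : mink w w ≤ 0) (hv2 : 0 ≤ v 2)
    (hw2 : 0 ≤ w 2) : v 0 * w 0 + v 1 * w 1 ≤ v 2 * w 2 := by
  simp only [mink] at hv hw
  refine abs_le_of_sq_le_sq' ?_ (mul_nonneg hv2 hw2) |>.2
  have h1 : (v 0 * w 0 + v 1 * w 1) ^ 2 ≤ (v 0 ^ 2 + v 1 ^ 2) * (w 0 ^ 2 + w 1 ^ 2) := by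
    nlinarith [sq_nonneg (v 0 * w 1 - v 1 * w 0)]
  have h2 : (v 0 ^ 2 + v 1 ^ 2) * (w 0 ^ 2 + w 1 ^ 2) ≤ v 2 ^ 2 * w 2 ^ 2 := by
    apply mul_le_mul <;> nlinarith [sq_nonneg (w 0), sq_nonneg (w 1), sq_nonneg (v 2)]
  nlinarith

lemma mink_nonpos_of_causal {v w : V} (hv : mink v v ≤ 0) (hw : mink w w ≤ 0) (hv2 : 0 ≤ v 2)
    (hw2 : 0 ≤ w 2) : mink v w ≤ 0 := by
  have := horizontal_inner_le hv hw hv2 hw2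
  simp only [mink]; linarith

lemma mink_neg_of_timelike {v w : V} (hv : mink v v < 0) (hw : mink w w ≤ 0) (hv2 : 0 < v 2)
    (hw2 : 0 < w 2) : mink v w < 0 := by
  simp only [mink] at hv hw ⊢
  have h3 : v 0 * w 0 + v 1 * w 1 < v 2 * w 2 := by
    refine lt_of_pow_lt_pow_left₀ 2 (mul_pos hv2 hw2).le ?_
    have h1 : (v 0 * w 0 + v 1 * w 1) ^ 2 ≤ (v 0 ^ 2 + v 1 ^ 2) * (w 0 ^ 2 + w 1 ^ 2) := by
      nlinarith [sq_nonneg (v 0 * w 1 - v 1 * w 0)]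
    have h2 : (v 0 ^ 2 + v 1 ^ 2) * (w 0 ^ 2 + w 1 ^ 2) ≤ (v 0 ^ 2 + v 1 ^ 2) * w 2 ^ 2 := by
      apply mul_le_mul_of_nonneg_left <;> nlinarith [sq_nonneg (v 0), sq_nonneg (v 1)]
    have h4 : (v 0 ^ 2 + v 1 ^ 2) * w 2 ^ 2 < v 2 ^ 2 * w 2 ^ 2 := by
      apply mul_lt_mul_of_pos_right _ (by positivity); nlinarith
    nlinarith
  linarith

lemma mink_null_self (η : Circle) : mink (null η) (null η) = 0 := by
  have h := Circle.normSq_coe η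
  rw [Complex.normSq_apply] at h
  simp [mink, null]; linarith

lemma null_two (η : Circle) : null η 2 = 1 := by simp [null]

lemma null_two_pos (η : Circle) : 0 < null η 2 := by simp [null]

lemma Hyp.mink_self (x : Hyp) : mink x.1 x.1 = -1 := x.2.1

lemma Hyp.two_pos (x : Hyp) : 0 < x.1 2 := x.2.2

lemma Hyp.mink_null_neg (x : Hyp) (η : Circle) : mink x.1 (null η) < 0 :=
  mink_neg_of_timelike (by rw [x.mink_self]; norm_num) (mink_null_self η).le x.two_pos
    (null_two_pos η)

lemma Hyp.mink_neg (x y : Hyp) : mink x.1 y.1 < 0 :=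
  mink_neg_of_timelike (by rw [x.mink_self]; norm_num) (by rw [y.mink_self]; norm_num) x.two_pos
    y.two_pos

lemma mink_null_null (a b : Circle) : mink (null a) (null b) =
    -(((a : ℂ).re - (b : ℂ).re) ^ 2 + ((a : ℂ).im - (b : ℂ).im) ^ 2) / 2 := by
  have ha := mink_null_self a
  have hb := mink_null_self b
  simp [mink, null] at *; linarith

lemma mink_null_null_neg {a b : Circle} (h : a ≠ b) : mink (null a) (null b) < 0 := by
  rw [mink_null_null]
  by_contra! hc
  apply h
  have h1 : ((a : ℂ).re - (b : ℂ).re) = 0 := by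
    have := sq_nonneg ((a : ℂ).re - (b : ℂ).re)
    have := sq_nonneg ((a : ℂ).im - (b : ℂ).im)
    exact pow_eq_zero_iff (two_ne_zero) |>.1 (by linarith)
  have h2 : ((a : ℂ).im - (b : ℂ).im) = 0 := by
    have := sq_nonneg ((a : ℂ).re - (b : ℂ).re)
    have := sq_nonneg ((a : ℂ).im - (b : ℂ).im)
    exact pow_eq_zero_iff (two_ne_zero) |>.1 (by linarith)
  exact Circle.ext (Complex.ext (by linarith) (by linarith))

/-- A future timelike vector is a positive multiple of a point of the hyperboloid. -/
lemma exists_smul_mem_hyp {w : V} (hw : mink w w < 0) (hw2 : 0 < w 2) :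
    ∃ c : ℝ, 0 < c ∧ ∃ z : Hyp, z.1 = c • w := by
  have hs : 0 < √(-mink w w) := Real.sqrt_pos.2 (by linarith)
  refine ⟨(√(-mink w w))⁻¹, by positivity, ⟨(√(-mink w w))⁻¹ • w, ?_, ?_⟩, rfl⟩
  · rw [mink_smul_left, mink_smul_right, ← mul_assoc, ← mul_inv, Real.mul_self_sqrt (by linarith)]
    field_simp
    rw [div_self hw.ne]
  · simp only [Pi.smul_apply, smul_eq_mul]; positivity

lemma Hyp.eq_of_smul {x y : Hyp} {c : ℝ} (h : x.1 = c • y.1) : x = y := by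
  have h1 := x.mink_self
  rw [h, mink_smul_left, mink_smul_right, y.mink_self] at h1
  have h2 := x.two_pos
  rw [h] at h2
  simp only [Pi.smul_apply, smul_eq_mul] at h2
  have hc : 0 < c := by
    by_contra! hc; nlinarith [y.two_pos]
  have : c = 1 := by nlinarith
  exact Subtype.ext (by rw [h, this, one_smul])

/-! ### Normals of geodesics -/

lemma mink_normal_left (a b : Circle) : mink (null a) (normal a b) = 0 := by
  rw [normal, mink_smul_right, mink_comm _ (mcross _ _), mink_mcross_left_self, mul_zero]

lemma mink_normal_right (a b : Circle) : mink (null b) (normal a b) = 0 := by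
  rw [normal, mink_smul_right, mink_comm _ (mcross _ _), mink_mcross_right_self, mul_zero]

lemma mink_normal_self {a b : Circle} (h : a ≠ b) : mink (normal a b) (normal a b) = 1 := by
  have := (mink_null_null_neg h).ne
  rw [normal, mink_smul_left, mink_smul_right, mink_mcross_mcross, mink_null_self, mink_null_self]
  field_simp; ring

/-- The two ideal endpoints and the unit normal form a basis in which the coordinates are read off
by pairing, because each null vector is orthogonal to itself and to the normal. Cramer's rule gives
the formula. -/
lemma normal_decomp {a b : Circle} (h : a ≠ b) (w : V) :
    w = (mink w (null b) / mink (null a) (null b)) • null a +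
      (mink w (null a) / mink (null a) (null b)) • null b + mink w (normal a b) • normal a b := by
  have h0 := (mink_null_null_neg h).ne
  have h1 : mcross (null b) (normal a b) = null b := by
    rw [normal, mcross_smul_right, mcross_swap, mcross_mcross, mink_null_self]
    rw [zero_smul, zero_sub, neg_neg, smul_smul, inv_mul_cancel₀ h0, one_smul]
  have h2 : mcross (normal a b) (null a) = null a := by
    rw [normal, mcross_smul_left, mcross_mcross, mink_null_self, zero_smul, sub_zero, smul_smul,
      mink_comm (null b), inv_mul_cancel₀ h0, one_smul]
  have h3 : mcross (null a) (null b) = mink (null a) (null b) • normal a b := by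
    rw [normal, smul_smul, mul_inv_cancel₀ h0, one_smul]
  have h4 := cramer (null a) (null b) (normal a b) w
  rw [h1, h2, h3, mink_smul_left, mink_normal_self h, mul_one, mink_smul_right] at h4
  apply smul_right_injective _ h0
  beta_reduce
  rw [h4]
  ext i
  simp only [Pi.add_apply, Pi.smul_apply, smul_eq_mul]
  field_simp

/-- The first endpoint of a geodesic, in some order. -/
noncomputable def Geodesic.fst (l : Geodesic) : Circle := (Quot.out l.1).1

/-- The second endpoint of a geodesic. -/
noncomputable def Geodesic.snd (l : Geodesic) : Circle := (Quot.out l.1).2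

/-- A unit normal of a geodesic. -/
noncomputable def Geodesic.nrm (l : Geodesic) : V := normal l.fst l.snd

lemma Geodesic.mk_fst_snd (l : Geodesic) : l.1 = s(l.fst, l.snd) := by
  conv_lhs => rw [← Quot.out_eq l.1]
  rfl

lemma Geodesic.fst_ne_snd (l : Geodesic) : l.fst ≠ l.snd := by
  have := l.2
  rw [l.mk_fst_snd, Sym2.mk_isDiag_iff] at this
  exact this

lemma Geodesic.nrm_eq_or {l : Geodesic} {a b : Circle} (h : l.1 = s(a, b)) :
    normal a b = l.nrm ∨ normal a b = -l.nrm := by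
  rw [l.mk_fst_snd, Sym2.eq_iff] at h
  rcases h with ⟨h1, h2⟩ | ⟨h1, h2⟩
  · left; rw [Geodesic.nrm, h1, h2]
  · right; rw [Geodesic.nrm, h1, h2, normal_swap a b, neg_neg]

lemma Geodesic.mink_nrm_self (l : Geodesic) : mink l.nrm l.nrm = 1 :=
  mink_normal_self l.fst_ne_snd

lemma Geodesic.mink_fst_nrm (l : Geodesic) : mink (null l.fst) l.nrm = 0 := mink_normal_left _ _

lemma Geodesic.mink_snd_nrm (l : Geodesic) : mink (null l.snd) l.nrm = 0 := mink_normal_right _ _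

/-- On `σ^⊥` the coordinates of `x` along the endpoints are quotients of two negative pairings, so
their positivity is automatic. -/
lemma Geodesic.mem_points_iff {l : Geodesic} {x : Hyp} : x ∈ l.points ↔ mink x.1 l.nrm = 0 := by
  constructor
  · rintro ⟨a, b, hl, u, v, -, -, hx⟩
    have h1 : mink x.1 (normal a b) = 0 := by
      rw [hx, mink_add_left, mink_smul_left, mink_smul_left, mink_normal_left, mink_normal_right]
      simp
    rcases Geodesic.nrm_eq_or hl with h | h
    · rwa [h] at h1
    · rw [h, mink_neg_right] at h1; linarith
  · intro h
    have h0 := mink_null_null_neg l.fst_ne_snd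
    refine ⟨l.fst, l.snd, l.mk_fst_snd, _, _, div_pos_of_neg_of_neg (x.mink_null_neg l.snd) h0,
      div_pos_of_neg_of_neg (x.mink_null_neg l.fst) h0, ?_⟩
    conv_lhs => rw [normal_decomp l.fst_ne_snd x.1]
    rw [show mink x.1 (normal l.fst l.snd) = 0 from h, zero_smul, add_zero]

/-! ### Segments and the geodesics that cross them -/

lemma seg_coeff_pos {x y z : Hyp} {a b : ℝ} (ha : 0 ≤ a) (hb : 0 ≤ b)
    (hz : z.1 = a • x.1 + b • y.1) : 0 < a ∨ 0 < b := by
  by_contra! h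
  have h1 := z.two_pos
  rw [hz, le_antisymm h.1 ha, le_antisymm h.2 hb] at h1
  simp at h1

lemma timelike_combination (x y : Hyp) {a b : ℝ} (ha : 0 ≤ a) (hb : 0 ≤ b) (hab : 0 < a + b) :
    mink (a • x.1 + b • y.1) (a • x.1 + b • y.1) < 0 ∧ 0 < (a • x.1 + b • y.1) 2 := by
  have hxy := x.mink_neg y
  constructor
  · simp only [mink_add_left, mink_add_right, mink_smul_left, mink_smul_right, x.mink_self,
      y.mink_self, mink_comm y.1 x.1]
    have : 0 ≤ a * b := mul_nonneg ha hb
    rcases ha.eq_or_lt with h | h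
    · subst h; nlinarith
    · nlinarith
  · simp only [Pi.add_apply, Pi.smul_apply, smul_eq_mul]
    rcases ha.eq_or_lt with h | h
    · subst h; nlinarith [y.two_pos]
    · nlinarith [mul_pos h x.two_pos, mul_nonneg hb y.two_pos.le]

lemma exists_mem_seg (x y : Hyp) {a b : ℝ} (ha : 0 ≤ a) (hb : 0 ≤ b) (hab : 0 < a + b) :
    ∃ c : ℝ, 0 < c ∧ ∃ z ∈ seg x y, z.1 = c • (a • x.1 + b • y.1) := by
  obtain ⟨h1, h2⟩ := timelike_combination x y ha hb hab
  obtain ⟨c, hc, z, hz⟩ := exists_smul_mem_hyp h1 h2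
  refine ⟨c, hc, z, ⟨c * a, c * b, by positivity, by positivity, ?_⟩, hz⟩
  rw [hz, smul_add, smul_smul, smul_smul]

lemma left_mem_seg (x y : Hyp) : x ∈ seg x y := ⟨1, 0, by simp, le_rfl, by simp⟩

lemma right_mem_seg (x y : Hyp) : y ∈ seg x y := ⟨0, 1, le_rfl, by simp, by simp⟩

lemma seg_subset_seg {x y z w : Hyp} (hz : z ∈ seg x y) (hw : w ∈ seg x y) :
    seg z w ⊆ seg x y := by
  rintro u ⟨a, b, ha, hb, hu⟩
  obtain ⟨a1, b1, ha1, hb1, hz⟩ := hz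
  obtain ⟨a2, b2, ha2, hb2, hw⟩ := hw
  refine ⟨a * a1 + b * a2, a * b1 + b * b2, by positivity, by positivity, ?_⟩
  rw [hu, hz, hw]; module

lemma meeting_mono {B B' : Set Hyp} (h : B ⊆ B') : meeting B ⊆ meeting B' :=
  fun _ hl => hl.mono (inter_subset_inter_right _ h)

lemma exists_mem_seg_mink_eq_zero {x y : Hyp} {σ : V} (h : mink x.1 σ * mink y.1 σ ≤ 0) :
    ∃ z ∈ seg x y, mink z.1 σ = 0 := by
  by_cases h0 : mink x.1 σ = 0
  · exact ⟨x, left_mem_seg x y, h0⟩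
  · obtain ⟨c, hc, z, hz, hzc⟩ := exists_mem_seg x y (abs_nonneg (mink y.1 σ))
      (abs_nonneg (mink x.1 σ)) (by positivity)
    refine ⟨z, hz, ?_⟩
    rw [hzc, mink_smul_left, mink_add_left, mink_smul_left, mink_smul_left]
    rcases lt_or_gt_of_ne h0 with h1 | h1
    · have h2 : 0 ≤ mink y.1 σ := by nlinarith
      rw [abs_of_neg h1, abs_of_nonneg h2]; ring
    · have h2 : mink y.1 σ ≤ 0 := by nlinarith
      rw [abs_of_pos h1, abs_of_nonpos h2]; ring

lemma mink_mul_nonpos_of_mem_seg {x y z : Hyp} {σ : V} (hz : z ∈ seg x y)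
    (h : mink z.1 σ = 0) : mink x.1 σ * mink y.1 σ ≤ 0 := by
  obtain ⟨a, b, ha, hb, hz'⟩ := hz
  have hab := seg_coeff_pos ha hb hz'
  rw [hz', mink_add_left, mink_smul_left, mink_smul_left] at h
  by_contra! hc
  rcases pos_and_pos_or_neg_and_neg_of_mul_pos hc with ⟨h1, h2⟩ | ⟨h1, h2⟩
  · rcases hab with h3 | h3
    · nlinarith [mul_pos h3 h1, mul_nonneg hb h2.le]
    · nlinarith [mul_pos h3 h2, mul_nonneg ha h1.le]
  · rcases hab with h3 | h3
    · nlinarith [mul_neg_of_pos_of_neg h3 h1, mul_nonpos_of_nonneg_of_nonpos hb h2.le]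
    · nlinarith [mul_neg_of_pos_of_neg h3 h2, mul_nonpos_of_nonneg_of_nonpos ha h1.le]

/-- Crossing becomes a weak sign condition that is even in the normal, so it makes sense on
unoriented geodesics and is closed. Geodesics through an endpoint of the segment count as crossing.
-/
lemma mem_meeting_seg {l : Geodesic} {x y : Hyp} :
    l ∈ meeting (seg x y) ↔ mink x.1 l.nrm * mink y.1 l.nrm ≤ 0 := by
  constructor
  · rintro ⟨z, hz, hzs⟩
    exact mink_mul_nonpos_of_mem_seg hzs (Geodesic.mem_points_iff.1 hz)
  · intro h
    obtain ⟨z, hz, hz0⟩ := exists_mem_seg_mink_eq_zero h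
    exact ⟨z, Geodesic.mem_points_iff.2 hz0, hz⟩

lemma sigma_eq (x₀ x : Hyp) (l : Geodesic) :
    sigma x₀ x l = Real.sign (mink x.1 l.nrm - mink x₀.1 l.nrm) • l.nrm := by
  unfold sigma
  rw [l.mk_fst_snd, Sym2.lift_mk]
  simp only [Geodesic.nrm, mink_comm]

/-! ### Topology of the space of geodesics -/

/-- The geodesic with given distinct endpoints. -/
def Geodesic.mk (p : {p : Circle × Circle // p.1 ≠ p.2}) : Geodesic :=
  ⟨s(p.1.1, p.1.2), by rw [Sym2.mk_isDiag_iff]; exact p.2⟩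

lemma Geodesic.mk_surjective : Function.Surjective Geodesic.mk := fun l =>
  ⟨⟨(l.fst, l.snd), l.fst_ne_snd⟩, Subtype.ext l.mk_fst_snd.symm⟩

lemma isOpenMap_sym2_mk : IsOpenMap (Quot.mk (Sym2.Rel Circle) : Circle × Circle → Sym2 Circle) := by
  intro W hW
  rw [← isQuotientMap_quot_mk.isOpen_preimage]
  have : Quot.mk (Sym2.Rel Circle) ⁻¹' (Quot.mk (Sym2.Rel Circle) '' W) =
      W ∪ Prod.swap ⁻¹' W := by
    ext ⟨a, b⟩
    constructor
    · rintro ⟨⟨c, d⟩, hw, h⟩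
      have h' : s(c, d) = s(a, b) := h
      rw [Sym2.eq_iff] at h'
      rcases h' with ⟨rfl, rfl⟩ | ⟨rfl, rfl⟩
      · exact Or.inl hw
      · exact Or.inr hw
    · rintro (h | h)
      · exact ⟨_, h, rfl⟩
      · exact ⟨_, h, Sym2.eq_swap⟩
  rw [this]
  exact hW.union (hW.preimage continuous_swap)

lemma Geodesic.isOpenQuotientMap_mk : IsOpenQuotientMap Geodesic.mk where
  surjective := Geodesic.mk_surjective
  continuous := by
    refine Continuous.subtype_mk ?_ _
    exact continuous_quot_mk.comp continuous_subtype_val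
  isOpenMap := by
    intro U hU
    obtain ⟨W, hW, rfl⟩ := isOpen_induced_iff.1 hU
    refine isOpen_induced_iff.2 ⟨_, isOpenMap_sym2_mk W hW, ?_⟩
    ext l
    constructor
    · rintro ⟨⟨a, b⟩, hw, h⟩
      have h' : s(a, b) = l.1 := h
      have hab : a ≠ b := by
        have := l.2
        rwa [← h', Sym2.mk_isDiag_iff] at this
      exact ⟨⟨(a, b), hab⟩, hw, Subtype.ext h'⟩
    · rintro ⟨p, hp, rfl⟩
      exact ⟨p.1, hp, rfl⟩

instance : SecondCountableTopology Geodesic :=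
  Geodesic.isOpenQuotientMap_mk.isQuotientMap.secondCountableTopology
    Geodesic.isOpenQuotientMap_mk.isOpenMap

lemma Geodesic.nrm_mk (p : {p : Circle × Circle // p.1 ≠ p.2}) :
    normal p.1.1 p.1.2 = (Geodesic.mk p).nrm ∨ normal p.1.1 p.1.2 = -(Geodesic.mk p).nrm :=
  Geodesic.nrm_eq_or rfl

lemma continuous_null : Continuous null := by
  refine continuous_pi fun i => ?_
  fin_cases i
  · exact Complex.continuous_re.comp continuous_subtype_val
  · exact Complex.continuous_im.comp continuous_subtype_val
  · exact continuous_const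

lemma continuous_mink : Continuous fun p : V × V => mink p.1 p.2 := by
  unfold mink; fun_prop

lemma Continuous.mink {X : Type*} [TopologicalSpace X] {f g : X → V} (hf : Continuous f)
    (hg : Continuous g) : Continuous fun x => Mink.mink (f x) (g x) :=
  continuous_mink.comp (hf.prodMk hg)

lemma continuous_mcross : Continuous fun p : V × V => mcross p.1 p.2 := by
  refine continuous_pi fun i => ?_
  fin_cases i <;> simp [mcross] <;> fun_prop

lemma continuous_normal : Continuous fun p : {p : Circle × Circle // p.1 ≠ p.2} =>
    normal p.1.1 p.1.2 := by
  have h1 : Continuous fun p : {p : Circle × Circle // p.1 ≠ p.2} => null p.1.1 :=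
    continuous_null.comp (continuous_fst.comp continuous_subtype_val)
  have h2 : Continuous fun p : {p : Circle × Circle // p.1 ≠ p.2} => null p.1.2 :=
    continuous_null.comp (continuous_snd.comp continuous_subtype_val)
  exact (Continuous.inv₀ (Continuous.mink h1 h2) fun p => (mink_null_null_neg p.2).ne).smul
    (continuous_mcross.comp (h1.prodMk h2))

/-- An even continuous function of the normal is continuous on the space of geodesics. -/
lemma continuous_even_nrm {X : Type*} [TopologicalSpace X] {G : V → X} (hG : Continuous G)
    (he : ∀ v, G (-v) = G v) : Continuous fun l : Geodesic => G l.nrm := by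
  rw [← Geodesic.isOpenQuotientMap_mk.continuous_comp_iff]
  have : ((fun l : Geodesic => G l.nrm) ∘ Geodesic.mk) = fun p => G (normal p.1.1 p.1.2) := by
    funext p
    rcases Geodesic.nrm_mk p with h | h
    · rw [h]; rfl
    · rw [h, he]; rfl
  rw [this]
  exact hG.comp continuous_normal

lemma isClosed_meeting_seg (x y : Hyp) : IsClosed (meeting (seg x y)) := by
  have : meeting (seg x y) = (fun l : Geodesic => mink x.1 l.nrm * mink y.1 l.nrm) ⁻¹' Iic 0 := by
    ext l; exact mem_meeting_seg
  rw [this]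
  refine isClosed_Iic.preimage (continuous_even_nrm (G := fun v => mink x.1 v * mink y.1 v) ?_ ?_)
  · exact (Continuous.mink continuous_const continuous_id).mul
      (Continuous.mink continuous_const continuous_id)
  · intro v; simp only [mink_neg_right]; ring

lemma measurableSet_meeting_seg (x y : Hyp) : MeasurableSet (meeting (seg x y)) :=
  (isClosed_meeting_seg x y).measurableSet

/-- Since `⟨x, y⟩ ≤ -1`, the normalization of `z = a x + b y` forces `a + b ≤ 1`. -/
lemma two_le_max_of_mem_seg {x y z : Hyp} (hz : z ∈ seg x y) : z.1 2 ≤ max (x.1 2) (y.1 2) := by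
  obtain ⟨a, b, ha, hb, hz⟩ := hz
  have hxy : mink x.1 y.1 ≤ -1 := by
    have h1 := x.mink_self
    have h2 := y.mink_self
    have hx := x.two_pos
    have hy := y.two_pos
    simp only [mink] at *
    set x0 := x.1 0; set x1 := x.1 1; set x2 := x.1 2
    set y0 := y.1 0; set y1 := y.1 1; set y2 := y.1 2
    have : x0 * y0 + x1 * y1 + 1 ≤ x2 * y2 := by
      refine abs_le_of_sq_le_sq' ?_ (mul_pos hx hy).le |>.2
      have e : (x2 * y2) ^ 2 = (1 + x0 ^ 2 + x1 ^ 2) * (1 + y0 ^ 2 + y1 ^ 2) := by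
        rw [mul_pow]; congr 1 <;> linarith
      nlinarith [sq_nonneg (x0 - y0), sq_nonneg (x1 - y1), sq_nonneg (x0 * y1 - x1 * y0)]
    linarith
  have hz1 := z.mink_self
  rw [hz] at hz1
  simp only [mink_add_left, mink_add_right, mink_smul_left, mink_smul_right, x.mink_self,
      y.mink_self, mink_comm y.1 x.1] at hz1
  have hab : a + b ≤ 1 := by
    have : (a + b) ^ 2 ≤ 1 := by nlinarith [mul_nonneg ha hb]
    nlinarith
  rw [hz]
  simp only [Pi.add_apply, Pi.smul_apply, smul_eq_mul]
  have h1 := mul_le_mul_of_nonneg_left (le_max_left (x.1 2) (y.1 2)) ha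
  have h2 := mul_le_mul_of_nonneg_left (le_max_right (x.1 2) (y.1 2)) hb
  have h3 : 0 ≤ max (x.1 2) (y.1 2) := le_max_of_le_left x.two_pos.le
  nlinarith

/-- A geodesic through a point of bounded height has endpoints a definite distance apart: if `z = u
a + v b`, then `2 u v ⟨a, b⟩ = -1`, while `u + v` is the height of `z`. So the crossing geodesics
lie in the image of a compact set of pairs away from the diagonal. -/
lemma isCompact_meeting_seg (x y : Hyp) : IsCompact (meeting (seg x y)) := by
  set m := max (x.1 2) (y.1 2)
  have hm : 0 < m := lt_max_of_lt_left x.two_pos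
  set K : Set (Circle × Circle) := {p | mink (null p.1) (null p.2) ≤ -(2 / m ^ 2)}
  have hK : IsCompact K := by
    apply IsClosed.isCompact
    exact isClosed_le (Continuous.mink (continuous_null.comp continuous_fst)
      (continuous_null.comp continuous_snd)) continuous_const
  have hK' : IsCompact ((↑) ⁻¹' K : Set {p : Circle × Circle // p.1 ≠ p.2}) := by
    rw [Subtype.isCompact_iff]
    convert hK using 1
    rw [image_preimage_eq_iff, Subtype.range_coe_subtype]
    intro p hp hd
    have h1 : mink (null p.1) (null p.2) ≤ -(2 / m ^ 2) := hp
    rw [hd, mink_null_self] at h1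
    have : 0 < 2 / m ^ 2 := by positivity
    linarith
  refine (hK'.image Geodesic.isOpenQuotientMap_mk.continuous).of_isClosed_subset
    (isClosed_meeting_seg x y) ?_
  rintro l ⟨z, ⟨a, b, hl, u, v, hu, hv, hz⟩, hzs⟩
  have hab : a ≠ b := by
    have := l.2
    rwa [hl, Sym2.mk_isDiag_iff] at this
  refine ⟨⟨(a, b), hab⟩, ?_, Subtype.ext hl.symm⟩
  have h1 := z.mink_self
  have h2 := two_le_max_of_mem_seg hzs
  rw [hz] at h1 h2
  simp only [mink_add_left, mink_add_right, mink_smul_left, mink_smul_right, mink_null_self,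
    mink_comm (null b) (null a)] at h1
  simp only [Pi.add_apply, Pi.smul_apply, smul_eq_mul, null_two, mul_one] at h2
  change mink (null a) (null b) ≤ -(2 / m ^ 2)
  have h3 : u * v * (-mink (null a) (null b)) = 1 / 2 := by linarith
  have h4 : u * v ≤ m ^ 2 / 4 := by
    have : (u + v) ^ 2 ≤ m ^ 2 := pow_le_pow_left₀ (by positivity) h2 2
    nlinarith [sq_nonneg (u - v)]
  have h5 : 0 < -mink (null a) (null b) := by linarith [mink_null_null_neg hab]
  rw [le_neg, div_le_iff₀ (by positivity)]
  nlinarith [mul_le_mul_of_nonneg_right h4 h5.le]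

lemma Geodesic.isClosed_singleton (l : Geodesic) : IsClosed ({l} : Set Geodesic) := by
  rw [← Geodesic.isOpenQuotientMap_mk.isQuotientMap.isClosed_preimage]
  have : Geodesic.mk ⁻¹' {l} =
      (↑) ⁻¹' ({(l.fst, l.snd), (l.snd, l.fst)} : Set (Circle × Circle)) := by
    ext ⟨⟨a, b⟩, hab⟩
    simp only [mem_preimage, mem_singleton_iff, mem_insert_iff]
    have h1 : Geodesic.mk ⟨(a, b), hab⟩ = l ↔ s(a, b) = l.1 := Subtype.ext_iff
    rw [h1, l.mk_fst_snd, Sym2.eq_iff]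
    simp only [Prod.mk.injEq]
  rw [this]
  exact (Set.toFinite _).isClosed.preimage continuous_subtype_val

/-! ### Measurability of the normal field -/

lemma continuousAt_sigma {x₀ x : Hyp} {l : Geodesic}
    (h : mink x.1 l.nrm - mink x₀.1 l.nrm ≠ 0) : ContinuousAt (sigma x₀ x) l := by
  obtain ⟨p, rfl⟩ := Geodesic.mk_surjective l
  rw [← Geodesic.isOpenQuotientMap_mk.continuousAt_comp_iff]
  set d : {p : Circle × Circle // p.1 ≠ p.2} → ℝ := fun p =>
    mink (normal p.1.1 p.1.2) x.1 - mink (normal p.1.1 p.1.2) x₀.1 with hd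
  have hdc : Continuous d := (Continuous.mink continuous_normal continuous_const).sub
    (Continuous.mink continuous_normal continuous_const)
  have hdp : d p ≠ 0 := by
    simp only [hd]
    rcases Geodesic.nrm_mk p with h' | h'
    · rw [h', mink_comm, mink_comm _ x₀.1]; exact h
    · rw [h', mink_comm, mink_comm _ x₀.1, mink_neg_right, mink_neg_right]
      intro h''; apply h; linarith
  have heq : sigma x₀ x ∘ Geodesic.mk = fun p => Real.sign (d p) • normal p.1.1 p.1.2 := rfl
  rw [heq]
  rcases lt_or_gt_of_ne hdp with h1 | h1
  · have : (fun p => Real.sign (d p) • normal p.1.1 p.1.2) =ᶠ[𝓝 p]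
        fun p => (-1 : ℝ) • normal p.1.1 p.1.2 := by
      filter_upwards [hdc.continuousAt.eventually (gt_mem_nhds h1)] with q hq
      rw [Real.sign_of_neg hq]
    exact (ContinuousAt.congr_of_eventuallyEq
      (continuous_normal.const_smul (-1 : ℝ)).continuousAt this)
  · have : (fun p => Real.sign (d p) • normal p.1.1 p.1.2) =ᶠ[𝓝 p]
        fun p => (1 : ℝ) • normal p.1.1 p.1.2 := by
      filter_upwards [hdc.continuousAt.eventually (lt_mem_nhds h1)] with q hq
      rw [Real.sign_of_pos hq]
    exact (ContinuousAt.congr_of_eventuallyEq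
      (continuous_normal.const_smul (1 : ℝ)).continuousAt this)

/-- The outward normal is continuous where `x₀` and `x` pair differently with the normal, because
the sign is locally constant there, and it vanishes elsewhere. The square makes the defining
condition of that open set even. -/
lemma measurable_sigma (x₀ x : Hyp) : Measurable (sigma x₀ x) := by
  classical
  set O : Set Geodesic := {l | (mink x.1 l.nrm - mink x₀.1 l.nrm) ^ 2 ≠ 0}
  have hO : IsOpen O := by
    refine isOpen_ne.preimage (continuous_even_nrm
      (G := fun v => (mink x.1 v - mink x₀.1 v) ^ 2) ?_ ?_)
    · exact ((Continuous.mink continuous_const continuous_id).sub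
        (Continuous.mink continuous_const continuous_id)).pow 2
    · intro v; simp only [mink_neg_right]; ring
  have h1 : sigma x₀ x = O.piecewise (sigma x₀ x) fun _ => 0 := by
    funext l
    by_cases hl : l ∈ O
    · rw [piecewise_eq_of_mem _ _ _ hl]
    · rw [piecewise_eq_of_notMem _ _ _ hl]
      have : mink x.1 l.nrm - mink x₀.1 l.nrm = 0 := by
        simpa [O] using hl
      rw [sigma_eq, this, Real.sign_zero, zero_smul]
  rw [h1]
  refine ContinuousOn.measurable_piecewise (fun l hl => ?_) continuousOn_const hO.measurableSet
  refine (continuousAt_sigma ?_).continuousWithinAt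
  intro h; exact hl (by rw [h]; simp)

lemma norm_sigma_le (x₀ x : Hyp) (l : Geodesic) : ‖sigma x₀ x l‖ ≤ ‖l.nrm‖ := by
  rw [sigma_eq, norm_smul]
  refine mul_le_of_le_one_left (norm_nonneg _) ?_
  rcases Real.sign_apply_eq (mink x.1 l.nrm - mink x₀.1 l.nrm) with h | h | h <;> rw [h] <;> simp

lemma integrableOn_sigma (μ : Measure Geodesic) [IsLocallyFiniteMeasure μ] (x₀ x y z : Hyp) :
    IntegrableOn (sigma x₀ x) (meeting (seg y z)) μ := by
  have hK := isCompact_meeting_seg y z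
  obtain ⟨C, hC⟩ := hK.exists_bound_of_continuousOn (f := fun l : Geodesic => ‖l.nrm‖)
    (continuous_even_nrm continuous_norm norm_neg).continuousOn
  refine Measure.integrableOn_of_bounded hK.measure_lt_top.ne
    (measurable_sigma x₀ x).aestronglyMeasurable (M := C) ?_
  refine (ae_restrict_iff' (measurableSet_meeting_seg y z)).2 (.of_forall fun l hl => ?_)
  exact (norm_sigma_le x₀ x l).trans ((le_abs_self _).trans (hC l hl))

lemma continuous_abs_mink_nrm (v : V) : Continuous fun l : Geodesic => |mink v l.nrm| :=
  continuous_even_nrm (G := fun w => |mink v w|)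
    (Continuous.mink continuous_const continuous_id).abs
    (fun w => by simp only [mink_neg_right, abs_neg])

lemma integrableOn_abs_mink (μ : Measure Geodesic) [IsLocallyFiniteMeasure μ] (v : V) (y z : Hyp) :
    IntegrableOn (fun l : Geodesic => |mink v l.nrm|) (meeting (seg y z)) μ :=
  (continuous_abs_mink_nrm v).continuousOn.integrableOn_compact' (isCompact_meeting_seg y z)
    (measurableSet_meeting_seg y z)

/-! ### Weighted leaves -/

lemma countable_weighted (μ : Measure Geodesic) [IsLocallyFiniteMeasure μ] :
    {l : Geodesic | 0 < μ {l}}.Countable :=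
  Measure.countable_meas_pos_of_disjoint_iUnion (fun l => l.isClosed_singleton.measurableSet)
    fun _ _ h => disjoint_singleton.2 h

/-- At most one geodesic of the support passes through `z`, and the complement of the support is
null. Thus a point off the weighted leaves can be used to split segments without counting mass
twice. -/
lemma measure_through_eq_zero {μ : Measure Geodesic} (hμ : IsMeasuredLamination μ) {z : Hyp}
    (hz : OffWeightedLeaves μ z) : μ {l | z ∈ l.points} = 0 := by
  have h0 : μ ({l | z ∈ l.points} ∩ μ.support) = 0 := by
    by_cases hne : ({l | z ∈ l.points} ∩ μ.support).Nonempty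
    · obtain ⟨l, hl, hls⟩ := hne
      refine measure_mono_null ?_ (hz l hl)
      rintro l' ⟨hl', hls'⟩
      by_contra hne
      exact (hμ.2.2 hls' hls hne).le_bot ⟨hl', hl⟩
    · rw [not_nonempty_iff_eq_empty.1 hne, measure_empty]
  refine measure_mono_null (t := ({l | z ∈ l.points} ∩ μ.support) ∪ μ.supportᶜ) ?_
    (measure_union_null h0 Measure.measure_compl_support)
  intro l hl
  by_cases h : l ∈ μ.support
  · exact Or.inl ⟨hl, h⟩
  · exact Or.inr h

lemma meeting_seg_union {x y z : Hyp} (hz : z ∈ seg x y) :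
    meeting (seg x y) = meeting (seg x z) ∪ meeting (seg z y) := by
  ext l
  constructor
  · intro h
    rw [mem_meeting_seg] at h
    rw [mem_union, mem_meeting_seg, mem_meeting_seg]
    by_contra! hc
    rcases pos_and_pos_or_neg_and_neg_of_mul_pos hc.1 with ⟨h1, h2⟩ | ⟨h1, h2⟩ <;>
    rcases pos_and_pos_or_neg_and_neg_of_mul_pos hc.2 with ⟨h3, h4⟩ | ⟨h3, h4⟩ <;> nlinarith
  · rintro (h | h)
    · exact meeting_mono (seg_subset_seg (left_mem_seg x y) hz) h
    · exact meeting_mono (seg_subset_seg hz (right_mem_seg x y)) h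

lemma meeting_seg_inter_subset {x y z : Hyp} (hz : z ∈ seg x y) :
    meeting (seg x z) ∩ meeting (seg z y) ⊆ {l | z ∈ l.points} := by
  rintro l ⟨h1, h2⟩
  rw [mem_meeting_seg] at h1 h2
  change z ∈ l.points
  rw [Geodesic.mem_points_iff]
  obtain ⟨a, b, ha, hb, hz⟩ := hz
  have h3 : mink z.1 l.nrm = a * mink x.1 l.nrm + b * mink y.1 l.nrm := by
    rw [hz, mink_add_left, mink_smul_left, mink_smul_left]
  have h4 : mink z.1 l.nrm ^ 2 ≤ 0 := by
    calc mink z.1 l.nrm ^ 2 = mink z.1 l.nrm * mink z.1 l.nrm := sq _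
      _ = a * (mink x.1 l.nrm * mink z.1 l.nrm) + b * (mink z.1 l.nrm * mink y.1 l.nrm) := by
        nth_rewrite 1 [h3]; ring
      _ ≤ 0 := by nlinarith [mul_nonneg ha (neg_nonneg.2 h1), mul_nonneg hb (neg_nonneg.2 h2)]
  exact pow_eq_zero_iff two_ne_zero |>.1 (le_antisymm h4 (sq_nonneg _))

lemma aedisjoint_meeting {μ : Measure Geodesic} (hμ : IsMeasuredLamination μ) {x y z : Hyp}
    (hz : z ∈ seg x y) (hoff : OffWeightedLeaves μ z) :
    AEDisjoint μ (meeting (seg x z)) (meeting (seg z y)) :=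
  measure_mono_null (meeting_seg_inter_subset hz) (measure_through_eq_zero hμ hoff)

lemma measureReal_meeting_add {μ : Measure Geodesic} (hμ : IsMeasuredLamination μ) {x y z : Hyp}
    (hz : z ∈ seg x y) (hoff : OffWeightedLeaves μ z) :
    (μ (meeting (seg x y))).toReal =
      (μ (meeting (seg x z))).toReal + (μ (meeting (seg z y))).toReal := by
  have := hμ.1
  rw [meeting_seg_union hz, measure_union₀ (measurableSet_meeting_seg z y).nullMeasurableSet
    (aedisjoint_meeting hμ hz hoff), ENNReal.toReal_add (isCompact_meeting_seg _ _).measure_lt_top.ne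
    (isCompact_meeting_seg _ _).measure_lt_top.ne]

lemma integral_meeting_add {μ : Measure Geodesic} (hμ : IsMeasuredLamination μ) {x y z : Hyp}
    (hz : z ∈ seg x y) (hoff : OffWeightedLeaves μ z) (v : V) :
    ∫ l in meeting (seg x y), |mink v l.nrm| ∂μ =
      ∫ l in meeting (seg x z), |mink v l.nrm| ∂μ +
      ∫ l in meeting (seg z y), |mink v l.nrm| ∂μ := by
  have := hμ.1
  rw [meeting_seg_union hz]
  exact setIntegral_union₀ (aedisjoint_meeting hμ hz hoff)
    (measurableSet_meeting_seg z y).nullMeasurableSet (integrableOn_abs_mink μ v x z)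
    (integrableOn_abs_mink μ v z y)

/-- The weighted leaves are countably many, and each meets the parabola `(r, r², 1)` finitely often,
its normal giving a nonzero quadratic polynomial. Uncountably many parameters remain. -/
lemma exists_offWeightedLeaves (μ : Measure Geodesic) [IsLocallyFiniteMeasure μ] :
    ∃ x : Hyp, OffWeightedLeaves μ x := by
  have hcurve : ∀ r ∈ Ioo (0 : ℝ) (1 / 2), ∃ c : ℝ, 0 < c ∧ ∃ z : Hyp, z.1 = c • ![r, r ^ 2, 1] := by
    intro r hr
    apply exists_smul_mem_hyp
    · have h1 : r * r < 1 / 4 := by nlinarith [hr.1, hr.2]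
      simp [mink]; nlinarith [mul_pos hr.1 hr.1]
    · simp
  have hbad : (⋃ l ∈ {l : Geodesic | 0 < μ {l}}, {r : ℝ | mink ![r, r ^ 2, 1] l.nrm = 0}).Countable := by
    refine (countable_weighted μ).biUnion fun l _ => Set.Finite.countable ?_
    let P : Polynomial ℝ := Polynomial.C (l.nrm 1) * Polynomial.X ^ 2 +
      Polynomial.C (l.nrm 0) * Polynomial.X + Polynomial.C (-l.nrm 2)
    have hP : P ≠ 0 := by
      intro h
      have h2 : P.coeff 2 = 0 := by rw [h]; simp
      have h1 : P.coeff 1 = 0 := by rw [h]; simp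
      have h0 : P.coeff 0 = 0 := by rw [h]; simp
      simp [P, Polynomial.coeff_X, Polynomial.coeff_C] at h0 h1 h2
      have := l.mink_nrm_self
      simp [mink, h0, h1, h2] at this
    refine (P.roots.toFinset.finite_toSet).subset fun r hr => ?_
    have : mink ![r, r ^ 2, 1] l.nrm = 0 := hr
    simp [mink] at this
    simp only [Multiset.mem_toFinset, SetLike.mem_coe, Polynomial.mem_roots hP,
      Polynomial.IsRoot.def, P]
    simp
    linarith
  have hunc : ¬ (Ioo (0 : ℝ) (1 / 2)).Countable := by
    intro h
    have := Cardinal.Real.Ioo_countable_iff.1 h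
    norm_num at this
  obtain ⟨r, hr, hr'⟩ : ∃ r ∈ Ioo (0 : ℝ) (1 / 2),
      r ∉ ⋃ l ∈ {l : Geodesic | 0 < μ {l}}, {r : ℝ | mink ![r, r ^ 2, 1] l.nrm = 0} := by
    by_contra! h
    exact hunc (hbad.mono h)
  obtain ⟨c, hc, z, hz⟩ := hcurve r hr
  refine ⟨z, fun l hl => ?_⟩
  by_contra hne
  apply hr'
  simp only [mem_iUnion]
  refine ⟨l, pos_iff_ne_zero.2 hne, ?_⟩
  rw [Geodesic.mem_points_iff, hz, mink_smul_left] at hl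
  rcases mul_eq_zero.1 hl with h | h
  · exact absurd h hc.ne'
  · exact h

/-! ### Strata of a lamination -/

lemma seg_subset_points {l : Geodesic} {z w : Hyp} (hz : z ∈ l.points) (hw : w ∈ l.points) :
    seg z w ⊆ l.points := by
  rintro u ⟨a, b, -, -, hu⟩
  rw [Geodesic.mem_points_iff] at *
  rw [hu, mink_add_left, mink_smul_left, mink_smul_left, hz, hw]; simp

lemma mink_mul_pos_of_disjoint {l l' : Geodesic} (h : Disjoint l.points l'.points) {z w : Hyp}
    (hz : z ∈ l.points) (hw : w ∈ l.points) : 0 < mink z.1 l'.nrm * mink w.1 l'.nrm := by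
  by_contra! hc
  obtain ⟨u, hu, hu0⟩ := exists_mem_seg_mink_eq_zero hc
  exact h.le_bot ⟨seg_subset_points hz hw hu, Geodesic.mem_points_iff.2 hu0⟩

lemma Geodesic.exists_points (l : Geodesic) {u : ℝ} (hu : 0 < u) : ∃ c : ℝ, 0 < c ∧
    ∃ z ∈ l.points, z.1 = c • (u • null l.fst + null l.snd) := by
  have h0 := mink_null_null_neg l.fst_ne_snd
  obtain ⟨c, hc, z, hz⟩ := exists_smul_mem_hyp (w := u • null l.fst + null l.snd)
    (by
      simp only [mink_add_left, mink_add_right, mink_smul_left, mink_smul_right, mink_null_self,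
        mink_comm (null l.snd) (null l.fst)]
      nlinarith [mul_neg_of_pos_of_neg hu h0])
    (by simp only [Pi.add_apply, Pi.smul_apply, smul_eq_mul, null_two]; linarith)
  refine ⟨c, hc, z, ?_, hz⟩
  rw [Geodesic.mem_points_iff, hz, mink_smul_left, mink_add_left, mink_smul_left, l.mink_fst_nrm,
    l.mink_snd_nrm]
  simp

/-- The endpoints are limits of points of the geodesic. The limits `u → ∞` and `u → 0` in `u A + B ≤
0` are replaced by explicit values of `u`. -/
lemma Geodesic.endpoints_nonpos {l : Geodesic} {σ : V} (h : ∀ z ∈ l.points, mink z.1 σ ≤ 0) :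
    mink (null l.fst) σ ≤ 0 ∧ mink (null l.snd) σ ≤ 0 := by
  have key : ∀ u : ℝ, 0 < u → u * mink (null l.fst) σ + mink (null l.snd) σ ≤ 0 := by
    intro u hu
    obtain ⟨c, hc, z, hz, hzc⟩ := l.exists_points hu
    have := h z hz
    rw [hzc, mink_smul_left, mink_add_left, mink_smul_left] at this
    by_contra! h'
    nlinarith [mul_pos hc h']
  set A := mink (null l.fst) σ
  set B := mink (null l.snd) σ
  constructor
  · by_contra! hA
    have := key ((|B| + 1) / A) (by positivity)
    rw [div_mul_cancel₀ _ hA.ne'] at this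
    linarith [neg_abs_le B]
  · by_contra! hB
    have h1 := key (B / (2 * (|A| + 1))) (by positivity)
    have h2 : B / (2 * (|A| + 1)) * A ≥ -(B / 2) := by
      have h3 : B / (2 * (|A| + 1)) * (-A) ≤ B / (2 * (|A| + 1)) * (|A| + 1) := by
        apply mul_le_mul_of_nonneg_left _ (by positivity)
        linarith [neg_abs_le A]
      have h4 : B / (2 * (|A| + 1)) * (|A| + 1) = B / 2 := by
        field_simp
      linarith
    linarith

/-- Among the leaves that cross a segment there is a first one. -/
lemma exists_first_leaf {L : Set Geodesic} (hL : IsGeodesicLamination L) {x y : Hyp}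
    (hx : ∀ l ∈ L, x ∉ l.points) (hmeet : ∃ l ∈ L, l ∈ meeting (seg x y)) :
    ∃ l ∈ L, ∃ z ∈ seg x y, z ∈ l.points ∧ ∀ l' ∈ L, l' ≠ l → l' ∉ meeting (seg x z) := by
  set K := L ∩ meeting (seg x y)
  have hK : IsCompact K := (isCompact_meeting_seg x y).inter_left hL.1
  have hx' : ∀ l ∈ L, mink x.1 l.nrm ≠ 0 := fun l hl h => hx l hl (Geodesic.mem_points_iff.2 h)
  -- The crossing with a leaf of normal `n` lies on the ray of `|⟨y, n⟩| x + |⟨x, n⟩| y`. The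
  -- crossing nearest to `x` is the one with the largest quotient, and the maximum is attained by
  -- compactness.
  obtain ⟨l, ⟨hlL, hlm⟩, hmax⟩ := hK.exists_isMaxOn (f := fun l => |mink y.1 l.nrm| / |mink x.1 l.nrm|)
    (by obtain ⟨l, h1, h2⟩ := hmeet; exact ⟨l, h1, h2⟩)
    ((continuous_abs_mink_nrm y.1).continuousOn.div (continuous_abs_mink_nrm x.1).continuousOn
      fun l hl => abs_ne_zero.2 (hx' l hl.1))
  have hX := abs_pos.2 (hx' l hlL)
  obtain ⟨c, hc, z, hz, hzc⟩ := exists_mem_seg x y (abs_nonneg (mink y.1 l.nrm))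
      (abs_nonneg (mink x.1 l.nrm)) (by positivity)
  have hzl : z ∈ l.points := by
    rw [Geodesic.mem_points_iff, hzc, mink_smul_left, mink_add_left, mink_smul_left, mink_smul_left]
    rw [mem_meeting_seg] at hlm
    rcases lt_or_gt_of_ne (hx' l hlL) with h1 | h1
    · have h2 : 0 ≤ mink y.1 l.nrm := by nlinarith
      rw [abs_of_neg h1, abs_of_nonneg h2]; ring
    · have h2 : mink y.1 l.nrm ≤ 0 := by nlinarith
      rw [abs_of_pos h1, abs_of_nonpos h2]; ring
  refine ⟨l, hlL, z, hz, hzl, fun l' hl' hne hm => ?_⟩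
  have hm' : l' ∈ meeting (seg x y) :=
    meeting_mono (seg_subset_seg (left_mem_seg x y) hz) hm
  have hrho : |mink y.1 l'.nrm| / |mink x.1 l'.nrm| ≤ |mink y.1 l.nrm| / |mink x.1 l.nrm| :=
    hmax ⟨hl', hm'⟩
  have hX' := abs_pos.2 (hx' l' hl')
  rw [div_le_div_iff₀ hX' hX] at hrho
  rw [mem_meeting_seg] at hm hm'
  have hzn : mink z.1 l'.nrm =
      c * (|mink y.1 l.nrm| * mink x.1 l'.nrm + |mink x.1 l.nrm| * mink y.1 l'.nrm) := by
    rw [hzc, mink_smul_left, mink_add_left, mink_smul_left, mink_smul_left]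
  have hz0 : mink z.1 l'.nrm = 0 := by
    rw [hzn] at hm ⊢
    rw [mul_eq_zero]; right
    rcases lt_or_gt_of_ne (hx' l' hl') with h1 | h1
    · have h2 : 0 ≤ mink y.1 l'.nrm := by nlinarith
      rw [abs_of_neg h1, abs_of_nonneg h2] at hrho
      have h3 : 0 ≤ c * (|mink y.1 l.nrm| * mink x.1 l'.nrm + |mink x.1 l.nrm| * mink y.1 l'.nrm) := by
        nlinarith
      nlinarith [nonneg_of_mul_nonneg_right h3 hc]
    · have h2 : mink y.1 l'.nrm ≤ 0 := by nlinarith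
      rw [abs_of_pos h1, abs_of_nonpos h2] at hrho
      have h3 : c * (|mink y.1 l.nrm| * mink x.1 l'.nrm + |mink x.1 l.nrm| * mink y.1 l'.nrm) ≤ 0 := by
        nlinarith
      nlinarith [nonpos_of_mul_nonpos_right h3 hc]
  exact (hL.2 hl' hlL hne).le_bot ⟨Geodesic.mem_points_iff.2 hz0, hzl⟩

/-- The point of the segment `[x, y]` on the ray through `(1 - s) x + s y`. -/
noncomputable def segPoint (x y : Hyp) (s : Icc (0 : ℝ) 1) : Hyp :=
  ⟨(√(-mink ((1 - s.1) • x.1 + s.1 • y.1) ((1 - s.1) • x.1 + s.1 • y.1)))⁻¹ •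
      ((1 - s.1) • x.1 + s.1 • y.1), by
    obtain ⟨h1, h2⟩ := timelike_combination x y (a := 1 - s.1) (b := s.1) (by linarith [s.2.2])
      s.2.1 (by linarith)
    set w := (1 - s.1) • x.1 + s.1 • y.1
    have hs : 0 < √(-mink w w) := Real.sqrt_pos.2 (by linarith)
    constructor
    · rw [mink_smul_left, mink_smul_right, ← mul_assoc, ← mul_inv,
        Real.mul_self_sqrt (by linarith)]
      field_simp
      rw [div_self h1.ne]
    · simp only [Pi.smul_apply, smul_eq_mul]; positivity⟩

lemma segPoint_eq (x y : Hyp) (s : Icc (0 : ℝ) 1) : ∃ c : ℝ, 0 < c ∧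
    (segPoint x y s).1 = c • ((1 - s.1) • x.1 + s.1 • y.1) := by
  obtain ⟨h1, h2⟩ := timelike_combination x y (a := 1 - s.1) (b := s.1) (by linarith [s.2.2])
      s.2.1 (by linarith)
  exact ⟨_, inv_pos.2 (Real.sqrt_pos.2 (by linarith)), rfl⟩

lemma segPoint_mem_seg (x y : Hyp) (s : Icc (0 : ℝ) 1) : segPoint x y s ∈ seg x y := by
  obtain ⟨c, hc, h⟩ := segPoint_eq x y s
  refine ⟨c * (1 - s.1), c * s.1, mul_nonneg hc.le (by linarith [s.2.2]),
    mul_nonneg hc.le s.2.1, ?_⟩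
  rw [h, smul_add, smul_smul, smul_smul]

lemma continuous_segPoint (x y : Hyp) : Continuous (segPoint x y) := by
  refine Continuous.subtype_mk ?_ _
  have h : Continuous fun s : Icc (0 : ℝ) 1 => (1 - s.1) • x.1 + s.1 • y.1 := by fun_prop
  refine Continuous.smul (Continuous.inv₀ (Real.continuous_sqrt.comp
    (Continuous.mink h h).neg) fun s => ?_) h
  obtain ⟨h1, h2⟩ := timelike_combination x y (a := 1 - s.1) (b := s.1) (by linarith [s.2.2])
      s.2.1 (by linarith)
  exact (Real.sqrt_pos.2 (neg_pos.2 h1)).ne'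

lemma segPoint_zero (x y : Hyp) : segPoint x y ⟨0, by simp⟩ = x := by
  obtain ⟨c, hc, h⟩ := segPoint_eq x y ⟨0, by simp⟩
  exact Hyp.eq_of_smul (c := c) (by rw [h]; simp)

lemma segPoint_one (x y : Hyp) : segPoint x y ⟨1, by simp⟩ = y := by
  obtain ⟨c, hc, h⟩ := segPoint_eq x y ⟨1, by simp⟩
  exact Hyp.eq_of_smul (c := c) (by rw [h]; simp)

lemma mem_stratum (L : Set Geodesic) (x : Hyp) : x ∈ stratum L x := by
  by_cases h : ∃ l ∈ L, x ∈ l.points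
  · obtain ⟨l, hl, hx⟩ := h
    exact Or.inl ⟨l, hl, hx, hx⟩
  · right
    apply mem_connectedComponentIn
    simpa using h

/-- A segment that meets no leaf is a connected subset of the complement of the leaves, so its ends
have the same stratum. -/
lemma exists_leaf_meeting_of_stratum_ne {L : Set Geodesic} {x y : Hyp}
    (h : stratum L x ≠ stratum L y) : ∃ l ∈ L, l ∈ meeting (seg x y) := by
  by_contra! hc
  apply h
  have hoff : ∀ z ∈ seg x y, ∀ l ∈ L, z ∉ l.points := fun z hz l hl hzl => hc l hl ⟨z, hzl, hz⟩
  have hcc : y ∈ connectedComponentIn (⋃ l ∈ L, l.points)ᶜ x := by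
    have hpre : IsPreconnected (range (segPoint x y)) := isPreconnected_range (continuous_segPoint x y)
    refine hpre.subset_connectedComponentIn ⟨_, segPoint_zero x y⟩ ?_ ⟨_, segPoint_one x y⟩
    rintro _ ⟨s, rfl⟩
    simp only [mem_compl_iff, mem_iUnion, not_exists]
    exact fun l hl => hoff _ (segPoint_mem_seg x y s) l hl
  have hx := hoff x (left_mem_seg x y)
  have hy := hoff y (right_mem_seg x y)
  unfold stratum
  rw [connectedComponentIn_eq hcc]
  congr 1
  ext z
  constructor
  · rintro ⟨l, hl, h, -⟩; exact absurd h (hx l hl)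
  · rintro ⟨l, hl, h, -⟩; exact absurd h (hy l hl)

/-- If two strata differ then a half-plane containing the first one contains a leaf that crosses
the segment between them. -/
lemma exists_leaf_nonpos {L : Set Geodesic} (hL : IsGeodesicLamination L) {x y : Hyp}
    (hne : stratum L x ≠ stratum L y) {σ : V} (hσ : ∀ z ∈ stratum L x, mink z.1 σ ≤ 0) :
    ∃ l ∈ L, l ∈ meeting (seg x y) ∧ ∀ w ∈ l.points, mink w.1 σ ≤ 0 := by
  by_cases hx : ∃ l ∈ L, x ∈ l.points
  · obtain ⟨l, hl, hx⟩ := hx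
    exact ⟨l, hl, ⟨x, hx, left_mem_seg x y⟩, fun w hw => hσ w (Or.inl ⟨l, hl, hx, hw⟩)⟩
  push Not at hx
  obtain ⟨l, hl, z, hz, hzl, hfirst⟩ :=
    exists_first_leaf hL hx (exists_leaf_meeting_of_stratum_ne hne)
  refine ⟨l, hl, ⟨z, hzl, hz⟩, fun w hw => ?_⟩
  have hxl : mink x.1 l.nrm ≠ 0 := fun h => hx l hl (Geodesic.mem_points_iff.2 h)
  have hwl : mink w.1 l.nrm = 0 := Geodesic.mem_points_iff.1 hw
  -- Let `w` be any point of the first leaf `l`. Another leaf meeting `[x, w]` would separate `x`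
  -- from `w`; but `z` is strictly on the side of `x`, as `l'` does not meet `[x, z]`, and on the
  -- side of `w`, as `l` and `l'` are disjoint. Hence the half-open segment from `x` to `w` lies in
  -- the stratum of `x`, and the inequality passes to the limit `w`.
  have hoff : ∀ u ∈ seg x w, u ∉ l.points → ∀ l' ∈ L, u ∉ l'.points := by
    intro u hu hul l' hl' hul'
    have hne : l' ≠ l := by rintro rfl; exact hul hul'
    have h1 := mink_mul_pos_of_disjoint (hL.2 hl hl' hne.symm) hw hzl
    have h2 := mink_mul_nonpos_of_mem_seg hu (Geodesic.mem_points_iff.1 hul')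
    have h3 := hfirst l' hl' hne
    rw [mem_meeting_seg, not_le] at h3
    rcases pos_and_pos_or_neg_and_neg_of_mul_pos h1 with ⟨h4, h5⟩ | ⟨h4, h5⟩ <;>
    rcases pos_and_pos_or_neg_and_neg_of_mul_pos h3 with ⟨h6, h7⟩ | ⟨h6, h7⟩ <;> nlinarith
  set T : Set (Icc (0 : ℝ) 1) := {s | s.1 < 1}
  have hT : IsPreconnected T := (ordConnected_of_Ioo (by
    intro a ha b hb hab c hc
    exact lt_of_lt_of_le (b := b.1) hc.2 hb.le)).isPreconnected
  have hsub : segPoint x w '' T ⊆ connectedComponentIn (⋃ l ∈ L, l.points)ᶜ x := by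
    refine (hT.image _ (continuous_segPoint x w).continuousOn).subset_connectedComponentIn
      ⟨⟨0, by simp⟩, by simp [T], segPoint_zero x w⟩ ?_
    rintro _ ⟨s, hs, rfl⟩
    simp only [mem_compl_iff, mem_iUnion, not_exists]
    refine fun l' hl' => hoff _ (segPoint_mem_seg x w s) ?_ l' hl'
    rw [Geodesic.mem_points_iff]
    obtain ⟨c, hc, h⟩ := segPoint_eq x w s
    rw [h, mink_smul_left, mink_add_left, mink_smul_left, mink_smul_left, hwl]
    have : (0 : ℝ) < 1 - s.1 := by have : s.1 < 1 := hs; linarith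
    simp [hc.ne', this.ne', hxl]
  have key : ∀ s ∈ Ico (0 : ℝ) 1, (1 - s) * mink x.1 σ + s * mink w.1 σ ≤ 0 := by
    intro s hs
    have h1 := hσ _ (Or.inr (hsub ⟨⟨s, hs.1, hs.2.le⟩, hs.2, rfl⟩))
    obtain ⟨c, hc, h⟩ := segPoint_eq x w ⟨s, hs.1, hs.2.le⟩
    rw [h, mink_smul_left, mink_add_left, mink_smul_left, mink_smul_left] at h1
    by_contra! h'
    nlinarith [mul_pos hc h']
  have hlim : Tendsto (fun s : ℝ => (1 - s) * mink x.1 σ + s * mink w.1 σ) (𝓝[<] 1)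
      (𝓝 ((1 - 1) * mink x.1 σ + 1 * mink w.1 σ)) :=
    (Continuous.tendsto (by fun_prop) 1).mono_left nhdsWithin_le_nhds
  have := le_of_tendsto hlim (by
    filter_upwards [Ico_mem_nhdsLT (show (0 : ℝ) < 1 by norm_num)] with s hs using key s hs)
  linarith

/-- Two unit normals that point the same way across a segment and whose geodesics do not cross. -/
lemma one_le_mink_of_noncrossing {l : Geodesic} {n σ : V} (hn : n = l.nrm ∨ n = -l.nrm)
    (hσ : mink σ σ = 1)
    (hs : (∀ z ∈ l.points, mink z.1 σ ≤ 0) ∨ ∀ z ∈ l.points, 0 ≤ mink z.1 σ) {x y : Hyp}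
    (hnx : mink x.1 n ≤ 0) (hny : 0 ≤ mink y.1 n) (hne : mink x.1 n < 0 ∨ 0 < mink y.1 n)
    (hσx : mink x.1 σ ≤ 0) (hσy : 0 ≤ mink y.1 σ) : 1 ≤ mink σ n := by
  have h0 := mink_null_null_neg l.fst_ne_snd
  have hd := normal_decomp l.fst_ne_snd σ
  have hαn : mink σ l.nrm • l.nrm = mink σ n • n := by
    rcases hn with h | h
    · rw [h]
    · rw [h, mink_neg_right, smul_neg, neg_smul, neg_neg]
  change σ = _ + _ + mink σ l.nrm • l.nrm at hd
  rw [hαn] at hd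
  set α := mink σ n
  set β := mink σ (null l.snd) / mink (null l.fst) (null l.snd) with hβ
  set γ := mink σ (null l.fst) / mink (null l.fst) (null l.snd) with hγ
  have han : mink (null l.fst) n = 0 := by
    rcases hn with h | h <;> rw [h]
    · exact l.mink_fst_nrm
    · rw [mink_neg_right, l.mink_fst_nrm, neg_zero]
  have hbn : mink (null l.snd) n = 0 := by
    rcases hn with h | h <;> rw [h]
    · exact l.mink_snd_nrm
    · rw [mink_neg_right, l.mink_snd_nrm, neg_zero]
  have hnn : mink n n = 1 := by
    rcases hn with h | h <;> rw [h]
    · exact l.mink_nrm_self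
    · rw [mink_neg_right, mink_neg_left, l.mink_nrm_self, neg_neg]
  -- Not crossing `l` means that `β` and `γ` have the same sign. As the two null vectors pair
  -- negatively, the unit length of `σ` then gives `α² ≥ 1`.
  have hsq : 2 * β * γ * mink (null l.fst) (null l.snd) + α ^ 2 = 1 := by
    rw [← hσ]
    conv_rhs => rw [hd]
    simp only [mink_add_left, mink_add_right, mink_smul_left, mink_smul_right, mink_null_self,
      mink_comm n (null l.fst), mink_comm n (null l.snd), han, hbn, hnn,
      mink_comm (null l.snd) (null l.fst)]
    ring
  have hexp : ∀ z : Hyp, mink z.1 σ =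
      β * mink z.1 (null l.fst) + γ * mink z.1 (null l.snd) + α * mink z.1 n := by
    intro z
    conv_lhs => rw [hd]
    simp only [mink_add_right, mink_smul_right]
  have hsign : (0 ≤ β ∧ 0 ≤ γ) ∨ (β ≤ 0 ∧ γ ≤ 0) := by
    rcases hs with h | h
    · obtain ⟨h1, h2⟩ := Geodesic.endpoints_nonpos h
      rw [mink_comm] at h1 h2
      exact Or.inl ⟨div_nonneg_of_nonpos h2 h0.le, div_nonneg_of_nonpos h1 h0.le⟩
    · obtain ⟨h1, h2⟩ := Geodesic.endpoints_nonpos (l := l) (σ := -σ)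
        (fun z hz => by rw [mink_neg_right]; linarith [h z hz])
      rw [mink_neg_right, neg_nonpos, mink_comm] at h1 h2
      exact Or.inr ⟨div_nonpos_of_nonneg_of_nonpos h2 h0.le, div_nonpos_of_nonneg_of_nonpos h1 h0.le⟩
  have hβγ : 0 ≤ β * γ := by rcases hsign with ⟨h1, h2⟩ | ⟨h1, h2⟩ <;> nlinarith
  have hα2 : 1 ≤ α ^ 2 := by nlinarith
  -- It remains to exclude `α < 0`, where the orientations at `x` and `y` force `β = γ = 0`, so that
  -- `σ` is a negative multiple of `n`. Then the strict sign in `hne` is contradicted.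
  suffices 0 ≤ α by nlinarith
  by_contra! hα
  have hx1 := x.mink_null_neg l.fst
  have hx2 := x.mink_null_neg l.snd
  have hy1 := y.mink_null_neg l.fst
  have hy2 := y.mink_null_neg l.snd
  rw [hexp] at hσx hσy
  rcases hsign with ⟨h1, h2⟩ | ⟨h1, h2⟩
  · have e1 := mul_nonpos_of_nonneg_of_nonpos h1 hy1.le
    have e2 := mul_nonpos_of_nonneg_of_nonpos h2 hy2.le
    have e3 := mul_nonpos_of_nonpos_of_nonneg hα.le hny
    have f1 : β = 0 := by
      have : β * mink y.1 (null l.fst) = 0 := by linarith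
      exact (mul_eq_zero.1 this).resolve_right hy1.ne
    have f2 : γ = 0 := by
      have : γ * mink y.1 (null l.snd) = 0 := by linarith
      exact (mul_eq_zero.1 this).resolve_right hy2.ne
    rw [f1, f2] at hσx hσy
    rcases hne with h | h <;> nlinarith
  · have e1 := mul_nonneg_of_nonpos_of_nonpos h1 hx1.le
    have e2 := mul_nonneg_of_nonpos_of_nonpos h2 hx2.le
    have e3 := mul_nonneg_of_nonpos_of_nonpos hα.le hnx
    have f1 : β = 0 := by
      have : β * mink x.1 (null l.fst) = 0 := by linarith
      exact (mul_eq_zero.1 this).resolve_right hx1.ne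
    have f2 : γ = 0 := by
      have : γ * mink x.1 (null l.snd) = 0 := by linarith
      exact (mul_eq_zero.1 this).resolve_right hx2.ne
    rw [f1, f2] at hσx hσy
    rcases hne with h | h <;> nlinarith

/-! ### Frames along a geodesic ray -/

lemma Hyp.two_pos_of_causal (x : Hyp) {w : V} (hw : mink w w ≤ 0) (hxw : mink x.1 w < 0) :
    0 < w 2 := by
  by_contra! h
  have := mink_nonpos_of_causal (v := x.1) (w := -w) (by rw [x.mink_self]; norm_num)
    (by rw [mink_neg_left, mink_neg_right, neg_neg]; exact hw) x.two_pos.le (by simpa using h)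
  rw [mink_neg_right] at this
  linarith

/-- A point of the hyperbolic plane and a null vector, normalized to `⟨x, N⟩ = -1`: the initial
data of a geodesic ray. -/
structure Frame (x : Hyp) (N : V) : Prop where
  null : mink N N = 0
  norm : mink x.1 N = -1

/-- The null vector opposite to `N`. -/
def opp (x : Hyp) (N : V) : V := (2 : ℝ) • x.1 - N

/-- The unit vector orthogonal to the ray. -/
def perp (x : Hyp) (N : V) : V := mcross x.1 N

/-- The vector `N + p τ + q ξ`. -/
noncomputable def fvec (x : Hyp) (N : V) (p q : ℝ) : V := N + p • perp x N + q • opp x N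

namespace Frame

variable {x : Hyp} {N : V}

lemma mink_opp_self (h : Frame x N) : mink (opp x N) (opp x N) = 0 := by
  simp only [opp, mink_sub_left, mink_sub_right, mink_smul_left, mink_smul_right, x.mink_self,
    h.norm, h.null, mink_comm N x.1]
  norm_num

lemma mink_opp (h : Frame x N) : mink N (opp x N) = -2 := by
  simp only [opp, mink_sub_right, mink_smul_right, h.norm, h.null, mink_comm N x.1]
  norm_num

lemma mink_perp_self (h : Frame x N) : mink (perp x N) (perp x N) = 1 := by
  rw [perp, mink_mcross_mcross, h.norm, h.null]; norm_num

lemma mink_perp (x : Hyp) (N : V) : mink N (perp x N) = 0 := by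
  rw [mink_comm, perp, mink_mcross_right_self]

lemma mink_opp_perp (x : Hyp) (N : V) : mink (opp x N) (perp x N) = 0 := by
  rw [mink_comm, perp, opp, mink_sub_right, mink_smul_right, mink_mcross_left_self,
    mink_mcross_right_self]; norm_num

lemma perp_cross_null (h : Frame x N) : mcross (perp x N) N = N := by
  rw [perp, mcross_mcross, h.null, h.norm]; simp

lemma perp_cross_opp (h : Frame x N) : mcross (perp x N) (opp x N) = -opp x N := by
  rw [perp, mcross_mcross, h.mink_opp]
  simp only [opp, mink_sub_right, mink_smul_right, x.mink_self, h.norm]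
  module

lemma null_cross_opp (x : Hyp) (N : V) : mcross N (opp x N) = (-2 : ℝ) • perp x N := by
  have : opp x N = (2 : ℝ) • x.1 + (-1 : ℝ) • N := by rw [opp]; module
  rw [this, mcross_add_right, mcross_smul_right, mcross_smul_right, mcross_self, mcross_swap, perp]
  module

lemma decomp (h : Frame x N) (w : V) : w = (-mink w (opp x N) / 2) • N + mink w (perp x N) • perp x N +
    (-mink w N / 2) • opp x N := by
  have h1 := cramer N (perp x N) (opp x N) w
  rw [mcross_swap N, h.perp_cross_null, h.perp_cross_opp, mcross_swap (opp x N),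
    Frame.null_cross_opp x N] at h1
  simp only [mink_neg_left, mink_neg_right, mink_smul_right, h.mink_opp] at h1
  apply smul_right_injective _ (two_ne_zero (α := ℝ))
  beta_reduce
  rw [show (2 : ℝ) = - -2 by norm_num, h1]
  module

lemma mink_fvec_opp (h : Frame x N) (p q : ℝ) : mink (fvec x N p q) (opp x N) = -2 := by
  simp only [fvec, mink_add_left, mink_smul_left, h.mink_opp, mink_comm (perp x N),
    Frame.mink_opp_perp x N, h.mink_opp_self]
  ring

lemma mink_fvec_perp (h : Frame x N) (p q : ℝ) : mink (fvec x N p q) (perp x N) = p := by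
  simp only [fvec, mink_add_left, mink_smul_left, Frame.mink_perp x N, h.mink_perp_self,
    Frame.mink_opp_perp x N]
  ring

lemma mink_fvec_null (h : Frame x N) (p q : ℝ) : mink (fvec x N p q) N = -2 * q := by
  simp only [fvec, mink_add_left, mink_smul_left, h.null, mink_comm (perp x N), Frame.mink_perp x N,
    mink_comm (opp x N), h.mink_opp]
  ring

lemma fvec_injective (h : Frame x N) {α α' p p' q q' : ℝ} (hα : α ≠ 0)
    (he : α • fvec x N p q = α' • fvec x N p' q') : α = α' ∧ p = p' ∧ q = q' := by
  have h1 := congrArg (fun w => mink w (opp x N)) he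
  have h2 := congrArg (fun w => mink w (perp x N)) he
  have h3 := congrArg (fun w => mink w N) he
  simp only [mink_smul_left, h.mink_fvec_opp, h.mink_fvec_perp, h.mink_fvec_null] at h1 h2 h3
  have h4 : α = α' := by linarith
  subst h4
  refine ⟨rfl, mul_left_cancel₀ hα h2, mul_left_cancel₀ hα (by linarith)⟩

lemma opp_two_pos (h : Frame x N) : 0 < opp x N 2 := by
  refine x.two_pos_of_causal h.mink_opp_self.le ?_
  simp only [opp, mink_sub_right, mink_smul_right, x.mink_self, h.norm]
  norm_num

lemma two_pos (h : Frame x N) : 0 < N 2 := x.two_pos_of_causal h.null.le (by rw [h.norm]; norm_num)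

lemma pt_eq (x : Hyp) (N : V) (r : ℝ) : Real.exp (-r) • x.1 + Real.sinh r • N =
    (Real.exp r / 2) • N + (Real.exp (-r) / 2) • opp x N := by
  rw [opp, Real.sinh_eq]; module

/-- The point at distance `r` on the ray. -/
noncomputable def pt (h : Frame x N) (r : ℝ) : Hyp :=
  ⟨Real.exp (-r) • x.1 + Real.sinh r • N, by
    constructor
    · simp only [mink_add_left, mink_add_right, mink_smul_left, mink_smul_right, x.mink_self,
        h.norm, h.null, mink_comm N x.1, Real.sinh_eq]
      have : Real.exp r * Real.exp (-r) = 1 := by rw [← Real.exp_add]; simp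
      linear_combination (-1 : ℝ) * this
    · rw [pt_eq]
      have h1 := h.opp_two_pos
      have h2 := h.two_pos
      simp only [Pi.add_apply, Pi.smul_apply, smul_eq_mul]
      positivity⟩

lemma pt_val (h : Frame x N) (r : ℝ) : (h.pt r).1 = Real.exp (-r) • x.1 + Real.sinh r • N := rfl

lemma pt_val_half (h : Frame x N) (r : ℝ) : (h.pt r).1 = (Real.exp r / 2) • N + (Real.exp (-r) / 2) • opp x N :=
  pt_eq x N r

lemma pt_zero (h : Frame x N) : h.pt 0 = x := Subtype.ext (by simp [pt_val])

lemma at_pt (h : Frame x N) (r : ℝ) : Frame (h.pt r) (Real.exp r • N) where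
  null := by rw [mink_smul_left, mink_smul_right, h.null]; simp
  norm := by
    rw [pt_val, mink_add_left, mink_smul_left, mink_smul_left, mink_smul_right, mink_smul_right,
      h.null, h.norm]
    have : Real.exp r * Real.exp (-r) = 1 := by rw [← Real.exp_add]; simp
    linarith

lemma pt_pt (h : Frame x N) (r s : ℝ) : (h.at_pt r).pt s = h.pt (r + s) := by
  apply Subtype.ext
  rw [pt_val, pt_val, pt_val, smul_add, smul_smul, smul_smul, smul_smul, neg_add, Real.exp_add,
    add_assoc, ← add_smul]
  congr 2
  · ring
  · simp only [Real.sinh_eq, neg_add, Real.exp_add]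
    have : Real.exp s * Real.exp (-s) = 1 := by rw [← Real.exp_add]; simp
    ring

lemma pt_mem_seg (h : Frame x N) {r s t : ℝ} (hrs : r ≤ s) (hst : s ≤ t) : h.pt s ∈ seg (h.pt r) (h.pt t) := by
  rcases (hrs.trans hst).eq_or_lt with he | hlt
  · have : s = r := by linarith
    rw [this]; exact left_mem_seg _ _
  have hpos : 0 < Real.sinh (t - r) := Real.sinh_pos_iff.2 (by linarith)
  refine ⟨Real.sinh (t - s) / Real.sinh (t - r), Real.sinh (s - r) / Real.sinh (t - r),
    div_nonneg (Real.sinh_nonneg_iff.2 (by linarith)) hpos.le,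
    div_nonneg (Real.sinh_nonneg_iff.2 (by linarith)) hpos.le, ?_⟩
  apply smul_right_injective _ hpos.ne'
  beta_reduce
  rw [smul_add, smul_smul, smul_smul, mul_div_cancel₀ _ hpos.ne', mul_div_cancel₀ _ hpos.ne']
  simp only [pt_val_half, Real.sinh_eq, sub_eq_add_neg, neg_add, neg_neg, Real.exp_add]
  have e1 : Real.exp r * Real.exp (-r) = 1 := by rw [← Real.exp_add]; simp
  have e2 : Real.exp s * Real.exp (-s) = 1 := by rw [← Real.exp_add]; simp
  have e3 : Real.exp t * Real.exp (-t) = 1 := by rw [← Real.exp_add]; simp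
  generalize Real.exp (-r) = r', Real.exp r = r'', Real.exp (-s) = s', Real.exp s = s'',
    Real.exp (-t) = t', Real.exp t = t'' at *
  simp only [smul_add, smul_smul]
  rw [add_add_add_comm, ← add_smul, ← add_smul]
  congr 2
  · ring
  · ring

lemma hdist_pt (h : Frame x N) {r s : ℝ} (hrs : r ≤ s) : hdist (h.pt r) (h.pt s) = s - r := by
  rw [hdist]
  have : -mink (h.pt r).1 (h.pt s).1 = Real.cosh (s - r) := by
    simp only [pt_val, mink_add_left, mink_add_right, mink_smul_left, mink_smul_right, x.mink_self,
      h.norm, h.null, mink_comm N x.1, Real.sinh_eq, Real.cosh_eq, sub_eq_add_neg, neg_add, neg_neg,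
      Real.exp_add]
    ring
  rw [this, Real.arcosh_cosh (by linarith)]

/-- Moving the base point forward by `r` multiplies `N` by `exp r`, keeps the perpendicular vector
and multiplies the opposite null vector by `exp (-r)`. Relative to `N` the displacement `p`
contracts by `exp (-r)` and `q` by `exp (-2r)`, which makes the effects of distant leaves summable.
-/
lemma fvec_rescale (h : Frame x N) (r p q : ℝ) :
    fvec (h.pt r) (Real.exp r • N) p q = Real.exp r • fvec x N (Real.exp (-r) * p)
      (Real.exp (-(2 * r)) * q) := by
  have e1 : Real.exp r * Real.exp (-r) = 1 := by rw [← Real.exp_add]; simp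
  have e2 : Real.exp (-(2 * r)) = Real.exp (-r) * Real.exp (-r) := by rw [← Real.exp_add]; ring_nf
  have h1 : perp (h.pt r) (Real.exp r • N) = perp x N := by
    rw [perp, pt_val, mcross_smul_right, mcross_add_left, mcross_smul_left, mcross_smul_left,
      mcross_self, smul_zero, add_zero, smul_smul, e1, one_smul, perp]
  have h2 : opp (h.pt r) (Real.exp r • N) = Real.exp (-r) • opp x N := by
    rw [opp, opp, pt_val, Real.sinh_eq]; module
  rw [fvec, fvec, h1, h2, e2]
  simp only [smul_add, smul_smul]
  congr 2
  · rw [← mul_assoc, e1, one_mul]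
  · linear_combination (-(Real.exp (-r) * q)) * e1

/-- The coordinates of the image of `N + p τ + q ξ` under a translation. -/
lemma translation_fvec (h : Frame x N) {σ : V} {a b c : ℝ} (hσ : σ = a • N + b • perp x N + c • opp x N)
    (s p q : ℝ) : translation σ s (fvec x N p q) =
      (Real.cosh s + (1 - Real.cosh s) * (-2 * c - 2 * q * a + p * b) * a +
        Real.sinh s * (p * a - b)) • N +
      (Real.cosh s * p + (1 - Real.cosh s) * (-2 * c - 2 * q * a + p * b) * b +
        Real.sinh s * (2 * q * a - 2 * c)) • perp x N +
      (Real.cosh s * q + (1 - Real.cosh s) * (-2 * c - 2 * q * a + p * b) * c +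
        Real.sinh s * (q * b - p * c)) • opp x N := by
  have hm : mink (fvec x N p q) σ = -2 * c - 2 * q * a + p * b := by
    rw [hσ]
    simp only [mink_add_right, mink_smul_right, h.mink_fvec_opp, h.mink_fvec_perp,
      h.mink_fvec_null]
    ring
  have hc : mcross (fvec x N p q) σ = (p * a - b) • N + (2 * q * a - 2 * c) • perp x N +
      (q * b - p * c) • opp x N := by
    rw [hσ, fvec]
    simp only [mcross_add_left, mcross_add_right, mcross_smul_left, mcross_smul_right, mcross_self,
      h.perp_cross_null, h.perp_cross_opp, Frame.null_cross_opp x N]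
    rw [mcross_swap N (perp x N), mcross_swap (opp x N) N, mcross_swap (opp x N) (perp x N),
      h.perp_cross_null, h.perp_cross_opp, Frame.null_cross_opp x N]
    module
  rw [translation, hm, hc, fvec, hσ]
  module

end Frame

/-! ### The effect of one translation -/

lemma cosh_sinh_bounds {s : ℝ} (h0 : 0 ≤ s) (h1 : s ≤ 1) :
    0 ≤ Real.cosh s - 1 ∧ Real.cosh s - 1 ≤ s ^ 2 ∧ |Real.sinh s - s| ≤ s ^ 2 := by
  have e1 := Real.abs_exp_sub_one_sub_id_le (x := s) (by rw [abs_of_nonneg h0]; exact h1)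
  have e2 := Real.abs_exp_sub_one_sub_id_le (x := -s) (by rw [abs_neg, abs_of_nonneg h0]; exact h1)
  rw [abs_le] at e1 e2
  refine ⟨by linarith [Real.one_le_cosh s], ?_, ?_⟩
  · rw [Real.cosh_eq]; nlinarith
  · rw [Real.sinh_eq, abs_le]; constructor <;> nlinarith

/-- Here `u` and `v` stand for `cosh s - 1` and `sinh s`, and the left-hand sides are the
coordinates in `Frame.translation_fvec`. After division by the coefficient `α` of the first null
vector, the only term of first order in `s` that is free of `p` and `q` is the shift `-2cs` of the
first coordinate. All others contain `s²`, or `s` times `p` or `q`. The constant `600` is not sharp.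
-/
lemma step_bounds {a b c p q s u v : ℝ} (ha : |a| ≤ 4) (hb : |b| ≤ 4) (hc : |c| ≤ 4)
    (hp : |p| ≤ 2) (hq : |q| ≤ 2) (hs0 : 0 ≤ s) (hs : s ≤ 1 / 1000) (hu0 : 0 ≤ u)
    (hu : u ≤ s ^ 2) (hv : |v - s| ≤ s ^ 2) :
    ∃ α p' q' : ℝ, 0 < α ∧
      (1 + u) + (1 - (1 + u)) * (-2 * c - 2 * q * a + p * b) * a + v * (p * a - b) = α ∧
      (1 + u) * p + (1 - (1 + u)) * (-2 * c - 2 * q * a + p * b) * b + v * (2 * q * a - 2 * c) =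
        α * p' ∧
      (1 + u) * q + (1 - (1 + u)) * (-2 * c - 2 * q * a + p * b) * c + v * (q * b - p * c) =
        α * q' ∧
      |p' - p - s * (-2 * c)| ≤ 600 * s * (|p| + |q| + s) ∧
      |q' - q| ≤ 600 * s * (|p| + |q| + s) := by
  set m := -2 * c - 2 * q * a + p * b with hm
  have hP := abs_nonneg p
  have hQ := abs_nonneg q
  have hss : s ^ 2 ≤ s / 1000 := by nlinarith
  have prod : ∀ {X Y k₁ k₂ : ℝ}, |X| ≤ k₁ → |Y| ≤ k₂ → |X * Y| ≤ k₁ * k₂ := by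
    intro X Y k₁ k₂ h1 h2
    rw [abs_mul]; exact mul_le_mul h1 h2 (abs_nonneg _) ((abs_nonneg _).trans h1)
  have hmb : |m| ≤ 32 := by
    have h1 : |q * a| ≤ 2 * 4 := prod hq ha
    have h2 : |p * b| ≤ 2 * 4 := prod hp hb
    rw [abs_le] at h1 h2 hc ⊢; constructor <;> rw [hm] <;> linarith
  have hvb : |v| ≤ 1.001 * s := by
    have : |v| ≤ |v - s| + |s| := by simpa using abs_add_le (v - s) s
    rw [abs_of_nonneg hs0] at this; linarith
  have hub : |u| ≤ s ^ 2 := by rwa [abs_of_nonneg hu0]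
  set α := (1 + u) + (1 - (1 + u)) * m * a + v * (p * a - b) with hα
  have hpab : |p * a - b| ≤ 12 := by
    have h1 : |p * a| ≤ 2 * 4 := prod hp ha
    rw [abs_le] at h1 hb ⊢; constructor <;> linarith
  have hα1 : |α - 1| ≤ 13 * s := by
    have h1 : |u * (1 - m * a)| ≤ s ^ 2 * 129 := by
      apply prod hub
      have h1 := prod hmb ha
      rw [abs_le] at h1 ⊢; constructor <;> linarith
    have h2 := prod hvb hpab
    have e : α - 1 = u * (1 - m * a) + v * (p * a - b) := by rw [hα]; ring
    rw [e]
    refine (abs_add_le _ _).trans ?_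
    linarith
  have hα9 : 0.9 ≤ α := by
    rw [abs_le] at hα1; linarith
  have hαpos : 0 < α := by linarith
  have hinv : ∀ {X k : ℝ}, |X| ≤ k → |X / α| ≤ k / 0.9 := by
    intro X k h
    rw [abs_div, abs_of_pos hαpos]
    exact div_le_div₀ ((abs_nonneg _).trans h) h (by norm_num) hα9
  refine ⟨α, ((1 + u) * p + (1 - (1 + u)) * m * b + v * (2 * q * a - 2 * c)) / α,
    ((1 + u) * q + (1 - (1 + u)) * m * c + v * (q * b - p * c)) / α, hαpos, rfl,
    (mul_div_cancel₀ _ hαpos.ne').symm, (mul_div_cancel₀ _ hαpos.ne').symm, ?_, ?_⟩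
  · have e : ((1 + u) * p + (1 - (1 + u)) * m * b + v * (2 * q * a - 2 * c)) / α - p -
        s * (-2 * c) = (u * (m * (p * a - b)) + v * (2 * (q * a) - p * (p * a - b)) -
          2 * (c * ((v - s) - s * (α - 1)))) / α := by
      field_simp
      rw [hα]; ring
    rw [e]
    have h1 := prod hub (prod hmb hpab)
    have h2 : |2 * (q * a) - p * (p * a - b)| ≤ 8 * |q| + 12 * |p| := by
      have h3 : |q * a| ≤ |q| * 4 := prod le_rfl ha
      have h4 : |p * (p * a - b)| ≤ |p| * 12 := prod le_rfl hpab
      rw [abs_le] at h3 h4 ⊢; constructor <;> linarith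
    have h3 := prod hvb h2
    have h4 : |c * ((v - s) - s * (α - 1))| ≤ 4 * (14 * s ^ 2) := by
      apply prod hc
      have h5 : |s * (α - 1)| ≤ s * (13 * s) := prod (by rw [abs_of_nonneg hs0]) hα1
      rw [abs_le] at h5 hv ⊢; constructor <;> nlinarith
    have h6 : |u * (m * (p * a - b)) + v * (2 * (q * a) - p * (p * a - b)) -
          2 * (c * ((v - s) - s * (α - 1)))| ≤
        s ^ 2 * (32 * 12) + 1.001 * s * (8 * |q| + 12 * |p|) + 2 * (4 * (14 * s ^ 2)) := by
      rw [abs_le] at h1 h3 h4 ⊢; constructor <;> linarith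
    refine (hinv h6).trans ?_
    rw [div_le_iff₀ (by norm_num)]
    linarith [mul_nonneg hs0 hP, mul_nonneg hs0 hQ, sq_nonneg s]
  · have e : ((1 + u) * q + (1 - (1 + u)) * m * c + v * (q * b - p * c)) / α - q =
        (u * (m * (q * a - c)) + v * (2 * (q * b) - p * (c + q * a))) / α := by
      field_simp
      rw [hα]; ring
    rw [e]
    have hqa : |q * a| ≤ 2 * 4 := prod hq ha
    have hqac : |q * a - c| ≤ 12 := by rw [abs_le] at hqa hc ⊢; constructor <;> linarith
    have hcqa : |c + q * a| ≤ 12 := by rw [abs_le] at hqa hc ⊢; constructor <;> linarith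
    have h1 := prod hub (prod hmb hqac)
    have h2 : |2 * (q * b) - p * (c + q * a)| ≤ 8 * |q| + 12 * |p| := by
      have h3 : |q * b| ≤ |q| * 4 := prod le_rfl hb
      have h4 : |p * (c + q * a)| ≤ |p| * 12 := prod le_rfl hcqa
      rw [abs_le] at h3 h4 ⊢; constructor <;> linarith
    have h3 := prod hvb h2
    have h6 : |u * (m * (q * a - c)) + v * (2 * (q * b) - p * (c + q * a))| ≤
        s ^ 2 * (32 * 12) + 1.001 * s * (8 * |q| + 12 * |p|) := by
      rw [abs_le] at h1 h3 ⊢; constructor <;> linarith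
    refine (hinv h6).trans ?_
    rw [div_le_iff₀ (by norm_num)]
    linarith [mul_nonneg hs0 hP, mul_nonneg hs0 hQ, sq_nonneg s]

/-- Coordinates of a unit normal whose geodesic crosses the segment `[x, x(δ)]`. -/
lemma Frame.normal_coords {x : Hyp} {N : V} (h : Frame x N) {δ : ℝ} (hδ : 0 < δ) (hδ1 : δ ≤ 1)
    {σ : V} (hσ : mink σ σ = 1) (hx : mink x.1 σ ≤ 0) (hy : 0 ≤ mink (h.pt δ).1 σ) :
    ∃ a b k : ℝ, σ = a • N + b • perp x N + (-k) • opp x N ∧ mink N σ = 2 * k ∧ 0 ≤ k ∧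
      k ≤ 1 / 2 ∧ k ≤ a ∧ a ≤ k + 8 * δ ∧ a ≤ 4 ∧ |b| ≤ 1 ∧ b ^ 2 + 4 * a * k = 1 := by
  set a := -mink σ (opp x N) / 2 with ha
  set b := mink σ (perp x N) with hb
  set k := mink σ N / 2 with hk
  have hdec : σ = a • N + b • perp x N + (-k) • opp x N := by
    rw [hk, ← neg_div]; exact h.decomp σ
  have hsq : b ^ 2 + 4 * a * k = 1 := by
    rw [← hσ]
    conv_rhs => rw [hdec]
    simp only [mink_add_left, mink_add_right, mink_smul_left, mink_smul_right, h.null,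
      Frame.mink_perp x N, Frame.mink_opp_perp x N, h.mink_opp, h.mink_opp_self, h.mink_perp_self,
      mink_comm (opp x N) N, mink_comm (perp x N) N, mink_comm (perp x N) (opp x N)]
    ring
  have hpt : ∀ r, mink (h.pt r).1 σ = Real.exp r * k - Real.exp (-r) * a := by
    intro r
    rw [h.pt_val_half, mink_add_left, mink_smul_left, mink_smul_left, mink_comm N, mink_comm (opp x N)]
    rw [ha, hk]; ring
  have hx' : k ≤ a := by
    have := hpt 0
    rw [h.pt_zero] at this
    simp at this; linarith
  rw [hpt] at hy
  have e1 : Real.exp δ * Real.exp (-δ) = 1 := by rw [← Real.exp_add]; simp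
  have e2 : a ≤ Real.exp (2 * δ) * k := by
    have h1 : Real.exp δ * (Real.exp (-δ) * a) ≤ Real.exp δ * (Real.exp δ * k) :=
      mul_le_mul_of_nonneg_left (by linarith) (Real.exp_pos _).le
    rw [← mul_assoc, e1, one_mul, ← mul_assoc, ← Real.exp_add] at h1
    rwa [two_mul]
  have e3 : 1 < Real.exp (2 * δ) := by
    have := Real.add_one_lt_exp (x := 2 * δ) (by positivity)
    linarith
  -- Crossing the segment means `k ≤ a ≤ exp (2δ) k`, which is impossible for negative `k`.
  have hk0 : 0 ≤ k := by
    by_contra! hk0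
    nlinarith
  have hk2 : k ≤ 1 / 2 := by nlinarith [sq_nonneg b]
  have e4 : Real.exp (2 * δ) ≤ 8 := by
    have h1 : Real.exp (2 * δ) ≤ Real.exp (1 + 1) := Real.exp_le_exp.2 (by linarith)
    rw [Real.exp_add] at h1
    nlinarith [Real.exp_one_lt_d9, Real.exp_pos 1]
  have e5 : Real.exp (2 * δ) - 1 ≤ 16 * δ := by
    have h1 := Real.add_one_le_exp (-(2 * δ))
    have h2 : Real.exp (2 * δ) * Real.exp (-(2 * δ)) = 1 := by rw [← Real.exp_add]; simp
    nlinarith [Real.exp_pos (2 * δ)]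
  refine ⟨a, b, k, hdec, by rw [hk, mink_comm]; ring, hk0, hk2, hx', by nlinarith, by nlinarith, ?_, hsq⟩
  rw [← sq_le_one_iff_abs_le_one]
  nlinarith [mul_nonneg (hk0.trans hx') hk0]

/-- Normals of disjoint geodesics crossing a short segment are close to one another. -/
lemma Frame.mink_normal_close {x : Hyp} {N : V} (h : Frame x N) {δ : ℝ} (hδ : 0 < δ) (hδ1 : δ ≤ 1)
    {σ σ' : V} (hσ : mink σ σ = 1) (hx : mink x.1 σ ≤ 0) (hy : 0 ≤ mink (h.pt δ).1 σ)
    (hσ' : mink σ' σ' = 1) (hx' : mink x.1 σ' ≤ 0) (hy' : 0 ≤ mink (h.pt δ).1 σ')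
    (hge : 1 ≤ mink σ σ') : |mink N σ - mink N σ'| ≤ 16 * δ := by
  obtain ⟨a, b, k, hd, hN, hk0, -, hka, hak, -, -, hsq⟩ := h.normal_coords hδ hδ1 hσ hx hy
  obtain ⟨a', b', k', hd', hN', hk0', -, hka', hak', -, -, hsq'⟩ :=
    h.normal_coords hδ hδ1 hσ' hx' hy'
  have e : mink σ σ' = b * b' + 2 * (a * k' + a' * k) := by
    rw [hd, hd']
    simp only [mink_add_left, mink_add_right, mink_smul_left, mink_smul_right, h.null,
      Frame.mink_perp x N, Frame.mink_opp_perp x N, h.mink_opp, h.mink_opp_self, h.mink_perp_self,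
      mink_comm (opp x N) N, mink_comm (perp x N) N, mink_comm (perp x N) (opp x N)]
    ring
  rw [hN, hN']
  rw [e] at hge
  -- The two unit-length relations turn `⟨σ, σ'⟩ ≥ 1` into `(b - b')² + 4 (a - a') (k - k') ≤ 0`.
  -- Since `a` and `a'` exceed `k` and `k'` by at most `8δ`, a difference of `k` and `k'` larger
  -- than `8δ` would give `a - a'` the same sign.
  have h1 : (a - a') * (k - k') ≤ 0 := by nlinarith [sq_nonneg (b - b')]
  have h2 : |k - k'| ≤ 8 * δ := by
    rw [abs_le]
    constructor <;> by_contra! hc <;> nlinarith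
  rw [show 2 * k - 2 * k' = 2 * (k - k') by ring, abs_mul, abs_two]; linarith

/-! ### Comparison maps of an earthquake -/

/-- The comparison map from the stratum of `x` to the stratum of `y`. -/
noncomputable def cmp (L : Set Geodesic) (A : Set Hyp → V ≃ₗ[ℝ] V) (x y : Hyp) : V ≃ₗ[ℝ] V :=
  comparison (A (stratum L x)) (A (stratum L y))

lemma cmp_apply (L : Set Geodesic) (A : Set Hyp → V ≃ₗ[ℝ] V) (x y : Hyp) (v : V) :
    cmp L A x y v = (A (stratum L x)).symm (A (stratum L y) v) := rfl

lemma cmp_cmp (L : Set Geodesic) (A : Set Hyp → V ≃ₗ[ℝ] V) (x y z : Hyp) (v : V) :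
    cmp L A x y (cmp L A y z v) = cmp L A x z v := by
  simp [cmp_apply]

/-! ### Trace and translation length -/

lemma trace_eq_sum (B : V ≃ₗ[ℝ] V) : LinearMap.trace ℝ V (B : V →ₗ[ℝ] V) =
    B (Pi.single 0 1) 0 + B (Pi.single 1 1) 1 + B (Pi.single 2 1) 2 := by
  rw [LinearMap.trace_eq_matrix_trace ℝ (Pi.basisFun ℝ (Fin 3)), Matrix.trace, Fin.sum_univ_three]
  simp

lemma translationLength_eq {B : V ≃ₗ[ℝ] V} {σ : V} {s : ℝ} (hσ : mink σ σ = 1) (hs : 0 ≤ s)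
    (hB : ∀ v, B v = translation σ s v) : translationLength B = s := by
  have h1 : LinearMap.trace ℝ V (B : V →ₗ[ℝ] V) = 1 + 2 * Real.cosh s := by
    rw [trace_eq_sum, hB, hB, hB]
    simp only [translation, mink, mcross, Pi.add_apply, Pi.sub_apply, Pi.smul_apply, smul_eq_mul]
    simp only [mink] at hσ
    simp
    linear_combination (1 - Real.cosh s) * hσ
  rw [translationLength, h1]
  rw [show (1 + 2 * Real.cosh s - 1) / 2 = Real.cosh s by ring, Real.arcosh_cosh hs]

lemma translationLength_of_eq_id {B : V ≃ₗ[ℝ] V} (hB : ∀ v, B v = v) : translationLength B = 0 := by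
  have h1 : LinearMap.trace ℝ V (B : V →ₗ[ℝ] V) = 3 := by
    rw [trace_eq_sum, hB, hB, hB]; simp; norm_num
  rw [translationLength, h1]
  norm_num

/-- The orientation of a leaf that crosses `[x, y]` transversely. -/
lemma exists_oriented_nrm {l : Geodesic} {x y : Hyp} (hl : l ∈ meeting (seg x y)) :
    ∃ n : V, (n = l.nrm ∨ n = -l.nrm) ∧ mink x.1 n ≤ 0 ∧ 0 ≤ mink y.1 n := by
  rw [mem_meeting_seg] at hl
  rcases le_or_gt (mink x.1 l.nrm) 0 with h1 | h1
  · rcases le_or_gt 0 (mink y.1 l.nrm) with h2 | h2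
    · exact ⟨l.nrm, Or.inl rfl, h1, h2⟩
    · refine ⟨-l.nrm, Or.inr rfl, ?_, ?_⟩ <;> rw [mink_neg_right]
      · nlinarith
      · linarith
  · refine ⟨-l.nrm, Or.inr rfl, ?_, ?_⟩ <;> rw [mink_neg_right]
    · linarith
    · nlinarith

lemma mink_self_of_oriented {l : Geodesic} {n : V} (hn : n = l.nrm ∨ n = -l.nrm) :
    mink n n = 1 := by
  rcases hn with h | h <;> rw [h]
  · exact l.mink_nrm_self
  · rw [mink_neg_right, mink_neg_left, l.mink_nrm_self, neg_neg]

lemma abs_mink_of_oriented {l : Geodesic} {n v : V} (hn : n = l.nrm ∨ n = -l.nrm) :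
    |mink v l.nrm| = |mink v n| := by
  rcases hn with h | h <;> rw [h]
  rw [mink_neg_right, abs_neg]

lemma sign_on_leaf {l l' : Geodesic} (hd : Disjoint l.points l'.points) {n : V}
    (hn : n = l'.nrm ∨ n = -l'.nrm) :
    (∀ z ∈ l.points, mink z.1 n ≤ 0) ∨ ∀ z ∈ l.points, 0 ≤ mink z.1 n := by
  have key : ∀ z ∈ l.points, ∀ w ∈ l.points, 0 < mink z.1 n * mink w.1 n := by
    intro z hz w hw
    have := mink_mul_pos_of_disjoint hd hz hw
    rcases hn with h | h <;> rw [h]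
    · exact this
    · rw [mink_neg_right, mink_neg_right, neg_mul_neg]; exact this
  by_cases hc : ∀ z ∈ l.points, mink z.1 n ≤ 0
  · exact Or.inl hc
  · push Not at hc
    obtain ⟨z, hz, hzn⟩ := hc
    right
    intro w hw
    have := key z hz w hw
    by_contra! hw'
    nlinarith

/-- Leaves of a lamination that cross a short segment are almost parallel. -/
lemma Frame.leaves_close {x : Hyp} {N : V} (h : Frame x N) {δ : ℝ} (hδ : 0 < δ) (hδ1 : δ ≤ 1)
    {L : Set Geodesic} (hL : IsGeodesicLamination L) {l l' : Geodesic} (hl : l ∈ L) (hl' : l' ∈ L)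
    (hm : l ∈ meeting (seg x (h.pt δ))) (hm' : l' ∈ meeting (seg x (h.pt δ))) :
    abs (|mink N l.nrm| - |mink N l'.nrm|) ≤ 16 * δ := by
  by_cases hne : l = l'
  · subst hne; simp only [sub_self, abs_zero]; positivity
  obtain ⟨n, hn, hnx, hny⟩ := exists_oriented_nrm hm
  obtain ⟨n', hn', hnx', hny'⟩ := exists_oriented_nrm hm'
  have hdis := hL.2 hl hl' hne
  have hnz : mink x.1 n < 0 ∨ 0 < mink (h.pt δ).1 n := by
    by_contra! hc
    have h1 : x ∈ l.points := by
      rw [Geodesic.mem_points_iff]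
      have : mink x.1 n = 0 := le_antisymm hnx hc.1
      rcases hn with e | e <;> rw [e] at this
      · exact this
      · rw [mink_neg_right] at this; linarith
    have h2 : h.pt δ ∈ l.points := by
      rw [Geodesic.mem_points_iff]
      have : mink (h.pt δ).1 n = 0 := le_antisymm hc.2 hny
      rcases hn with e | e <;> rw [e] at this
      · exact this
      · rw [mink_neg_right] at this; linarith
    have := mink_mul_pos_of_disjoint hdis h1 h2
    rw [mem_meeting_seg] at hm'
    linarith
  have hge := one_le_mink_of_noncrossing hn (mink_self_of_oriented hn') (sign_on_leaf hdis hn')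
    hnx hny hnz hnx' hny'
  have hclose := h.mink_normal_close hδ hδ1 (mink_self_of_oriented hn') hnx' hny'
    (mink_self_of_oriented hn) hnx hny hge
  obtain ⟨_, _, k, -, hN, hk, -⟩ := h.normal_coords hδ hδ1 (mink_self_of_oriented hn) hnx hny
  obtain ⟨_, _, k', -, hN', hk', -⟩ := h.normal_coords hδ hδ1 (mink_self_of_oriented hn') hnx' hny'
  rw [abs_mink_of_oriented hn, abs_mink_of_oriented hn', abs_of_nonneg (a := mink N n) (by linarith),
    abs_of_nonneg (a := mink N n') (by linarith), abs_sub_comm]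
  exact hclose

/-- The effect of the comparison map of two points of a short segment. -/
lemma Frame.cmp_step {x : Hyp} {N : V} (h : Frame x N) {δ : ℝ} (hδ : 0 < δ) (hδ1 : δ ≤ 1)
    {L : Set Geodesic} (hL : IsGeodesicLamination L) {E : Hyp → Hyp} {A : Set Hyp → V ≃ₗ[ℝ] V}
    (hE : IsLeftEarthquake L E A) {z w : Hyp} (hz : z ∈ seg x (h.pt δ))
    (hw : w ∈ seg z (h.pt δ)) : ∃ s k : ℝ, translationLength (cmp L A z w) = s ∧ 0 ≤ s ∧ 0 ≤ k ∧
      k ≤ 1 ∧ (0 < s → ∀ l ∈ L, l ∈ meeting (seg x (h.pt δ)) → abs (k - |mink N l.nrm|) ≤ 32 * δ) ∧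
      (s ≤ 1 / 1000 → ∀ p q : ℝ, |p| ≤ 2 → |q| ≤ 2 → ∃ α p' q' : ℝ, 0 < α ∧
        cmp L A z w (fvec x N p q) = α • fvec x N p' q' ∧
        |p' - p - s * k| ≤ 600 * s * (|p| + |q| + s) ∧
        |q' - q| ≤ 600 * s * (|p| + |q| + s)) := by
  -- Within one stratum the comparison map is the identity. The value of `k` is then irrelevant, as
  -- its closeness to the leaves is claimed only for `0 < s`.
  by_cases hst : stratum L z = stratum L w
  · have hid : ∀ v, cmp L A z w v = v := by intro v; rw [cmp_apply, hst]; simp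
    refine ⟨0, 0, translationLength_of_eq_id hid, le_rfl, le_rfl, zero_le_one,
      fun h => absurd h (lt_irrefl _), fun _ p q _ _ => ⟨1, p, q, one_pos, ?_, ?_, ?_⟩⟩
    · rw [hid, one_smul]
    · simp
    · simp
  obtain ⟨σ, s, hσ, hs, hneg, hpos, hB⟩ := hE.2.2 _ _ ⟨z, rfl⟩ ⟨w, rfl⟩ hst
  have hzσ := hneg z (mem_stratum L z)
  have hwσ := hpos w (mem_stratum L w)
  obtain ⟨a₁, b₁, ha₁, hb₁, hz'⟩ := id hz
  obtain ⟨a₂, b₂, ha₂, hb₂, hw'⟩ := id hw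
  have hb₂0 : 0 < b₂ := by
    rcases hb₂.eq_or_lt with e | e
    · exfalso; apply hst
      rw [← e, zero_smul, add_zero] at hw'
      rw [Hyp.eq_of_smul hw']
    · exact e
  -- The weak signs of `σ` at `z` and `w` propagate outward to the two ends of the segment, since
  -- the coefficients `b₂` and `a₁` are positive.
  have hyσ : 0 ≤ mink (h.pt δ).1 σ := by
    rw [hw', mink_add_left, mink_smul_left, mink_smul_left] at hwσ
    by_contra! hc
    nlinarith [mul_nonneg ha₂ (neg_nonneg.2 hzσ), mul_neg_of_pos_of_neg hb₂0 hc]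
  have ha₁0 : 0 < a₁ := by
    rcases ha₁.eq_or_lt with e | e
    · exfalso; apply hst
      rw [← e, zero_smul, zero_add] at hz'
      have h1 := Hyp.eq_of_smul hz'
      rw [← h1, ← add_smul] at hw'
      rw [Hyp.eq_of_smul hw']
    · exact e
  have hxσ : mink x.1 σ ≤ 0 := by
    rw [hz', mink_add_left, mink_smul_left, mink_smul_left] at hzσ
    by_contra! hc
    nlinarith [mul_nonneg hb₁ hyσ, mul_pos ha₁0 hc]
  obtain ⟨a, b, k, hd, hN, hk0, hk2, hka, -, ha4, hb1, -⟩ := h.normal_coords hδ hδ1 hσ hxσ hyσ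
  refine ⟨s, 2 * k, translationLength_eq hσ hs hB, hs, by linarith, by linarith, fun _ => ?_,
    fun hs1 p q hp hq => ?_⟩
  -- The axis of a comparison map need not be a leaf. It is compared with a leaf `l₁` across `[z,
  -- w]` that it does not cross, and `l₁` with `l`; each comparison costs `16 δ`. The leaf `l₁`
  -- cannot contain both `z` and `w`, because it would then be their common stratum.
  · obtain ⟨l₁, hl₁, hm₁, hle₁⟩ := exists_leaf_nonpos hL hst hneg
    have hwseg : w ∈ seg x (h.pt δ) := seg_subset_seg hz (right_mem_seg _ _) hw
    have hm₁' := meeting_mono (seg_subset_seg hz hwseg) hm₁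
    intro l hl hm
    have hc1 := h.leaves_close hδ hδ1 hL hl₁ hl hm₁' hm
    obtain ⟨n, hn, hnz, hnw⟩ := exists_oriented_nrm hm₁
    have hnz' : mink z.1 n < 0 ∨ 0 < mink w.1 n := by
      by_contra! hc
      have e1 : mink z.1 n = 0 := le_antisymm hnz hc.1
      have e2 : mink w.1 n = 0 := le_antisymm hc.2 hnw
      have h1 : z ∈ l₁.points := by
        rw [Geodesic.mem_points_iff]
        rcases hn with e | e <;> rw [e] at e1
        · exact e1
        · rw [mink_neg_right] at e1; linarith
      have h2 : w ∈ l₁.points := by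
        rw [Geodesic.mem_points_iff]
        rcases hn with e | e <;> rw [e] at e2
        · exact e2
        · rw [mink_neg_right] at e2; linarith
      apply hst
      have hcompl : ∀ u, u ∈ l₁.points → stratum L u = l₁.points := by
        intro u hu
        have hcc : connectedComponentIn (⋃ l ∈ L, l.points)ᶜ u = ∅ := by
          apply connectedComponentIn_eq_empty
          intro hc
          exact hc (mem_biUnion hl₁ hu)
        unfold stratum
        rw [hcc, union_empty]
        ext v
        constructor
        · rintro ⟨l', hl', hul', hvl'⟩
          by_cases e : l' = l₁
          · rwa [← e]
          · exact ((hL.2 hl' hl₁ e).le_bot ⟨hul', hu⟩).elim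
        · intro hv; exact ⟨l₁, hl₁, hu, hv⟩
      rw [hcompl z h1, hcompl w h2]
    have hge := one_le_mink_of_noncrossing hn hσ (Or.inl hle₁) hnz hnw hnz' hzσ hwσ
    have hny : 0 ≤ mink (h.pt δ).1 n := by
      rw [hw', mink_add_left, mink_smul_left, mink_smul_left] at hnw
      by_contra! hc
      nlinarith [mul_nonneg ha₂ (neg_nonneg.2 hnz), mul_neg_of_pos_of_neg hb₂0 hc]
    have hnx : mink x.1 n ≤ 0 := by
      rw [hz', mink_add_left, mink_smul_left, mink_smul_left] at hnz
      by_contra! hc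
      nlinarith [mul_nonneg hb₁ hny, mul_pos ha₁0 hc]
    have hc2 := h.mink_normal_close hδ hδ1 hσ hxσ hyσ (mink_self_of_oriented hn) hnx hny hge
    obtain ⟨_, _, k', -, hN', hk', -⟩ :=
      h.normal_coords hδ hδ1 (mink_self_of_oriented hn) hnx hny
    rw [abs_mink_of_oriented hn, abs_of_nonneg (a := mink N n) (by linarith)] at hc1
    rw [hN] at hc2
    calc abs (2 * k - |mink N l.nrm|) ≤ |2 * k - mink N n| + abs (mink N n - |mink N l.nrm|) :=
          abs_sub_le _ _ _
      _ ≤ 32 * δ := by linarith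
  · obtain ⟨hu0, hu, hv⟩ := cosh_sinh_bounds hs (hs1.trans (by norm_num))
    obtain ⟨α, p', q', hα, e1, e2, e3, e4, e5⟩ := step_bounds (a := a) (b := b) (c := -k) (p := p)
      (q := q) (s := s) (u := Real.cosh s - 1) (v := Real.sinh s)
      (by rw [abs_of_nonneg (hk0.trans hka)]; exact ha4) (by linarith)
      (by rw [abs_neg, abs_of_nonneg hk0]; linarith) hp hq hs hs1 hu0 hu hv
    refine ⟨α, p', q', hα, ?_, by convert e4 using 4; ring, e5⟩
    have hB' : cmp L A z w (fvec x N p q) = translation σ s (fvec x N p q) := hB _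
    rw [hB', h.translation_fvec hd, fvec]
    simp only [add_sub_cancel] at e1 e2 e3
    rw [e1, e2, e3]
    module

/-! ### Comparison maps across a short segment -/

/-- The effect of the comparison map of a short segment, in terms of a partition. -/
lemma Frame.cmp_chain {x : Hyp} {N : V} (h : Frame x N) {δ : ℝ} (hδ : 0 < δ) (hδ1 : δ ≤ 1)
    {L : Set Geodesic} (hL : IsGeodesicLamination L) {E : Hyp → Hyp} {A : Set Hyp → V ≃ₗ[ℝ] V}
    (hE : IsLeftEarthquake L E A) {T p q : ℝ} (hT : 6002 * T ≤ 1) (hp : |p| ≤ 3 / 2)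
    (hq : |q| ≤ 3 / 2) (n : ℕ) : ∀ P : ℕ → Hyp, P 0 ∈ seg x (h.pt δ) → P n = h.pt δ →
      (∀ i < n, P (i + 1) ∈ seg (P i) (h.pt δ)) →
      ∀ S, S = ∑ i ∈ Finset.range n, translationLength (cmp L A (P i) (P (i + 1))) → S ≤ T →
      0 ≤ S ∧ ∃ α p' q' K : ℝ, 0 < α ∧ cmp L A (P 0) (h.pt δ) (fvec x N p q) = α • fvec x N p' q' ∧
        |p' - p| ≤ 3001 * S ∧ |q' - q| ≤ 3001 * S ∧
        |p' - p - K| ≤ 600 * S * (|p| + |q| + 6003 * T) ∧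
        |q' - q| ≤ 600 * S * (|p| + |q| + 6003 * T) ∧ 0 ≤ K ∧ K ≤ S ∧
        ∀ l ∈ L, l ∈ meeting (seg x (h.pt δ)) → abs (K - S * |mink N l.nrm|) ≤ 32 * δ * S := by
  induction n with
  | zero =>
    intro P _ hPn _ S hS _
    simp only [Finset.range_zero, Finset.sum_empty] at hS
    subst hS
    refine ⟨le_rfl, 1, p, q, 0, one_pos, ?_, ?_⟩
    · rw [hPn, cmp_apply, LinearEquiv.symm_apply_apply, one_smul]
    · simp
  | succ n ih =>
    intro P hP0 hPn hP S hS hST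
    -- The first interval of the partition is split off: its comparison map is applied last, after
    -- the composite of all later ones. One step moves `p` by at most `3000 s + s`, whence `3001`,
    -- and `6002 T ≤ 1` keeps `|p|` and `|q|` below `3/2 + 1/2 = 2`.
    rw [Finset.sum_range_succ'] at hS
    obtain ⟨s, k, hs, hs0, hk0, hk1, hkl, hstep⟩ :=
      h.cmp_step hδ hδ1 hL hE hP0 (hP 0 (by omega))
    rw [hs] at hS
    have hP1 : P (0 + 1) ∈ seg x (h.pt δ) := seg_subset_seg hP0 (right_mem_seg _ _) (hP 0 (by omega))
    obtain ⟨hS'0, α, p₁, q₁, K, hα, hcmp, hp₁, hq₁, hpK, hqK, hK0, hKS, hKl⟩ :=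
      ih (fun i => P (i + 1)) hP1 hPn (fun i hi => hP (i + 1) (by omega)) _ rfl
        (by linarith)
    set S' := ∑ i ∈ Finset.range n, translationLength (cmp L A (P (i + 1)) (P (i + 1 + 1)))
    have hT0 : 0 ≤ T := by linarith
    have hS'T : S' ≤ T := by linarith
    have hsT : s ≤ T := by linarith
    have ep : |p₁| ≤ |p| + 3001 * T := by
      have := abs_add_le p (p₁ - p); rw [add_sub_cancel] at this; linarith
    have eq : |q₁| ≤ |q| + 3001 * T := by
      have := abs_add_le q (q₁ - q); rw [add_sub_cancel] at this; linarith
    have hp2 : |p₁| ≤ 2 := by linarith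
    have hq2 : |q₁| ≤ 2 := by linarith
    obtain ⟨β, p₂, q₂, hβ, hcmp₂, hp₂, hq₂⟩ := hstep (by linarith) p₁ q₁ hp2 hq2
    have hsmall : 600 * s * (|p₁| + |q₁| + s) ≤ 3000 * s := by
      have : |p₁| + |q₁| + s ≤ 5 := by linarith
      nlinarith
    have hsB : 600 * s * (|p₁| + |q₁| + s) ≤ 600 * s * (|p| + |q| + 6003 * T) :=
      mul_le_mul_of_nonneg_left (by linarith) (by positivity)
    have hsk : 0 ≤ s * k := mul_nonneg hs0 hk0
    have hsk1 : s * k ≤ s := mul_le_of_le_one_right hs0 hk1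
    refine ⟨by linarith, α * β, p₂, q₂, K + s * k, by positivity, ?_, ?_, ?_, ?_, ?_, by linarith,
      by linarith, ?_⟩
    · rw [← cmp_cmp L A (P 0) (P (0 + 1)), hcmp, map_smul, hcmp₂, smul_smul]
    · rw [hS]
      rw [abs_le] at hp₂ hp₁ ⊢
      constructor <;> linarith
    · rw [hS]
      rw [abs_le] at hq₂ hq₁ ⊢
      constructor <;> linarith
    · rw [hS, mul_add 600, add_mul]
      rw [abs_le] at hpK hp₂ ⊢
      constructor <;> linarith
    · rw [hS, mul_add 600, add_mul]
      rw [abs_le] at hqK hq₂ ⊢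
      constructor <;> linarith
    · intro l hl hm
      have h1 := hKl l hl hm
      have h2 : abs (s * k - s * |mink N l.nrm|) ≤ 32 * δ * s := by
        rcases hs0.eq_or_lt with e | e
        · rw [← e]; simp
        · rw [← mul_sub, abs_mul, abs_of_nonneg hs0, mul_comm]
          exact mul_le_mul_of_nonneg_right (hkl e l hl hm) hs0
      rw [hS, add_mul, mul_add]
      rw [abs_le] at h1 h2 ⊢
      constructor <;> linarith

/-- A leaf that crosses the segment `[x, x(δ)]` has `|⟨N, n⟩| ≤ 1`. -/
lemma Frame.abs_mink_le_one {x : Hyp} {N : V} (h : Frame x N) {δ : ℝ} (hδ : 0 < δ) (hδ1 : δ ≤ 1)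
    {l : Geodesic} (hm : l ∈ meeting (seg x (h.pt δ))) : |mink N l.nrm| ≤ 1 := by
  obtain ⟨n, hn, hnx, hny⟩ := exists_oriented_nrm hm
  obtain ⟨_, _, k, -, hN, hk0, hk, -⟩ :=
    h.normal_coords hδ hδ1 (mink_self_of_oriented hn) hnx hny
  rw [abs_mink_of_oriented hn, hN, abs_of_nonneg (by linarith)]
  linarith

/-- The effect of the comparison map of a short segment, in terms of the earthquake measure. -/
lemma Frame.cmp_block {x : Hyp} {N : V} (h : Frame x N) {δ : ℝ} (hδ : 0 < δ) (hδ1 : δ ≤ 1)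
    {ν : Measure Geodesic} (hν : IsMeasuredLamination ν) {E : Hyp → Hyp} {A : Set Hyp → V ≃ₗ[ℝ] V}
    (hE : IsLeftEarthquake ν.support E A) {m : ℝ}
    (hm : m = (ν (meeting (seg x (h.pt δ)))).toReal)
    (hG : IsGLB (partitionSums ν.support A x (h.pt δ)) m) {p q : ℝ} (hT : 10000 * m ≤ 1)
    (hp : |p| ≤ 3 / 2) (hq : |q| ≤ 3 / 2) :
    ∃ α p' q' : ℝ, 0 < α ∧ cmp ν.support A x (h.pt δ) (fvec x N p q) = α • fvec x N p' q' ∧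
      |p' - p - ∫ l in meeting (seg x (h.pt δ)), |mink N l.nrm| ∂ν| ≤
        600 * m * (|p| + |q| + 6003 * m) + 48 * δ * m ∧
      |q' - q| ≤ 600 * m * (|p| + |q| + 6003 * m) := by
  have := hν.1
  set I := ∫ l in meeting (seg x (h.pt δ)), |mink N l.nrm| ∂ν
  have hm0 : 0 ≤ m := by rw [hm]; exact ENNReal.toReal_nonneg
  have hfin : ν (meeting (seg x (h.pt δ))) ≠ ∞ := (isCompact_meeting_seg _ _).measure_lt_top.ne
  have hae : ∀ᵐ l ∂(ν.restrict (meeting (seg x (h.pt δ)))), l ∈ ν.support :=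
    ae_restrict_of_ae Measure.support_mem_ae
  -- As leaves across the segment are almost parallel, any one of them represents the integral. This
  -- makes the sum over a partition comparable with the integral without refining the partition.
  have hI : ∀ l₀ ∈ ν.support, l₀ ∈ meeting (seg x (h.pt δ)) →
      abs (I - m * |mink N l₀.nrm|) ≤ 16 * δ * m := by
    intro l₀ hl₀ hm₀
    have e : I - m * |mink N l₀.nrm| =
        ∫ l in meeting (seg x (h.pt δ)), (|mink N l.nrm| - |mink N l₀.nrm|) ∂ν := by
      rw [integral_sub (integrableOn_abs_mink ν N _ _) (integrableOn_const hfin), setIntegral_const,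
        smul_eq_mul, Measure.real, ← hm]
    rw [e, hm]
    rw [← Real.norm_eq_abs]
    refine norm_setIntegral_le_of_norm_le_const_ae hfin.lt_top ?_
    filter_upwards [hae, ae_restrict_mem (measurableSet_meeting_seg _ _)] with l hl hlm
    exact h.leaves_close hδ hδ1 hν.2 hl hl₀ hlm hm₀
  have hinst : ∀ ε : ℝ, 0 < ε → ε ≤ 1 / 100000 → ∃ α p' q' : ℝ, 0 < α ∧
      cmp ν.support A x (h.pt δ) (fvec x N p q) = α • fvec x N p' q' ∧
      |p' - p - I| ≤ 600 * (m + ε) * (|p| + |q| + 6003 * (m + ε)) +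
        (32 * δ * (m + ε) + ε + 16 * δ * m) ∧
      |q' - q| ≤ 600 * (m + ε) * (|p| + |q| + 6003 * (m + ε)) := by
    intro ε hε hε1
    -- The mass is the infimum of the partition sums, so some partition has total length within `ε`
    -- of it.
    obtain ⟨S, hSmem, hmS, hSm⟩ := hG.exists_between (show m < m + ε by linarith)
    obtain ⟨n, P, hP0, hPn, hP, hS⟩ := hSmem
    obtain ⟨hS0, α, p', q', K, hα, hcmp, -, -, hpK, hqK, hK0, hKS, hKl⟩ :=
      h.cmp_chain hδ hδ1 hν.2 hE (T := m + ε) (by linarith) hp hq n P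
      (by rw [hP0]; exact left_mem_seg _ _) hPn hP S hS hSm.le
    rw [hP0] at hcmp
    have hB : 600 * S * (|p| + |q| + 6003 * (m + ε)) ≤
        600 * (m + ε) * (|p| + |q| + 6003 * (m + ε)) :=
      mul_le_mul_of_nonneg_right (by linarith) (by positivity)
    have hKI : |K - I| ≤ 32 * δ * (m + ε) + ε + 16 * δ * m := by
      by_cases hne : ∃ l₀ ∈ ν.support, l₀ ∈ meeting (seg x (h.pt δ))
      · obtain ⟨l₀, hl₀, hm₀⟩ := hne
        have h1 := hI l₀ hl₀ hm₀
        have h2 := hKl l₀ hl₀ hm₀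
        have h3 := h.abs_mink_le_one hδ hδ1 hm₀
        have h4 : abs (S * |mink N l₀.nrm| - m * |mink N l₀.nrm|) ≤ ε := by
          rw [← sub_mul, abs_mul, abs_abs, abs_of_nonneg (by linarith)]
          calc (S - m) * |mink N l₀.nrm| ≤ (S - m) * 1 :=
                mul_le_mul_of_nonneg_left h3 (by linarith)
            _ ≤ ε := by linarith
        have h5 : 32 * δ * S ≤ 32 * δ * (m + ε) :=
          mul_le_mul_of_nonneg_left hSm.le (by positivity)
        rw [abs_le] at h1 h2 h4 ⊢
        constructor <;> linarith
      · push Not at hne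
        have hz : ν (meeting (seg x (h.pt δ))) = 0 :=
          measure_mono_null (t := ν.supportᶜ) (fun l hl hls => hne l hls hl)
            Measure.measure_compl_support
        have hI0 : I = 0 := setIntegral_measure_zero _ hz
        have hm00 : m = 0 := by rw [hm, hz]; simp
        rw [hI0, sub_zero, abs_of_nonneg hK0, hm00]
        have : 0 ≤ 32 * δ * ε := by positivity
        linarith
    refine ⟨α, p', q', hα, hcmp, ?_, hqK.trans hB⟩
    calc |p' - p - I| = |(p' - p - K) + (K - I)| := by congr 1; ring
      _ ≤ _ := (abs_add_le _ _).trans (add_le_add (hpK.trans hB) hKI)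
  -- The partition depends on `ε`, but the image vector does not, and its coordinates are unique. So
  -- the coordinates found for one `ε` satisfy the bounds for all, and `ε` can tend to `0`.
  obtain ⟨α, p', q', hα, hcmp, -, -⟩ := hinst (1 / 100000) (by norm_num) le_rfl
  have hall : ∀ ε : ℝ, 0 < ε → ε ≤ 1 / 100000 →
      |p' - p - I| ≤ 600 * (m + ε) * (|p| + |q| + 6003 * (m + ε)) +
        (32 * δ * (m + ε) + ε + 16 * δ * m) ∧
      |q' - q| ≤ 600 * (m + ε) * (|p| + |q| + 6003 * (m + ε)) := by
    intro ε hε hε1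
    obtain ⟨α₂, p₂, q₂, hα₂, hcmp₂, h1, h2⟩ := hinst ε hε hε1
    rw [hcmp] at hcmp₂
    obtain ⟨-, e1, e2⟩ := h.fvec_injective hα.ne' hcmp₂
    rw [e1, e2]; exact ⟨h1, h2⟩
  have hev : ∀ᶠ ε : ℝ in 𝓝[>] 0, 0 < ε ∧ ε ≤ 1 / 100000 := by
    filter_upwards [Ioc_mem_nhdsGT (show (0 : ℝ) < 1 / 100000 by norm_num)] with ε hε using hε
  refine ⟨α, p', q', hα, hcmp, ?_, ?_⟩
  · have hlim : Tendsto (fun ε : ℝ => 600 * (m + ε) * (|p| + |q| + 6003 * (m + ε)) +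
        (32 * δ * (m + ε) + ε + 16 * δ * m)) (𝓝[>] 0)
        (𝓝 (600 * (m + 0) * (|p| + |q| + 6003 * (m + 0)) + (32 * δ * (m + 0) + 0 + 16 * δ * m))) :=
      (Continuous.tendsto (by fun_prop) 0).mono_left nhdsWithin_le_nhds
    have := ge_of_tendsto hlim (hev.mono fun ε hε => (hall ε hε.1 hε.2).1)
    simp only [add_zero] at this
    linarith
  · have hlim : Tendsto (fun ε : ℝ => 600 * (m + ε) * (|p| + |q| + 6003 * (m + ε))) (𝓝[>] 0)
        (𝓝 (600 * (m + 0) * (|p| + |q| + 6003 * (m + 0)))) :=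
      (Continuous.tendsto (by fun_prop) 0).mono_left nhdsWithin_le_nhds
    have := ge_of_tendsto hlim (hev.mono fun ε hε => (hall ε hε.1 hε.2).2)
    simpa only [add_zero] using this

/-! ### Earthquakes along a geodesic ray -/

/-- The mass of the `i`-th segment of length `δ` of a ray. -/
noncomputable def Frame.mass (ν : Measure Geodesic) {x : Hyp} {N : V} (h : Frame x N) (δ : ℝ)
    (i : ℕ) : ℝ :=
  (ν (meeting (seg (h.pt (i * δ)) (h.pt ((i + 1 : ℕ) * δ))))).toReal

/-- The exponentially weighted mass of the first `n` segments of a ray. -/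
noncomputable def Frame.wmass (ν : Measure Geodesic) {x : Hyp} {N : V} (h : Frame x N) (δ : ℝ)
    (n : ℕ) : ℝ :=
  ∑ i ∈ Finset.range n, Real.exp (-(i * δ)) * h.mass ν δ i

/-- The integral of `|⟨N, n⟩|` over the geodesics that meet a segment of a ray. -/
noncomputable def Frame.rayIntegral (ν : Measure Geodesic) {x : Hyp} {N : V} (h : Frame x N)
    (r : ℝ) : ℝ :=
  ∫ l in meeting (seg x (h.pt r)), |mink N l.nrm| ∂ν

lemma Frame.mass_nonneg (ν : Measure Geodesic) {x : Hyp} {N : V} (h : Frame x N) (δ : ℝ) (i : ℕ) :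
    0 ≤ h.mass ν δ i := ENNReal.toReal_nonneg

lemma Frame.at_pt_pt_mul {x : Hyp} {N : V} (h : Frame x N) (δ : ℝ) (i : ℕ) :
    (h.at_pt δ).pt (i * δ) = h.pt ((i + 1 : ℕ) * δ) := by
  rw [h.pt_pt]; congr 1; push_cast; ring

lemma Frame.mass_at_pt (ν : Measure Geodesic) {x : Hyp} {N : V} (h : Frame x N) (δ : ℝ) (i : ℕ) :
    (h.at_pt δ).mass ν δ i = h.mass ν δ (i + 1) := by
  rw [mass, mass, h.at_pt_pt_mul, h.at_pt_pt_mul]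

lemma Frame.wmass_succ (ν : Measure Geodesic) {x : Hyp} {N : V} (h : Frame x N) (δ : ℝ) (n : ℕ) :
    h.wmass ν δ (n + 1) = h.mass ν δ 0 + Real.exp (-δ) * (h.at_pt δ).wmass ν δ n := by
  rw [wmass, Finset.sum_range_succ', wmass, Finset.mul_sum, add_comm]
  congr 1
  · simp
  · refine Finset.sum_congr rfl fun i _ => ?_
    rw [h.mass_at_pt, ← mul_assoc, ← Real.exp_add]
    congr 2; push_cast; ring

/-- The frame at distance `δ` has null vector `exp δ • N`; the factor `exp (-δ)` undoes this
rescaling. The dividing point must avoid weighted leaves so that no atom is counted twice. -/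
lemma Frame.rayIntegral_add {ν : Measure Geodesic} (hν : IsMeasuredLamination ν) {x : Hyp} {N : V}
    (h : Frame x N) {δ s : ℝ} (hδ : 0 ≤ δ) (hs : 0 ≤ s) (hoff : OffWeightedLeaves ν (h.pt δ)) :
    h.rayIntegral ν (δ + s) =
      h.rayIntegral ν δ + Real.exp (-δ) * (h.at_pt δ).rayIntegral ν s := by
  have hz : h.pt δ ∈ seg x (h.pt (δ + s)) := by
    have := h.pt_mem_seg (r := 0) (s := δ) (t := δ + s) hδ (by linarith)
    rwa [h.pt_zero] at this
  rw [rayIntegral, integral_meeting_add hν hz hoff, rayIntegral, rayIntegral, h.pt_pt]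
  congr 1
  simp only [mink_smul_left, abs_mul, abs_of_pos (Real.exp_pos δ)]
  rw [integral_const_mul, ← mul_assoc, ← Real.exp_add]
  simp

lemma Frame.rayIntegral_zero {ν : Measure Geodesic} (hν : IsMeasuredLamination ν) {x : Hyp} {N : V}
    (h : Frame x N) (hoff : OffWeightedLeaves ν x) : h.rayIntegral ν 0 = 0 := by
  rw [rayIntegral, h.pt_zero]
  apply setIntegral_measure_zero
  refine measure_mono_null (fun l hl => ?_) (measure_through_eq_zero hν hoff)
  rw [mem_meeting_seg] at hl
  change x ∈ l.points
  rw [Geodesic.mem_points_iff]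
  nlinarith

lemma Frame.rayIntegral_nonneg (ν : Measure Geodesic) {x : Hyp} {N : V} (h : Frame x N) (r : ℝ) :
    0 ≤ h.rayIntegral ν r := integral_nonneg fun _ => abs_nonneg _

lemma Frame.mass_zero (ν : Measure Geodesic) {x : Hyp} {N : V} (h : Frame x N) (δ : ℝ) :
    h.mass ν δ 0 = (ν (meeting (seg x (h.pt δ)))).toReal := by
  simp [mass, h.pt_zero]

lemma Frame.rayIntegral_le_mass {ν : Measure Geodesic} (hν : IsMeasuredLamination ν) {x : Hyp}
    {N : V} (h : Frame x N) {δ : ℝ} (hδ : 0 < δ) (hδ1 : δ ≤ 1) :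
    h.rayIntegral ν δ ≤ h.mass ν δ 0 := by
  have := hν.1
  have hfin : ν (meeting (seg x (h.pt δ))) ≠ ∞ := (isCompact_meeting_seg _ _).measure_lt_top.ne
  rw [mass_zero, rayIntegral]
  calc ∫ l in meeting (seg x (h.pt δ)), |mink N l.nrm| ∂ν
      ≤ ∫ l in meeting (seg x (h.pt δ)), (1 : ℝ) ∂ν :=
        setIntegral_mono_on (integrableOn_abs_mink ν N _ _) (integrableOn_const hfin)
          (measurableSet_meeting_seg _ _) fun l hl => h.abs_mink_le_one hδ hδ1 hl
    _ = _ := by simp [Measure.real]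

lemma Frame.rayIntegral_le_wmass {ν : Measure Geodesic} (hν : IsMeasuredLamination ν) {δ : ℝ}
    (hδ : 0 < δ) (hδ1 : δ ≤ 1) (n : ℕ) : ∀ {x : Hyp} {N : V} (h : Frame x N),
      (∀ j : ℕ, OffWeightedLeaves ν (h.pt (j * δ))) →
      h.rayIntegral ν (n * δ) ≤ h.wmass ν δ n := by
  induction n with
  | zero =>
    intro x N h hoff
    have h0 := hoff 0
    simp only [Nat.cast_zero, zero_mul, h.pt_zero] at h0 ⊢
    simp [h.rayIntegral_zero hν h0, wmass]
  | succ n ih =>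
    intro x N h hoff
    have h1 : OffWeightedLeaves ν (h.pt δ) := by simpa using hoff 1
    have e : ((n + 1 : ℕ) : ℝ) * δ = δ + n * δ := by push_cast; ring
    rw [e, h.rayIntegral_add hν hδ.le (by positivity) h1, h.wmass_succ]
    have h2 := ih (h.at_pt δ) fun j => by rw [h.at_pt_pt_mul]; exact hoff _
    have h3 := h.rayIntegral_le_mass hν hδ hδ1
    have := mul_le_mul_of_nonneg_left h2 (Real.exp_pos (-δ)).le
    linarith

/-- The image of a far point of a ray under an earthquake, seen from the origin of the ray. -/
lemma Frame.ray_estimate {ν : Measure Geodesic} (hν : IsMeasuredLamination ν) {E : Hyp → Hyp}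
    {A : Set Hyp → V ≃ₗ[ℝ] V} (hE : IsLeftEarthquake ν.support E A)
    (hG : ∀ x y : Hyp, OffWeightedLeaves ν x → OffWeightedLeaves ν y →
      IsGLB (partitionSums ν.support A x y) (ν (meeting (seg x y))).toReal)
    {δ K : ℝ} (hδ : 0 < δ) (hδ1 : δ ≤ 1) (hK : 10000 * K ≤ 1) (n : ℕ) :
    ∀ {x : Hyp} {N : V} (h : Frame x N), (∀ j : ℕ, OffWeightedLeaves ν (h.pt (j * δ))) →
      (∀ j k : ℕ, (h.at_pt (j * δ)).wmass ν δ k ≤ K) →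
      ∃ α p q : ℝ, 0 < α ∧ cmp ν.support A x (h.pt (n * δ)) (h.pt (n * δ)).1 = α • fvec x N p q ∧
        |p| ≤ 2300 * h.wmass ν δ n ∧ |q| ≤ Real.exp (-(2 * (n * δ))) + 2300 * h.wmass ν δ n ∧
        |p - h.rayIntegral ν (n * δ)| ≤
          h.wmass ν δ n * (7000000 * K + 48 * δ) + 600 * K * n * Real.exp (-(n * δ)) := by
  induction n with
  | zero =>
    intro x N h hoff _
    have h0 := hoff 0
    simp only [Nat.cast_zero, zero_mul, h.pt_zero] at h0 ⊢
    -- The base point itself is half the sum of the two opposite null vectors, so the induction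
    -- starts with `p = 0` and `q = 1`.
    refine ⟨1 / 2, 0, 1, by norm_num, ?_, ?_⟩
    · rw [cmp_apply, LinearEquiv.symm_apply_apply, fvec, opp]; module
    · simp [wmass, h.rayIntegral_zero hν h0]
  | succ n ih =>
    intro x N h hoff hsum
    have h0 : OffWeightedLeaves ν x := by simpa [h.pt_zero] using hoff 0
    have h1 : OffWeightedLeaves ν (h.pt δ) := by simpa using hoff 1
    have hK' : ∀ k, h.wmass ν δ k ≤ K := by
      intro k
      have := hsum 0 k
      have e : ∀ (y : Hyp) (N' : V) (h' : Frame y N'), y = x → N' = N →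
          h'.wmass ν δ k = h.wmass ν δ k := by rintro y N' h' rfl rfl; rfl
      rwa [e _ _ (h.at_pt ((0 : ℕ) * δ)) (by simp [h.pt_zero]) (by simp)] at this
    -- The first segment is split off, and the estimate is applied to the rest of the ray from its
    -- own base point. Returning to `x` first contracts the coordinates and then applies the
    -- comparison map of one segment.
    obtain ⟨α, p₁, q₁, hα, hcmp, hp₁, hq₁, herr⟩ := ih (h.at_pt δ)
      (fun j => by rw [h.at_pt_pt_mul]; exact hoff _) (fun j k => by
        have := hsum (j + 1) k
        have e : ∀ (y y' : Hyp) (N' N'' : V) (h' : Frame y N') (h'' : Frame y' N''), y = y' →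
          N' = N'' → h'.wmass ν δ k = h''.wmass ν δ k := by
            rintro y _ N' _ h' h'' rfl rfl; rfl
        rwa [e _ _ _ _ ((h.at_pt δ).at_pt (j * δ)) (h.at_pt ((j + 1 : ℕ) * δ))
          (h.at_pt_pt_mul δ j) (by rw [smul_smul, ← Real.exp_add]; congr 2; push_cast; ring)])
    set S' := (h.at_pt δ).wmass ν δ n
    have hS := h.wmass_succ ν δ n
    set S := h.wmass ν δ (n + 1)
    set m := h.mass ν δ 0 with hm
    have hm0 : 0 ≤ m := h.mass_nonneg ν δ 0
    have hmK : m ≤ K := by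
      have := hK' 1
      simpa [wmass] using this
    have hSK : S ≤ K := hK' _
    have hed : 0 < Real.exp (-δ) := Real.exp_pos _
    have hed1 : Real.exp (-δ) ≤ 1 := Real.exp_le_one_iff.2 (by linarith)
    have he2 : Real.exp (-(2 * δ)) = Real.exp (-δ) * Real.exp (-δ) := by
      rw [← Real.exp_add]; ring_nf
    have hS'0 : 0 ≤ S' := Finset.sum_nonneg fun i _ =>
      mul_nonneg (Real.exp_pos _).le (Frame.mass_nonneg _ _ _ _)
    have heS : Real.exp (-δ) * S' ≤ S := by linarith
    set p := Real.exp (-δ) * p₁ with hp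
    set q := Real.exp (-(2 * δ)) * q₁ with hq
    have hpb : |p| ≤ 2300 * (Real.exp (-δ) * S') := by
      rw [hp, abs_mul, abs_of_pos hed]
      have := mul_le_mul_of_nonneg_left hp₁ hed.le
      linarith
    have heexp : Real.exp (-(2 * ((n + 1 : ℕ) * δ))) =
        Real.exp (-(2 * δ)) * Real.exp (-(2 * (n * δ))) := by
      rw [← Real.exp_add]; congr 1; push_cast; ring
    have hqb : |q| ≤ Real.exp (-(2 * ((n + 1 : ℕ) * δ))) + 2300 * (Real.exp (-δ) * S') := by
      rw [hq, abs_mul, abs_of_pos (Real.exp_pos _), heexp]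
      have h2 := mul_le_mul_of_nonneg_left hq₁ (Real.exp_pos (-(2 * δ))).le
      have h3 : Real.exp (-(2 * δ)) * S' ≤ Real.exp (-δ) * S' := by
        rw [he2, mul_assoc]
        exact mul_le_of_le_one_left (mul_nonneg hed.le hS'0) hed1
      linarith
    have hX1 : Real.exp (-(2 * ((n + 1 : ℕ) * δ))) ≤ 1 :=
      Real.exp_le_one_iff.2 (by rw [neg_nonpos]; positivity)
    obtain ⟨β, p', q', hβ, hblk, hp', hq'⟩ := h.cmp_block hδ hδ1 hν hE (m := m)
      (by rw [hm, h.mass_zero]) (by rw [hm, h.mass_zero]; exact hG _ _ h0 h1) (p := p) (q := q)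
      (by linarith) (by linarith) (by linarith)
    have hI1 := h.rayIntegral_le_mass hν hδ hδ1
    have hI0 := h.rayIntegral_nonneg ν δ
    change |p' - p - h.rayIntegral ν δ| ≤ _ at hp'
    have hcast : ((n + 1 : ℕ) : ℝ) * δ = δ + n * δ := by push_cast; ring
    refine ⟨α * Real.exp δ * β, p', q', by positivity, ?_, ?_, ?_, ?_⟩
    · rw [← cmp_cmp _ _ x (h.pt δ), ← h.at_pt_pt_mul δ n, hcmp, map_smul, h.fvec_rescale, map_smul,
        hblk]
      module
    -- `600 * 3.5 + 48` is below `2290`, and the integral over the segment adds at most `m`. The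
    -- total stays below `2300 m`.
    · have hc : 600 * m * (|p| + |q| + 6003 * m) + 48 * δ * m ≤ 2290 * m := by
        have : |p| + |q| + 6003 * m ≤ 3.5 := by linarith
        nlinarith
      have := abs_sub_abs_le_abs_sub (p' - p) (h.rayIntegral ν δ)
      have := abs_sub_abs_le_abs_sub p' p
      rw [abs_of_nonneg hI0] at *
      linarith
    · have hc : 600 * m * (|p| + |q| + 6003 * m) ≤ 2290 * m := by
        have : |p| + |q| + 6003 * m ≤ 3.5 := by linarith
        nlinarith
      have := abs_sub_abs_le_abs_sub q' q
      linarith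
    · rw [hcast, h.rayIntegral_add hν hδ.le (by positivity) h1]
      set X := Real.exp (-(2 * ((n + 1 : ℕ) * δ)))
      have hX0 : 0 ≤ X := (Real.exp_pos _).le
      have hXle : X ≤ Real.exp (-(δ + n * δ)) := by
        apply Real.exp_le_exp.2
        rw [hcast]
        have : 0 ≤ δ + n * δ := by positivity
        linarith
      have hK0 : 0 ≤ K := hm0.trans hmK
      -- The coordinates inherited from the mass are at most `4600 K`; with `6003 m` this gives
      -- `10603 K`. The term `X` is the trace left by the initial value `q = 1`, and each of the `n`
      -- segments contributes one such term, which explains the factor `n exp (-nδ)` in the final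
      -- bound.
      have hc : 600 * m * (|p| + |q| + 6003 * m) + 48 * δ * m ≤
          m * (7000000 * K + 48 * δ) + 600 * K * X := by
        have h3 : |p| + |q| + 6003 * m ≤ 10603 * K + X := by linarith
        have h4 : 600 * m * (|p| + |q| + 6003 * m) ≤ 600 * m * (10603 * K + X) :=
          mul_le_mul_of_nonneg_left h3 (by positivity)
        have h5 : m * X ≤ K * X := mul_le_mul_of_nonneg_right hmK hX0
        have h6 : 0 ≤ m * K := mul_nonneg hm0 hK0
        linarith
      have hpp : |p - Real.exp (-δ) * (h.at_pt δ).rayIntegral ν (n * δ)| ≤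
          Real.exp (-δ) * S' * (7000000 * K + 48 * δ) +
            600 * K * n * Real.exp (-(δ + n * δ)) := by
        rw [hp, ← mul_sub, abs_mul, abs_of_pos hed]
        have := mul_le_mul_of_nonneg_left herr hed.le
        have e : Real.exp (-(δ + n * δ)) = Real.exp (-δ) * Real.exp (-(n * δ)) := by
          rw [← Real.exp_add]; congr 1; ring
        rw [e]
        linarith
      have hfin : 600 * K * X ≤ 600 * K * Real.exp (-(δ + n * δ)) :=
        mul_le_mul_of_nonneg_left hXle (by positivity)
      rw [hS]
      push_cast
      calc |p' - (h.rayIntegral ν δ + Real.exp (-δ) * (h.at_pt δ).rayIntegral ν (n * δ))|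
          = |(p' - p - h.rayIntegral ν δ) +
              (p - Real.exp (-δ) * (h.at_pt δ).rayIntegral ν (n * δ))| := by congr 1; ring
        _ ≤ _ := abs_add_le _ _
        _ ≤ _ := by linarith

/-! ### Mass bounds -/

/-- The norm sees only transverse segments. A segment contained in a leaf meets no other leaf, and
that leaf has no weight because the starting point is off the weighted leaves. -/
lemma Frame.measure_le_thurstonNorm {μ : Measure Geodesic} (hμ : IsMeasuredLamination μ)
    (hbdd : thurstonNorm μ < ⊤) {x : Hyp} {N : V} (h : Frame x N) {r s : ℝ} (hrs : r ≤ s)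
    (hs : s ≤ r + 1) (hoff : OffWeightedLeaves μ (h.pt r)) :
    (μ (meeting (seg (h.pt r) (h.pt s)))).toReal ≤ (thurstonNorm μ).toReal := by
  by_cases hc : ∃ l ∈ μ.support, seg (h.pt r) (h.pt s) ⊆ l.points
  · obtain ⟨l, hl, hsub⟩ := hc
    have h0 : μ (meeting (seg (h.pt r) (h.pt s))) = 0 := by
      refine measure_mono_null (t := {l} ∪ μ.supportᶜ) (fun l' hl' => ?_)
        (measure_union_null (hoff l (hsub (left_mem_seg _ _))) Measure.measure_compl_support)
      by_cases hs' : l' ∈ μ.support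
      · left
        by_contra hne
        obtain ⟨z, hz, hzs⟩ := hl'
        exact (hμ.2.2 hs' hl hne).le_bot ⟨hz, hsub hzs⟩
      · exact Or.inr hs'
    rw [h0]; simp
  · push Not at hc
    refine ENNReal.toReal_mono hbdd.ne ?_
    unfold thurstonNorm
    refine le_iSup₂_of_le (h.pt r) (h.pt s) (le_iSup₂_of_le ?_ hc le_rfl)
    rw [h.hdist_pt hrs]; linarith

lemma Frame.sum_mass {μ : Measure Geodesic} (hμ : IsMeasuredLamination μ) {x : Hyp} {N : V}
    (h : Frame x N) {δ : ℝ} (hδ : 0 < δ) (hoff : ∀ j : ℕ, OffWeightedLeaves μ (h.pt (j * δ)))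
    (n : ℕ) : ∑ i ∈ Finset.range n, h.mass μ δ i = (μ (meeting (seg x (h.pt (n * δ))))).toReal := by
  have hx : OffWeightedLeaves μ x := by simpa [h.pt_zero] using hoff 0
  induction n with
  | zero =>
    have h0 : μ (meeting (seg x (h.pt ((0 : ℕ) * δ)))) = 0 := by
      refine measure_mono_null (fun l hl => ?_) (measure_through_eq_zero hμ hx)
      rw [mem_meeting_seg] at hl
      change x ∈ l.points
      rw [Geodesic.mem_points_iff]
      simp only [Nat.cast_zero, zero_mul, h.pt_zero] at hl
      nlinarith
    rw [h0]; simp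
  | succ n ih =>
    have hz : h.pt (n * δ) ∈ seg x (h.pt ((n + 1 : ℕ) * δ)) := by
      have := h.pt_mem_seg (r := 0) (s := n * δ) (t := (n + 1 : ℕ) * δ) (by positivity)
        (by push_cast; nlinarith)
      rwa [h.pt_zero] at this
    rw [Finset.sum_range_succ, ih, measureReal_meeting_add hμ hz (hoff n), mass]

/-- The segments are grouped into blocks of total length between `1/2` and `1`. Each block has mass
at most the Thurston norm, and passing a block contracts by `exp (-1/2) ≤ 2/3`; the geometric series
gives the factor `3`. -/
lemma Frame.wmass_le {μ : Measure Geodesic} (hμ : IsMeasuredLamination μ)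
    (hbdd : thurstonNorm μ < ⊤) {δ : ℝ} (hδ : 0 < δ) (hδ1 : δ ≤ 1 / 2) (n : ℕ) :
    ∀ {x : Hyp} {N : V} (h : Frame x N), (∀ j : ℕ, OffWeightedLeaves μ (h.pt (j * δ))) →
      h.wmass μ δ n ≤ 3 * (thurstonNorm μ).toReal := by
  set k := ⌊1 / δ⌋₊
  have hk1 : k * δ ≤ 1 := by
    have := Nat.floor_le (show 0 ≤ 1 / δ by positivity)
    calc k * δ ≤ 1 / δ * δ := mul_le_mul_of_nonneg_right this hδ.le
      _ = 1 := by field_simp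
  have hk2 : 1 / 2 ≤ k * δ := by
    have := Nat.lt_floor_add_one (1 / δ)
    have h2 : 1 / δ * δ < (k + 1) * δ := mul_lt_mul_of_pos_right this hδ
    rw [div_mul_cancel₀ _ hδ.ne'] at h2
    nlinarith
  have hk0 : 0 < k := by
    rcases Nat.eq_zero_or_pos k with h | h
    · rw [h] at hk2; norm_num at hk2
    · exact h
  set M := (thurstonNorm μ).toReal
  have hM : 0 ≤ M := ENNReal.toReal_nonneg
  have hinit : ∀ {x : Hyp} {N : V} (h : Frame x N), (∀ j : ℕ, OffWeightedLeaves μ (h.pt (j * δ))) →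
      ∀ n ≤ k, h.wmass μ δ n ≤ M := by
    intro x N h hoff n hn
    calc h.wmass μ δ n ≤ ∑ i ∈ Finset.range n, h.mass μ δ i := by
          refine Finset.sum_le_sum fun i _ => mul_le_of_le_one_left (h.mass_nonneg μ δ i) ?_
          exact Real.exp_le_one_iff.2 (by rw [neg_nonpos]; positivity)
      _ = _ := h.sum_mass hμ hδ hoff n
      _ ≤ M := by
        have h0 := hoff 0
        have := h.measure_le_thurstonNorm hμ hbdd (r := (0 : ℕ) * δ) (s := n * δ) (by simp; positivity)
          (by
            have : (n : ℝ) * δ ≤ k * δ := mul_le_mul_of_nonneg_right (by exact_mod_cast hn) hδ.le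
            simp; linarith) h0
        simpa [h.pt_zero] using this
  induction n using Nat.strong_induction_on with
  | _ n ih =>
    intro x N h hoff
    rcases le_or_gt n k with hn | hn
    · linarith [hinit h hoff n hn]
    · obtain ⟨m, rfl⟩ := Nat.exists_eq_add_of_lt hn
      have hoff' : ∀ j : ℕ, OffWeightedLeaves μ ((h.at_pt (k * δ)).pt (j * δ)) := by
        intro j
        rw [h.pt_pt, ← add_mul, ← Nat.cast_add]; exact hoff _
      have hrec := ih (m + 1) (by omega) (h.at_pt (k * δ)) hoff'
      have hsplit : h.wmass μ δ (k + m + 1) =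
          h.wmass μ δ k + Real.exp (-(k * δ)) * (h.at_pt (k * δ)).wmass μ δ (m + 1) := by
        rw [add_assoc, wmass, Finset.sum_range_add]
        congr 1
        rw [wmass, Finset.mul_sum]
        refine Finset.sum_congr rfl fun i _ => ?_
        rw [← mul_assoc, ← Real.exp_add, mass, mass, h.pt_pt, h.pt_pt]
        congr 2
        · push_cast; ring_nf
        · push_cast; ring_nf
      have hexp : Real.exp (-(k * δ)) ≤ 2 / 3 := by
        have h1 : (3 / 2 : ℝ) ≤ Real.exp (k * δ) := by
          have := Real.add_one_le_exp (k * δ); linarith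
        rw [Real.exp_neg]
        calc (Real.exp (k * δ))⁻¹ ≤ (3 / 2 : ℝ)⁻¹ := inv_anti₀ (by norm_num) h1
          _ = 2 / 3 := by norm_num
      rw [hsplit]
      have h1 := hinit h hoff k le_rfl
      have h2 : Real.exp (-(k * δ)) * (h.at_pt (k * δ)).wmass μ δ (m + 1) ≤ 2 / 3 * (3 * M) :=
        mul_le_mul hexp hrec (Finset.sum_nonneg fun i _ =>
          mul_nonneg (Real.exp_pos _).le (Frame.mass_nonneg _ _ _ _)) (by norm_num)
      linarith

/-- Arbitrarily fine equidistant points on a ray that avoid the weighted leaves. -/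
lemma Frame.exists_generic_step {μ : Measure Geodesic} [IsLocallyFiniteMeasure μ] {x : Hyp} {N : V}
    (h : Frame x N) (hx : OffWeightedLeaves μ x) {δ₀ : ℝ} (hδ₀ : 0 < δ₀) :
    ∃ δ, 0 < δ ∧ δ < δ₀ ∧ ∀ j : ℕ, OffWeightedLeaves μ (h.pt (j * δ)) := by
  set B : Set ℝ := ⋃ l ∈ {l : Geodesic | 0 < μ {l}}, {r : ℝ | mink (h.pt r).1 l.nrm = 0}
  have hB : B.Countable := by
    refine (countable_weighted μ).biUnion fun l hl => Set.Subsingleton.countable ?_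
    intro r hr s hs
    have hxl : mink x.1 l.nrm ≠ 0 := fun h0 =>
      (show 0 < μ {l} from hl).ne' (hx l (Geodesic.mem_points_iff.2 h0))
    -- Multiplied by `2 exp r`, the condition is affine in `exp (2r)` and fails at `r = 0`, so the
    -- ray meets the leaf at most once.
    have e : ∀ r : ℝ, mink (h.pt r).1 l.nrm = 0 →
        2 * mink x.1 l.nrm + (Real.exp (2 * r) - 1) * mink N l.nrm = 0 := by
      intro r hr
      rw [h.pt_val, mink_add_left, mink_smul_left, mink_smul_left, Real.sinh_eq] at hr
      have e1 : Real.exp r * Real.exp (-r) = 1 := by rw [← Real.exp_add]; simp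
      have e2 : Real.exp (2 * r) = Real.exp r * Real.exp r := by rw [← Real.exp_add]; ring_nf
      rw [e2]
      linear_combination 2 * Real.exp r * hr - (2 * mink x.1 l.nrm - mink N l.nrm) * e1
    have hr' := e r hr
    have hs' := e s hs
    have h1 : (Real.exp (2 * r) - Real.exp (2 * s)) * mink N l.nrm = 0 := by linarith
    rcases mul_eq_zero.1 h1 with h2 | h2
    · have := Real.exp_injective (sub_eq_zero.1 h2); linarith
    · rw [h2] at hr'; exact absurd (by linarith) hxl
  have hbad : (⋃ j : ℕ, (fun δ : ℝ => ((j + 1 : ℕ) : ℝ) * δ) ⁻¹' B).Countable := by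
    refine countable_iUnion fun j => hB.preimage ?_
    exact mul_right_injective₀ (by positivity)
  have hunc : ¬ (Ioo 0 δ₀).Countable := by
    rw [Cardinal.Real.Ioo_countable_iff]; linarith
  obtain ⟨δ, hδ, hδ'⟩ : ∃ δ ∈ Ioo 0 δ₀, δ ∉ ⋃ j : ℕ, (fun δ : ℝ => ((j + 1 : ℕ) : ℝ) * δ) ⁻¹' B := by
    by_contra! hc
    exact hunc (hbad.mono hc)
  refine ⟨δ, hδ.1, hδ.2, fun j => ?_⟩
  rcases j with _ | j
  · simpa [h.pt_zero] using hx
  · intro l hl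
    by_contra hne
    apply hδ'
    refine mem_iUnion.2 ⟨j, ?_⟩
    exact mem_biUnion (show l ∈ {l : Geodesic | 0 < μ {l}} from pos_iff_ne_zero.2 hne)
      (Geodesic.mem_points_iff.1 hl)

/-- The integral over a whole ray converges. -/
lemma Frame.exists_tendsto_rayIntegral {μ : Measure Geodesic} (hμ : IsMeasuredLamination μ)
    (hbdd : thurstonNorm μ < ⊤) {x : Hyp} {N : V} (h : Frame x N) (hx : OffWeightedLeaves μ x) :
    ∃ Ψ, Tendsto (h.rayIntegral μ) atTop (𝓝 Ψ) := by
  have := hμ.1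
  have hmono : ∀ r s, 0 ≤ r → r ≤ s → h.rayIntegral μ r ≤ h.rayIntegral μ s := by
    intro r s hr hrs
    refine setIntegral_mono_set (integrableOn_abs_mink μ N _ _) (.of_forall fun _ => abs_nonneg _)
      (LE.le.eventuallyLE (meeting_mono (seg_subset_seg (left_mem_seg _ _) ?_)))
    have := h.pt_mem_seg hr hrs
    rwa [h.pt_zero] at this
  obtain ⟨δ, hδ, hδ1, hoff⟩ := h.exists_generic_step hx (show (0 : ℝ) < 1 / 2 by norm_num)
  have hmono' : Monotone fun r : ℝ => h.rayIntegral μ (max r 0) := fun r s hrs =>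
    hmono _ _ (le_max_right _ _) (max_le_max_right 0 hrs)
  have hbd : BddAbove (range fun r : ℝ => h.rayIntegral μ (max r 0)) := by
    refine ⟨3 * (thurstonNorm μ).toReal, ?_⟩
    rintro _ ⟨r, rfl⟩
    obtain ⟨n, hn⟩ := exists_nat_ge (max r 0 / δ)
    rw [div_le_iff₀ hδ] at hn
    exact (hmono _ _ (le_max_right _ _) hn).trans
      ((Frame.rayIntegral_le_wmass hμ hδ (by linarith) n h hoff).trans
        (Frame.wmass_le hμ hbdd hδ hδ1.le n h hoff))
  refine ⟨_, (tendsto_atTop_ciSup hmono' hbd).congr' ?_⟩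
  filter_upwards [eventually_ge_atTop 0] with r hr
  rw [max_eq_left hr]

/-! ### Scaling a measured lamination -/

lemma support_smul_measure (μ : Measure Geodesic) {c : ℝ≥0} (hc : c ≠ 0) :
    (c • μ).support = μ.support := by
  ext l
  simp only [Measure.mem_support_iff_forall]
  refine forall₂_congr fun U _ => ?_
  simp [pos_iff_ne_zero, hc]

lemma IsMeasuredLamination.smul {μ : Measure Geodesic} (hμ : IsMeasuredLamination μ) {c : ℝ≥0}
    (hc : c ≠ 0) : IsMeasuredLamination (c • μ) := by
  have := hμ.1
  refine ⟨inferInstance, ?_⟩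
  rw [support_smul_measure μ hc]
  exact hμ.2

lemma OffWeightedLeaves.smul {μ : Measure Geodesic} {x : Hyp} (hx : OffWeightedLeaves μ x)
    (c : ℝ≥0) : OffWeightedLeaves (c • μ) x := by
  intro l hl
  simp [hx l hl]

lemma Frame.wmass_smul (μ : Measure Geodesic) (c : ℝ≥0) {x : Hyp} {N : V} (h : Frame x N) (δ : ℝ)
    (n : ℕ) : h.wmass (c • μ) δ n = c * h.wmass μ δ n := by
  rw [wmass, wmass, Finset.mul_sum]
  refine Finset.sum_congr rfl fun i _ => ?_
  rw [mass, mass]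
  simp only [Measure.smul_apply, ENNReal.smul_def, smul_eq_mul, ENNReal.toReal_mul,
    ENNReal.coe_toReal]
  ring

lemma Frame.rayIntegral_smul (μ : Measure Geodesic) (c : ℝ≥0) {x : Hyp} {N : V} (h : Frame x N)
    (r : ℝ) : h.rayIntegral (c • μ) r = c * h.rayIntegral μ r := by
  rw [rayIntegral, rayIntegral, Measure.restrict_smul, integral_smul_nnreal_measure]
  rfl

/-! ### Boundary values -/

lemma frame_ofNull (x : Hyp) (η : Circle) :
    Frame x ((-mink x.1 (null η))⁻¹ • null η) where
  null := by rw [mink_smul_left, mink_smul_right, mink_null_self]; simp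
  norm := by
    have := (x.mink_null_neg η).ne
    rw [mink_smul_right]
    field_simp

lemma tendsto_klein_pt {x : Hyp} {N : V} (h : Frame x N) {η : Circle} {c : ℝ} (hc : 0 < c)
    (hN : N = c • null η) : Tendsto (fun r => klein (h.pt r)) atTop (𝓝 (η : ℂ)) := by
  have hN2 : N 2 = c := by rw [hN]; simp [null]
  have key : ∀ r, klein (h.pt r) = (((N + Real.exp (-(2 * r)) • opp x N) 2)⁻¹ : ℝ) •
      horiz (N + Real.exp (-(2 * r)) • opp x N) := by
    intro r
    have e : (h.pt r).1 = (Real.exp r / 2) • (N + Real.exp (-(2 * r)) • opp x N) := by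
      rw [h.pt_val_half, smul_add, smul_smul]
      congr 2
      rw [div_mul_eq_mul_div, ← Real.exp_add]; congr 2; ring
    have hpos : Real.exp r / 2 ≠ 0 := by positivity
    have hh : ∀ (k : ℝ) (w : V), horiz (k • w) = k • horiz w := by
      intro k w; apply Complex.ext <;> simp [horiz]
    rw [klein, e, hh, smul_smul]
    congr 1
    rw [Pi.smul_apply, smul_eq_mul]
    field_simp
  have hlim : Tendsto (fun r : ℝ => N + Real.exp (-(2 * r)) • opp x N) atTop (𝓝 N) := by
    have h1 : Tendsto (fun r : ℝ => Real.exp (-(2 * r))) atTop (𝓝 0) :=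
      Real.tendsto_exp_neg_atTop_nhds_zero.comp
        (tendsto_id.const_mul_atTop (show (0 : ℝ) < 2 by norm_num))
    simpa using tendsto_const_nhds.add (h1.smul_const (opp x N))
  have hhor : Continuous horiz := by
    have : horiz = fun p : V => (p 0 : ℂ) + (p 1 : ℂ) * Complex.I := by
      funext p; apply Complex.ext <;> simp [horiz]
    rw [this]; fun_prop
  have hfin : (η : ℂ) = ((N 2)⁻¹ : ℝ) • horiz N := by
    rw [hN2, hN]
    apply Complex.ext <;> simp [horiz, null] <;> field_simp
  rw [hfin]
  refine Tendsto.congr (fun r => (key r).symm) ?_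
  refine Tendsto.smul (Tendsto.inv₀ ?_ ?_) ((hhor.tendsto N).comp hlim)
  · exact ((continuous_apply (2 : Fin 3)).tendsto N).comp hlim
  · rw [hN2]; exact hc.ne'

lemma tendsto_of_klein {ι : Type*} {F : Filter ι} {X : ι → Hyp} {η : Circle}
    (h : Tendsto (fun i => klein (X i)) F (𝓝 (η : ℂ))) :
    Tendsto (fun i => ((X i).1 2)⁻¹ • (X i).1) F (𝓝 (null η)) := by
  have hre := (Complex.continuous_re.tendsto _).comp h
  have him := (Complex.continuous_im.tendsto _).comp h
  rw [tendsto_pi_nhds]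
  intro j
  fin_cases j
  · simpa [klein, horiz, null, Function.comp_def] using hre
  · simpa [klein, horiz, null, Function.comp_def] using him
  · refine Tendsto.congr (f₁ := fun _ => (1 : ℝ)) (fun i => ?_) (by simpa [null] using tendsto_const_nhds)
    simp [((X i).two_pos).ne']

lemma Frame.mink_fvec_self {x : Hyp} {N : V} (h : Frame x N) (p q : ℝ) :
    mink (fvec x N p q) (fvec x N p q) = p ^ 2 - 4 * q := by
  conv_lhs => arg 2; rw [fvec]
  simp only [mink_add_right, mink_smul_right, h.mink_fvec_null, h.mink_fvec_opp, h.mink_fvec_perp]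
  ring

/-- The boundary values of an earthquake, seen from a point off the weighted leaves. -/
lemma boundary_estimate {μ : Measure Geodesic} (hμ : IsMeasuredLamination μ)
    (hbdd : thurstonNorm μ < ⊤) {x : Hyp} (hx : OffWeightedLeaves μ x) {η : Circle} {N : V}
    (h : Frame x N) {c : ℝ} (hc : 0 < c) (hN : N = c • null η) {Ψ : ℝ}
    (hΨ : Tendsto (h.rayIntegral μ) atTop (𝓝 Ψ)) {t : ℝ} (ht : 0 < t)
    (htM : 30000 * (t * (thurstonNorm μ).toReal) ≤ 1) {E : Hyp → Hyp} {A : Set Hyp → V ≃ₗ[ℝ] V}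
    (hE : IsLeftEarthquake (t.toNNReal • μ).support E A)
    (hG : ∀ x y : Hyp, OffWeightedLeaves (t.toNNReal • μ) x → OffWeightedLeaves (t.toNNReal • μ) y →
      IsGLB (partitionSums (t.toNNReal • μ).support A x y)
        ((t.toNNReal • μ) (meeting (seg x y))).toReal)
    {f : Circle → Circle} (hf : IsBoundaryExtension E f) :
    ∃ α p : ℝ, 0 < α ∧ (A (stratum μ.support x)).symm (null (f η)) = α • fvec x N p (p ^ 2 / 4) ∧
      |p - t * Ψ| ≤ 7000000 * (3 * (t * (thurstonNorm μ).toReal)) ^ 2 := by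
  have := hμ.1
  have hc0 : t.toNNReal ≠ 0 := by simpa using ht
  have hct : ((t.toNNReal : ℝ≥0) : ℝ) = t := Real.coe_toNNReal t ht.le
  have hν := hμ.smul hc0
  rw [support_smul_measure μ hc0] at hE hG
  have hE' : IsLeftEarthquake (t.toNNReal • μ).support E A := by
    rwa [support_smul_measure μ hc0]
  have hG' : ∀ x y : Hyp, OffWeightedLeaves (t.toNNReal • μ) x →
      OffWeightedLeaves (t.toNNReal • μ) y →
      IsGLB (partitionSums (t.toNNReal • μ).support A x y)
        ((t.toNNReal • μ) (meeting (seg x y))).toReal := by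
    rwa [support_smul_measure μ hc0]
  set K := 3 * (t * (thurstonNorm μ).toReal) with hK
  have hK0 : 0 ≤ K := by positivity
  set A₀ := A (stratum μ.support x) with hA₀
  set W := A₀.symm (null (f η)) with hW
  have hiso : ∀ v w, mink (A₀ v) (A₀ w) = mink v w := (hE.2.1 _ ⟨x, rfl⟩).1.1
  have hWW : mink W W = 0 := by
    rw [← hiso, hW, LinearEquiv.apply_symm_apply, mink_null_self]
  have hWne : W ≠ 0 := by
    intro h0
    have h1 : null (f η) = 0 := by
      rw [← A₀.apply_symm_apply (null (f η)), ← hW, h0, map_zero]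
    have := null_two (f η)
    rw [h1] at this; simp at this
  have hAc : Continuous A₀.symm := LinearMap.continuous_of_finiteDimensional (A₀.symm : V →ₗ[ℝ] V)
  -- The coordinates of `W` are the limits of `β n`, `β n * p n` and `β n * q n`. At this stage `β
  -- n` might tend to `0`, so all bounds are kept multiplied by the leading coordinate; its
  -- positivity follows from them afterwards, since otherwise `W = 0`.
  have key : ∀ δ₀ : ℝ, 0 < δ₀ → 0 ≤ -mink W (opp x N) / 2 ∧
      |mink W (perp x N)| ≤ -mink W (opp x N) / 2 ∧
      |-mink W N / 2| ≤ 2 * (-mink W (opp x N) / 2) ∧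
      |mink W (perp x N) - -mink W (opp x N) / 2 * (t * Ψ)| ≤
        -mink W (opp x N) / 2 * (K * (7000000 * K + 48 * δ₀)) := by
    intro δ₀ hδ₀
    obtain ⟨δ, hδ, hδlt, hoff⟩ := h.exists_generic_step hx (show 0 < min δ₀ (1 / 2) by positivity)
    have hδ2 : δ ≤ 1 / 2 := (hδlt.trans_le (min_le_right _ _)).le
    have hδd : δ ≤ δ₀ := (hδlt.trans_le (min_le_left _ _)).le
    have hwm : ∀ j k : ℕ, (h.at_pt (j * δ)).wmass (t.toNNReal • μ) δ k ≤ K := by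
      intro j k
      rw [Frame.wmass_smul, hct, hK, mul_left_comm]
      refine mul_le_mul_of_nonneg_left (Frame.wmass_le hμ hbdd hδ hδ2 k (h.at_pt (j * δ)) ?_) ht.le
      intro i
      rw [h.pt_pt, ← add_mul, ← Nat.cast_add]; exact hoff _
    have hwm0 : ∀ k : ℕ, h.wmass (t.toNNReal • μ) δ k ≤ K := by
      intro k
      rw [Frame.wmass_smul, hct, hK, mul_left_comm]
      exact mul_le_mul_of_nonneg_left (Frame.wmass_le hμ hbdd hδ hδ2 k h hoff) ht.le
    have hest := fun n : ℕ => Frame.ray_estimate hν hE' hG' hδ (by linarith) (K := K)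
      (by rw [hK]; linarith) n h (fun j => (hoff j).smul _) hwm
    choose α p q hα hcmp hp hq herr using hest
    rw [support_smul_measure μ hc0] at hcmp
    set X : ℕ → Hyp := fun n => h.pt (n * δ) with hX
    have hXinf : Tendsto (fun n : ℕ => (n : ℝ) * δ) atTop atTop :=
      tendsto_natCast_atTop_atTop.atTop_mul_const hδ
    have hkl : Tendsto (fun n => klein (X n)) atTop (𝓝 (η : ℂ)) :=
      (tendsto_klein_pt h hc hN).comp hXinf
    have hEX : Tendsto (fun n => klein (E (X n))) atTop (𝓝 (f η : ℂ)) :=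
      (hf η).comp (tendsto_comap_iff.2 hkl)
    have hnull := tendsto_of_klein hEX
    have hWlim : Tendsto (fun n => A₀.symm (((E (X n)).1 2)⁻¹ • (E (X n)).1)) atTop (𝓝 W) :=
      (hAc.tendsto _).comp hnull
    set β : ℕ → ℝ := fun n => ((E (X n)).1 2)⁻¹ * α n with hβ
    have hβpos : ∀ n, 0 < β n := fun n => mul_pos (inv_pos.2 (E (X n)).two_pos) (hα n)
    have heq : ∀ n, A₀.symm (((E (X n)).1 2)⁻¹ • (E (X n)).1) = β n • fvec x N (p n) (q n) := by
      intro n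
      have h1 : (E (X n)).1 = A (stratum μ.support (X n)) (X n).1 :=
        (hE.2.1 _ ⟨X n, rfl⟩).2 _ (mem_stratum _ _)
      have h2 : A₀.symm (E (X n)).1 = α n • fvec x N (p n) (q n) := by rw [h1]; exact hcmp n
      rw [map_smul, h2, smul_smul]
    simp only [heq] at hWlim
    have hlin : ∀ v : V, Tendsto (fun n => mink (β n • fvec x N (p n) (q n)) v) atTop
        (𝓝 (mink W v)) := fun v =>
      ((Continuous.mink continuous_id continuous_const).tendsto W).comp hWlim
    have l1 : Tendsto β atTop (𝓝 (-mink W (opp x N) / 2)) := by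
      refine Tendsto.congr (fun n => ?_) ((hlin (opp x N)).neg.div_const 2)
      rw [mink_smul_left, h.mink_fvec_opp]; ring
    have l2 : Tendsto (fun n => β n * p n) atTop (𝓝 (mink W (perp x N))) := by
      refine Tendsto.congr (fun n => ?_) (hlin (perp x N))
      rw [mink_smul_left, h.mink_fvec_perp]
    have l3 : Tendsto (fun n => β n * q n) atTop (𝓝 (-mink W N / 2)) := by
      refine Tendsto.congr (fun n => ?_) ((hlin N).neg.div_const 2)
      rw [mink_smul_left, h.mink_fvec_null]; ring
    have l4 : Tendsto (fun n : ℕ => h.rayIntegral (t.toNNReal • μ) (n * δ)) atTop (𝓝 (t * Ψ)) := by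
      simp only [Frame.rayIntegral_smul, hct]
      exact (hΨ.comp hXinf).const_mul t
    have l5 : Tendsto (fun n : ℕ => K * (7000000 * K + 48 * δ) +
        600 * K * n * Real.exp (-(n * δ))) atTop (𝓝 (K * (7000000 * K + 48 * δ))) := by
      have h1 : Tendsto (fun n : ℕ => (n : ℝ) * δ * Real.exp (-((n : ℝ) * δ))) atTop (𝓝 0) := by
        have := (Real.tendsto_pow_mul_exp_neg_atTop_nhds_zero 1).comp hXinf
        simpa [Function.comp_def] using this
      have h2 := (h1.const_mul (600 * K / δ)).const_add (K * (7000000 * K + 48 * δ))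
      rw [mul_zero, add_zero] at h2
      refine Tendsto.congr (fun n => ?_) h2
      field_simp
    have hp1 : ∀ n, |p n| ≤ 1 := fun n => (hp n).trans (by linarith [hwm0 n])
    have hq2 : ∀ n, |q n| ≤ 2 := fun n => (hq n).trans (by
      have : Real.exp (-(2 * (n * δ))) ≤ 1 := Real.exp_le_one_iff.2 (by
        rw [neg_nonpos]; positivity)
      linarith [hwm0 n])
    refine ⟨ge_of_tendsto' l1 fun n => (hβpos n).le, le_of_tendsto_of_tendsto' l2.abs l1 fun n => ?_,
      le_of_tendsto_of_tendsto' l3.abs (l1.const_mul 2) fun n => ?_, ?_⟩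
    · rw [abs_mul, abs_of_pos (hβpos n)]
      exact mul_le_of_le_one_right (hβpos n).le (hp1 n)
    · rw [abs_mul, abs_of_pos (hβpos n), mul_comm 2]
      exact mul_le_mul_of_nonneg_left (hq2 n) (hβpos n).le
    · have hle : ∀ n : ℕ, |β n * p n - β n * h.rayIntegral (t.toNNReal • μ) (n * δ)| ≤
          β n * (K * (7000000 * K + 48 * δ) + 600 * K * n * Real.exp (-(n * δ))) := by
        intro n
        rw [← mul_sub, abs_mul, abs_of_pos (hβpos n)]
        refine mul_le_mul_of_nonneg_left ((herr n).trans ?_) (hβpos n).le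
        have := mul_le_mul_of_nonneg_right (hwm0 n)
          (show 0 ≤ 7000000 * K + 48 * δ by positivity)
        linarith
      have h1 := le_of_tendsto_of_tendsto' (l2.sub (l1.mul l4)).abs (l1.mul l5) hle
      refine h1.trans (mul_le_mul_of_nonneg_left ?_ (ge_of_tendsto' l1 fun n => (hβpos n).le))
      exact mul_le_mul_of_nonneg_left (by linarith) hK0
  obtain ⟨h0, h1, h2, -⟩ := key 1 one_pos
  set α := -mink W (opp x N) / 2 with hα
  have hdec := h.decomp W
  rw [← hα] at hdec
  have hαpos : 0 < α := by
    rcases h0.eq_or_lt with e | e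
    · exfalso; apply hWne
      rw [← e] at h1 h2 hdec
      have e1 : mink W (perp x N) = 0 := by simpa using h1
      have e2 : -mink W N / 2 = 0 := by simpa using h2
      rw [e1, e2] at hdec
      rw [hdec]; simp
    · exact e
  set p := mink W (perp x N) / α with hp
  set q := (-mink W N / 2) / α with hq
  have hWf : W = α • fvec x N p q := by
    rw [fvec, smul_add, smul_add, smul_smul, smul_smul, hp, hq, mul_div_cancel₀ _ hαpos.ne',
      mul_div_cancel₀ _ hαpos.ne']
    exact hdec
  have hpq : q = p ^ 2 / 4 := by
    rw [hWf, mink_smul_left, mink_smul_right, h.mink_fvec_self] at hWW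
    have : p ^ 2 - 4 * q = 0 := by
      rcases mul_eq_zero.1 hWW with h | h
      · exact absurd h hαpos.ne'
      · exact (mul_eq_zero.1 h).resolve_left hαpos.ne'
    linarith
  refine ⟨α, p, hαpos, by rw [hWf, hpq], ?_⟩
  -- The step length `δ` entered only through the approximating points; `p` belongs to the boundary
  -- value, so `δ₀` can tend to `0` and only the quadratic error survives.
  have hall : ∀ δ₀ : ℝ, 0 < δ₀ → |p - t * Ψ| ≤ K * (7000000 * K + 48 * δ₀) := by
    intro δ₀ hδ₀
    have h3 := (key δ₀ hδ₀).2.2.2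
    have e : mink W (perp x N) - α * (t * Ψ) = α * (p - t * Ψ) := by
      rw [hp]; field_simp
    rw [e, abs_mul, abs_of_pos hαpos] at h3
    exact le_of_mul_le_mul_left h3 hαpos
  have hlim : Tendsto (fun δ₀ : ℝ => K * (7000000 * K + 48 * δ₀)) (𝓝[>] 0)
      (𝓝 (K * (7000000 * K + 48 * 0))) :=
    (Continuous.tendsto (by fun_prop) 0).mono_left nhdsWithin_le_nhds
  have := ge_of_tendsto hlim (by
    filter_upwards [self_mem_nhdsWithin] with δ₀ hδ₀ using hall δ₀ hδ₀)
  calc |p - t * Ψ| ≤ K * (7000000 * K + 48 * 0) := this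
    _ = 7000000 * K ^ 2 := by ring

/-! ### Differentiating the normalizing isometries -/

/-- The unit tangent vector of the circle at infinity. -/
def tang (η : Circle) : V := ![-(η : ℂ).im, (η : ℂ).re, 0]

lemma mink_tang_self (η : Circle) : mink (tang η) (tang η) = 1 := by
  have h := Circle.normSq_coe η
  rw [Complex.normSq_apply] at h
  simp [mink, tang]; linarith

lemma mink_null_tang (η : Circle) : mink (null η) (tang η) = 0 := by
  simp [mink, tang, null]; ring

lemma mcross_null_tang (η : Circle) : mcross (null η) (tang η) = -null η := by
  have h := Circle.normSq_coe η
  rw [Complex.normSq_apply] at h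
  ext i; fin_cases i <;> simp [mcross, tang, null]
  linarith

lemma _root_.HasDerivWithinAt.mink {f g : ℝ → V} {f' g' : V} {s : Set ℝ} {t : ℝ}
    (hf : HasDerivWithinAt f f' s t) (hg : HasDerivWithinAt g g' s t) :
    HasDerivWithinAt (fun t => Mink.mink (f t) (g t)) (Mink.mink f' (g t) + Mink.mink (f t) g') s t := by
  rw [hasDerivWithinAt_pi] at hf hg
  have := (((hf 0).mul (hg 0)).add ((hf 1).mul (hg 1))).sub ((hf 2).mul (hg 2))
  refine (this.congr_deriv ?_).congr_of_eventuallyEq (.of_forall fun t => ?_) ?_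
  · simp only [Mink.mink]; ring
  · simp [Mink.mink]
  · simp [Mink.mink]

lemma _root_.DifferentiableWithinAt.mink {f g : ℝ → V} {s : Set ℝ} {t : ℝ}
    (hf : DifferentiableWithinAt ℝ f s t) (hg : DifferentiableWithinAt ℝ g s t) :
    DifferentiableWithinAt ℝ (fun t => Mink.mink (f t) (g t)) s t :=
  (hf.hasDerivWithinAt.mink hg.hasDerivWithinAt).differentiableWithinAt

lemma _root_.DifferentiableWithinAt.mcross {f g : ℝ → V} {s : Set ℝ} {t : ℝ}
    (hf : DifferentiableWithinAt ℝ f s t) (hg : DifferentiableWithinAt ℝ g s t) :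
    DifferentiableWithinAt ℝ (fun t => Mink.mcross (f t) (g t)) s t := by
  rw [differentiableWithinAt_pi] at hf hg ⊢
  intro i
  fin_cases i
  · exact ((hf 1).mul (hg 2)).sub ((hf 2).mul (hg 1))
  · exact ((hf 2).mul (hg 0)).sub ((hf 0).mul (hg 2))
  · exact (((hf 0).mul (hg 1)).sub ((hf 1).mul (hg 0))).neg

lemma exists_three_null : ∃ a b c : Circle, a ≠ b ∧ a ≠ c ∧ b ≠ c ∧
    mink (mcross (null a) (null b)) (null c) ≠ 0 := by
  have hdet : mink (mcross (null 1) (null (Circle.exp (Real.pi / 2)))) (null (Circle.exp Real.pi))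
      ≠ 0 := by
    simp [null, mink, mcross, Circle.coe_exp]
  refine ⟨1, Circle.exp (Real.pi / 2), Circle.exp Real.pi, ?_, ?_, ?_, hdet⟩
  · intro h; rw [← h, mcross_self, mink_zero_left] at hdet; exact hdet rfl
  · intro h; rw [← h, mink_mcross_left_self] at hdet; exact hdet rfl
  · intro h; rw [← h, mink_mcross_right_self] at hdet; exact hdet rfl

/-- A family of isometries is differentiable if it is so on three null directions. -/
lemma differentiable_of_three_null {B : ℝ → V ≃ₗ[ℝ] V} {t₀ : ℝ} (ht₀ : 0 < t₀)
    (hB : ∀ t, 0 < t → t ≤ t₀ → ∀ v w, mink (B t v) (B t w) = mink v w)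
    {g ν : Circle → ℝ → V} {α : Circle → ℝ → ℝ} {c : Circle → ℝ} (hc : ∀ η, 0 < c η)
    (hα : ∀ η t, 0 < t → t ≤ t₀ → 0 < α η t)
    (hg : ∀ η, DifferentiableWithinAt ℝ (g η) (Ici 0) 0)
    (hν : ∀ η, DifferentiableWithinAt ℝ (ν η) (Ici 0) 0) (hg0 : ∀ η, g η 0 = null η)
    (hν0 : ∀ η, ν η 0 = c η • null η)
    (heq : ∀ η t, 0 < t → t ≤ t₀ → g η t = α η t • B t (ν η t)) :
    ∃ (Φ : V → ℝ → V) (D : V → V), ∀ v, HasDerivWithinAt (Φ v) (D v) (Ici 0) 0 ∧ Φ v 0 = v ∧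
      ∀ᶠ t in 𝓝[>] 0, Φ v t = B t v := by
  obtain ⟨a, b, d, hab, had, hbd, hdet⟩ := exists_three_null
  have hG0 : ∀ {i j : Circle}, i ≠ j → mink (g i 0) (g j 0) ≠ 0 := fun h => by
    rw [hg0, hg0]; exact (mink_null_null_neg h).ne
  have hH0 : ∀ {i j : Circle}, i ≠ j → mink (ν i 0) (ν j 0) ≠ 0 := fun {i j} h => by
    rw [hν0, hν0, mink_smul_left, mink_smul_right]
    exact mul_ne_zero (hc i).ne' (mul_ne_zero (hc j).ne' (mink_null_null_neg h).ne)
  -- the square of the scale of the first of three null directions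
  let R : Circle → Circle → Circle → ℝ → ℝ := fun i j k t =>
    (mink (g i t) (g j t) * mink (g i t) (g k t) / mink (g j t) (g k t)) *
      (mink (ν j t) (ν k t) / (mink (ν i t) (ν j t) * mink (ν i t) (ν k t)))
  have hR0 : ∀ {i j k : Circle}, i ≠ j → i ≠ k → j ≠ k → R i j k 0 = ((c i)⁻¹) ^ 2 := by
    intro i j k hij hik hjk
    have h1 := (mink_null_null_neg hij).ne
    have h2 := (mink_null_null_neg hik).ne
    have h3 := (mink_null_null_neg hjk).ne
    have := (hc i).ne'
    have := (hc j).ne'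
    have := (hc k).ne'
    simp only [R, hg0, hν0, mink_smul_left, mink_smul_right]
    field_simp
  have hRd : ∀ {i j k : Circle}, i ≠ j → i ≠ k → j ≠ k →
      DifferentiableWithinAt ℝ (fun t => √(R i j k t)) (Ici 0) 0 := by
    intro i j k hij hik hjk
    refine DifferentiableWithinAt.sqrt ?_ ?_
    · refine ((((hg i).mink (hg j)).mul ((hg i).mink (hg k))).div ((hg j).mink (hg k)) (hG0 hjk)).mul
        (((hν j).mink (hν k)).div (((hν i).mink (hν j)).mul ((hν i).mink (hν k))) ?_)
      exact mul_ne_zero (hH0 hij) (hH0 hik)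
    · rw [hR0 hij hik hjk]; exact pow_ne_zero _ (inv_ne_zero (hc i).ne')
  have hev0 : ∀ {F : ℝ → ℝ}, DifferentiableWithinAt ℝ F (Ici 0) 0 → F 0 ≠ 0 →
      ∀ᶠ t in 𝓝[>] 0, F t ≠ 0 := by
    intro F hF h0
    exact (hF.continuousWithinAt.mono Ioi_subset_Ici_self).eventually (isOpen_ne.mem_nhds h0)
  have hsmall : ∀ᶠ t in 𝓝[>] (0 : ℝ), 0 < t ∧ t ≤ t₀ := by
    filter_upwards [Ioc_mem_nhdsGT ht₀] with t ht using ht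
  -- By invariance `⟨g i, g j⟩ = α i * α j * ⟨ν i, ν j⟩`. In `R i j k` the scales of `j` and `k`
  -- cancel, so the unknown scale `α i` is a differentiable function of the data.
  have hRα : ∀ {i j k : Circle}, i ≠ j → i ≠ k → j ≠ k →
      ∀ᶠ t in 𝓝[>] 0, √(R i j k t) = α i t := by
    intro i j k hij hik hjk
    filter_upwards [hsmall, hev0 ((hν i).mink (hν j)) (hH0 hij), hev0 ((hν i).mink (hν k)) (hH0 hik),
      hev0 ((hν j).mink (hν k)) (hH0 hjk)] with t ht h1 h2 h3
    have hai := hα i t ht.1 ht.2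
    have haj := (hα j t ht.1 ht.2).ne'
    have hak := (hα k t ht.1 ht.2).ne'
    have : R i j k t = α i t ^ 2 := by
      simp only [R, heq _ t ht.1 ht.2, mink_smul_left, mink_smul_right, hB t ht.1 ht.2]
      field_simp
    rw [this, Real.sqrt_sq hai.le]
  let β : Circle → Circle → Circle → ℝ → V := fun i j k t => √(R i j k t) • ν i t
  have hβd : ∀ {i j k : Circle}, i ≠ j → i ≠ k → j ≠ k →
      DifferentiableWithinAt ℝ (β i j k) (Ici 0) 0 := fun hij hik hjk =>
    (hRd hij hik hjk).smul (hν _)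
  have hβ0 : ∀ {i j k : Circle}, i ≠ j → i ≠ k → j ≠ k → β i j k 0 = null i := by
    intro i j k hij hik hjk
    simp only [β, hR0 hij hik hjk, Real.sqrt_sq (inv_pos.2 (hc i)).le, hν0, smul_smul,
      inv_mul_cancel₀ (hc i).ne', one_smul]
  set b₁ := β a b d
  set b₂ := β b a d
  set b₃ := β d a b
  have d₁ : DifferentiableWithinAt ℝ b₁ (Ici 0) 0 := hβd hab had hbd
  have d₂ : DifferentiableWithinAt ℝ b₂ (Ici 0) 0 := hβd hab.symm hbd had
  have d₃ : DifferentiableWithinAt ℝ b₃ (Ici 0) 0 := hβd had.symm hbd.symm hab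
  have z₁ : b₁ 0 = null a := hβ0 hab had hbd
  have z₂ : b₂ 0 = null b := hβ0 hab.symm hbd had
  have z₃ : b₃ 0 = null d := hβ0 had.symm hbd.symm hab
  let det : ℝ → ℝ := fun t => mink (mcross (b₁ t) (b₂ t)) (b₃ t)
  have hdet0 : det 0 ≠ 0 := by simp only [det, z₁, z₂, z₃]; exact hdet
  have hdetd : DifferentiableWithinAt ℝ det (Ici 0) 0 := (d₁.mcross d₂).mink d₃
  -- Once rescaled, `b₁`, `b₂`, `b₃` are a basis that `B t` sends to `g a`, `g b`, `g d`. Expanding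
  -- `v` by Cramer's rule expresses `B t v` through differentiable functions, and the same formula
  -- makes sense at `t = 0`, where it gives `v`.
  let Φ : V → ℝ → V := fun v t => (det t)⁻¹ • (mink v (mcross (b₂ t) (b₃ t)) • g a t +
    mink v (mcross (b₃ t) (b₁ t)) • g b t + mink v (mcross (b₁ t) (b₂ t)) • g d t)
  have hconst : ∀ v : V, DifferentiableWithinAt ℝ (fun _ : ℝ => v) (Ici 0) 0 :=
    fun v => differentiableWithinAt_const v
  have hΦd : ∀ v, DifferentiableWithinAt ℝ (Φ v) (Ici 0) 0 := fun v =>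
    (hdetd.inv hdet0).smul ((((((hconst v).mink (d₂.mcross d₃)).smul (hg a)).add
      (((hconst v).mink (d₃.mcross d₁)).smul (hg b))).add
      (((hconst v).mink (d₁.mcross d₂)).smul (hg d))))
  refine ⟨Φ, fun v => derivWithin (Φ v) (Ici 0) 0, fun v => ⟨(hΦd v).hasDerivWithinAt, ?_, ?_⟩⟩
  · have := cramer (b₁ 0) (b₂ 0) (b₃ 0) v
    simp only [Φ, hg0]
    rw [← z₁, ← z₂, ← z₃, ← this, smul_smul, inv_mul_cancel₀ hdet0, one_smul]
  · filter_upwards [hsmall, hev0 hdetd hdet0, hRα hab had hbd, hRα hab.symm hbd had,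
      hRα had.symm hbd.symm hab] with t ht hdt e₁ e₂ e₃
    have f₁ : g a t = B t (b₁ t) := by
      rw [heq a t ht.1 ht.2, ← map_smul]; simp only [b₁, β, e₁]
    have f₂ : g b t = B t (b₂ t) := by
      rw [heq b t ht.1 ht.2, ← map_smul]; simp only [b₂, β, e₂]
    have f₃ : g d t = B t (b₃ t) := by
      rw [heq d t ht.1 ht.2, ← map_smul]; simp only [b₃, β, e₃]
    simp only [Φ]
    rw [f₁, f₂, f₃, ← map_smul, ← map_smul, ← map_smul, ← map_add, ← map_add, ← cramer, map_smul,
      smul_smul, inv_mul_cancel₀ hdt, one_smul]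

/-- The derivative of boundary maps that factor through differentiable maps fixing a stratum. -/
lemma exists_vector_of_factorization {B : ℝ → V ≃ₗ[ℝ] V} {t₀ : ℝ} (ht₀ : 0 < t₀)
    (hB : ∀ t, 0 < t → t ≤ t₀ → ∀ v w, mink (B t v) (B t w) = mink v w)
    {g ν : Circle → ℝ → V} {α : Circle → ℝ → ℝ} {c φ Ψ : Circle → ℝ} {x : Hyp}
    (hc : ∀ η, c η = (-mink x.1 (null η))⁻¹)
    (hα : ∀ η t, 0 < t → t ≤ t₀ → 0 < α η t)
    (hg : ∀ η, HasDerivWithinAt (g η) (φ η • tang η) (Ici 0) 0)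
    (hν : ∀ η, HasDerivWithinAt (ν η) (Ψ η • perp x (c η • null η)) (Ici 0) 0)
    (hg0 : ∀ η, g η 0 = null η) (hν0 : ∀ η, ν η 0 = c η • null η)
    (heq : ∀ η t, 0 < t → t ≤ t₀ → g η t = α η t • B t (ν η t)) :
    ∃ y : V, ∀ η, φ η = mink y (null η) + Ψ η / c η := by
  have hcpos : ∀ η, 0 < c η := fun η => by
    rw [hc]; exact inv_pos.2 (neg_pos.2 (x.mink_null_neg η))
  obtain ⟨Φ, D, hΦ⟩ := differentiable_of_three_null ht₀ hB hcpos hα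
    (fun η => (hg η).differentiableWithinAt) (fun η => (hν η).differentiableWithinAt) hg0 hν0 heq
  have hsmall : ∀ᶠ t in 𝓝[>] (0 : ℝ), 0 < t ∧ t ≤ t₀ := by
    filter_upwards [Ioc_mem_nhdsGT ht₀] with t ht using ht
  have hcongr : ∀ {F G : ℝ → ℝ} {F' G' : ℝ}, HasDerivWithinAt F F' (Ici 0) 0 →
      HasDerivWithinAt G G' (Ici 0) 0 → F 0 = G 0 → (∀ᶠ t in 𝓝[>] 0, F t = G t) → F' = G' := by
    intro F G F' G' hF hG h0 hev
    rw [← hasDerivWithinAt_Ioi_iff_Ici] at hF hG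
    have hF' := hG.congr_of_eventuallyEq hev h0
    have h1 := hF.derivWithin (uniqueDiffWithinAt_Ioi 0)
    rw [← h1, hF'.derivWithin (uniqueDiffWithinAt_Ioi 0)]
  -- The constant function `⟨B t v, B t w⟩` is differentiated at `0`.
  have hanti : ∀ v w, mink (D v) w + mink v (D w) = 0 := by
    intro v w
    have h1 := (hΦ v).1.mink (hΦ w).1
    rw [(hΦ v).2.1, (hΦ w).2.1] at h1
    refine hcongr h1 (hasDerivWithinAt_const 0 (Ici 0) (mink v w)) ?_ ?_
    · rw [(hΦ v).2.1, (hΦ w).2.1]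
    · filter_upwards [hsmall, (hΦ v).2.2, (hΦ w).2.2] with t ht e1 e2
      rw [e1, e2, hB t ht.1 ht.2]
  -- A skew linear map has the form `v ↦ v ⊠ y`; this `y` is read off from its matrix entries.
  -- Linearity of `D` is not available directly, so it is replaced by moving `D` to the other factor
  -- through `hanti` and expanding there.
  let e₀ : V := ![1, 0, 0]
  let e₁ : V := ![0, 1, 0]
  let e₂ : V := ![0, 0, 1]
  let y : V := ![mink (D e₂) e₁, -mink (D e₂) e₀, -mink (D e₀) e₁]
  have hy : ∀ η, mink (null η) (D (tang η)) = -mink y (null η) := by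
    intro η
    have hn : null η = (η : ℂ).re • e₀ + (η : ℂ).im • e₁ + e₂ := by
      ext i; fin_cases i <;> simp [null, e₀, e₁, e₂]
    have ht : tang η = (-(η : ℂ).im) • e₀ + (η : ℂ).re • e₁ := by
      ext i; fin_cases i <;> simp [tang, e₀, e₁]
    have a00 := hanti e₀ e₀
    have a11 := hanti e₁ e₁
    have a01 := hanti e₀ e₁
    have s1 : mink (D (null η)) (tang η) = -(mink (null η) (D (tang η))) := by
      linarith [hanti (null η) (tang η)]
    have t0 := hanti (null η) e₀
    have t1 := hanti (null η) e₁
    have t2 : mink (null η) (D e₀) = (η : ℂ).re * mink e₀ (D e₀) + (η : ℂ).im * mink e₁ (D e₀) +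
        mink e₂ (D e₀) := by
      conv_lhs => rw [hn]
      simp only [mink_add_left, mink_smul_left]
    have t3 : mink (null η) (D e₁) = (η : ℂ).re * mink e₀ (D e₁) + (η : ℂ).im * mink e₁ (D e₁) +
        mink e₂ (D e₁) := by
      conv_lhs => rw [hn]
      simp only [mink_add_left, mink_smul_left]
    have t4 : mink (D (null η)) (tang η) = (-(η : ℂ).im) * mink (D (null η)) e₀ +
        (η : ℂ).re * mink (D (null η)) e₁ := by
      conv_lhs => rw [ht]
      simp only [mink_add_right, mink_smul_right]
    have t5 : mink y (null η) = mink (D e₂) e₁ * (η : ℂ).re + -mink (D e₂) e₀ * (η : ℂ).im -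
        -mink (D e₀) e₁ := by
      simp [y, mink, null]
    have u0 := hanti e₂ e₀
    have u1 := hanti e₂ e₁
    have c1 := mink_comm (D e₀) e₀
    have c2 := mink_comm (D e₁) e₁
    have c3 := mink_comm (D e₀) e₁
    have hsq := Circle.normSq_coe η
    rw [Complex.normSq_apply] at hsq
    have a00' : mink e₀ (D e₀) = 0 := by linarith
    have a11' : mink e₁ (D e₁) = 0 := by linarith
    rw [a00'] at t2
    rw [a11'] at t3
    have w0 : mink (D (null η)) e₀ = -((η : ℂ).im * mink (D e₀) e₁ + mink e₂ (D e₀)) := by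
      rw [c3]; linarith
    have w1 : mink (D (null η)) e₁ = (η : ℂ).re * mink (D e₀) e₁ - mink e₂ (D e₁) := by
      have : mink e₀ (D e₁) = -mink (D e₀) e₁ := by linarith
      rw [this] at t3; linarith
    rw [w0, w1] at t4
    have u0' : mink e₂ (D e₀) = -mink (D e₂) e₀ := by linarith
    have u1' : mink e₂ (D e₁) = -mink (D e₂) e₁ := by linarith
    rw [u0', u1'] at t4
    linear_combination s1 - t4 + t5 - mink (D e₀) e₁ * hsq
  refine ⟨y, fun η => ?_⟩
  have hcη := hcpos η
  have hxν : mink (ν η 0) x.1 = -1 := by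
    have := (x.mink_null_neg η).ne
    rw [hν0, hc, mink_smul_left, mink_comm (null η) x.1]
    field_simp
  -- the scale of `g` relative to `ν`
  let a : ℝ → ℝ := fun t => mink (g η t) (Φ x.1 t) / mink (ν η t) x.1
  have had : DifferentiableWithinAt ℝ a (Ici 0) 0 :=
    ((hg η).differentiableWithinAt.mink (hΦ x.1).1.differentiableWithinAt).div
      ((hν η).differentiableWithinAt.mink (differentiableWithinAt_const _)) (by rw [hxν]; norm_num)
  have ha0 : a 0 = (c η)⁻¹ := by
    simp only [a]
    rw [hxν, (hΦ x.1).2.1, hg0, hc, inv_inv, mink_comm]; ring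
  have hne : ∀ᶠ t in 𝓝[>] 0, mink (ν η t) x.1 ≠ 0 := by
    have h1 : ContinuousWithinAt (fun t => mink (ν η t) x.1) (Ici 0) 0 :=
      ((hν η).differentiableWithinAt.mink (differentiableWithinAt_const x.1)).continuousWithinAt
    refine (h1.mono Ioi_subset_Ici_self).eventually (isOpen_ne.mem_nhds ?_)
    change mink (ν η 0) x.1 ≠ 0
    rw [hxν]; norm_num
  have haα : ∀ᶠ t in 𝓝[>] 0, a t = α η t := by
    filter_upwards [hsmall, (hΦ x.1).2.2, hne] with t ht e1 e2
    simp only [a]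
    rw [e1, heq η t ht.1 ht.2, mink_smul_left, hB t ht.1 ht.2, mul_div_assoc, div_self e2, mul_one]
  -- Both sides of `⟨g, B τ⟩ = α ⟨ν, τ⟩`, with `τ` the tangent vector at `η`, are differentiated.
  -- The derivative of the scale drops out because `⟨ν, τ⟩` vanishes at `t = 0`.
  have hF := (hg η).mink (hΦ (tang η)).1
  have hG := had.hasDerivWithinAt.mul ((hν η).mink (hasDerivWithinAt_const 0 (Ici 0) (tang η)))
  have hz : mink (ν η 0) (tang η) = 0 := by rw [hν0, mink_smul_left, mink_null_tang, mul_zero]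
  have hder := hcongr hF hG (by
      simp only [Pi.mul_apply]
      rw [hz, (hΦ (tang η)).2.1, hg0, mink_null_tang, mul_zero]) (by
      filter_upwards [hsmall, (hΦ (tang η)).2.2, haα] with t ht e1 e2
      simp only [Pi.mul_apply]
      rw [e1, e2, heq η t ht.1 ht.2, mink_smul_left, hB t ht.1 ht.2])
  rw [(hΦ (tang η)).2.1, hz, ha0, hg0, mink_smul_left, mink_tang_self, hy, mink_smul_left,
    mink_zero_right] at hder
  have hperp : mink (perp x (c η • null η)) (tang η) = 1 := by
    have := (x.mink_null_neg η).ne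
    rw [perp, mcross_smul_right, mink_smul_left, mink_mcross_cycle, mcross_null_tang, mink_neg_left,
      hc, mink_comm (null η) x.1]
    field_simp
  rw [hperp] at hder
  rw [div_eq_mul_inv]
  linarith

lemma hasDerivWithinAt_of_quadratic {P : ℝ → ℝ} {Ψ C t₀ : ℝ} (ht₀ : 0 < t₀) (h0 : P 0 = 0)
    (h : ∀ t, 0 < t → t ≤ t₀ → |P t - t * Ψ| ≤ C * t ^ 2) :
    HasDerivWithinAt P Ψ (Ici 0) 0 := by
  rw [← hasDerivWithinAt_Ioi_iff_Ici, hasDerivWithinAt_iff_isLittleO]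
  have hO : (fun t => P t - P 0 - (t - 0) • Ψ) =O[𝓝[>] 0] fun t : ℝ => t ^ 2 := by
    refine Asymptotics.IsBigO.of_bound C ?_
    filter_upwards [Ioc_mem_nhdsGT ht₀] with t ht
    rw [h0, sub_zero, sub_zero, smul_eq_mul, Real.norm_eq_abs, Real.norm_eq_abs,
      abs_of_nonneg (sq_nonneg t)]
    exact h t ht.1 ht.2
  refine hO.trans_isLittleO ?_
  have := (Asymptotics.isLittleO_pow_id (𝕜 := ℝ) (n := 2) (by norm_num)).mono
    (nhdsWithin_le_nhds (s := Ioi (0 : ℝ)))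
  simpa using this

lemma boundaryExtension_id {f : Circle → Circle} (hf : IsBoundaryExtension id f) (x : Hyp)
    (η : Circle) : f η = η := by
  have hη := x.mink_null_neg η
  have h1 := tendsto_klein_pt (frame_ofNull x η) (inv_pos.2 (neg_pos.2 hη)) rfl
  have h2 := (hf η).comp (tendsto_comap_iff.2 h1)
  exact Circle.ext (tendsto_nhds_unique h2 h1)

lemma hasDerivWithinAt_null {f : ℝ → Circle} {η : Circle} {k : ℝ} {s : Set ℝ} {t : ℝ}
    (h : HasDerivWithinAt (fun t => (f t : ℂ)) (Complex.I * (η : ℂ) * (k : ℂ)) s t) :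
    HasDerivWithinAt (fun t => null (f t)) (k • tang η) s t := by
  rw [hasDerivWithinAt_pi]
  have hre := Complex.reCLM.hasFDerivAt.comp_hasDerivWithinAt t h
  have him := Complex.imCLM.hasFDerivAt.comp_hasDerivWithinAt t h
  intro i
  fin_cases i
  · refine hre.congr_deriv ?_
    simp [tang]; ring
  · refine him.congr_deriv ?_
    simp [tang]; ring
  · refine (hasDerivWithinAt_const t s (1 : ℝ)).congr_deriv ?_
    simp [tang]

/-- An infinitesimal earthquake is, up to the restriction of a linear function, the limit of the
integrals of the support functions of the leaves along a ray. -/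
lemma IsInfinitesimalEarthquake.exists_tendsto {μ : Measure Geodesic} (hμ : IsMeasuredLamination μ)
    (hbdd : thurstonNorm μ < ⊤) {φ : Circle → ℝ} (hφ : IsInfinitesimalEarthquake μ φ) {x : Hyp}
    (hx : OffWeightedLeaves μ x) : ∃ y : V, ∀ η, Tendsto (fun r => mink y (null η) +
      ∫ l in meeting (seg x ((frame_ofNull x η).pt r)), |mink (null η) l.nrm| ∂μ) atTop
      (𝓝 (φ η)) := by
  obtain ⟨E, f, hE, hf, hE0, hder⟩ := hφ
  choose! A hA hG using hE
  choose Ψ hΨ using fun η => (frame_ofNull x η).exists_tendsto_rayIntegral hμ hbdd hx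
  set M := (thurstonNorm μ).toReal
  have hM : 0 ≤ M := ENNReal.toReal_nonneg
  set c : Circle → ℝ := fun η => (-mink x.1 (null η))⁻¹
  have hc : ∀ η, 0 < c η := fun η => inv_pos.2 (neg_pos.2 (x.mink_null_neg η))
  -- This ensures the smallness condition of `boundary_estimate`; the `1` covers a lamination of
  -- norm zero.
  set t₀ : ℝ := 1 / (30000 * (M + 1))
  have ht₀ : 0 < t₀ := by positivity
  have hest : ∀ η t, 0 < t → t ≤ t₀ → ∃ α p : ℝ, 0 < α ∧
      (A t (stratum μ.support x)).symm (null (f t η)) = α • fvec x (c η • null η) p (p ^ 2 / 4) ∧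
      |p - t * Ψ η| ≤ 7000000 * (3 * (t * M)) ^ 2 := by
    intro η t ht htt
    refine boundary_estimate hμ hbdd hx (frame_ofNull x η) (hc η) rfl (hΨ η) ht ?_ (hA t ht.le)
      (hG t ht.le) (hf t ht.le)
    have : t * (M + 1) ≤ t₀ * (M + 1) := by gcongr
    have e : t₀ * (M + 1) = 1 / 30000 := by simp only [t₀]; field_simp
    have : t * M ≤ t * (M + 1) := by gcongr; linarith
    linarith
  choose! α p hα hαp hp using hest
  -- The estimate provides `p` only for `t > 0`. The value at `t = 0` is set to the limit.
  let P : Circle → ℝ → ℝ := fun η t => if t = 0 then 0 else p η t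
  have hP : ∀ η t, 0 < t → P η t = p η t := fun η t ht => if_neg ht.ne'
  have hP0 : ∀ η, P η 0 = 0 := fun η => if_pos rfl
  have hPd : ∀ η, HasDerivWithinAt (P η) (Ψ η) (Ici 0) 0 := fun η =>
    hasDerivWithinAt_of_quadratic (C := 7000000 * (3 * M) ^ 2) ht₀ (hP0 η) fun t ht htt => by
      rw [hP η t ht]
      refine (hp η t ht htt).trans_eq (by ring)
  let ν : Circle → ℝ → V := fun η t => fvec x (c η • null η) (P η t) (P η t ^ 2 / 4)
  have hν : ∀ η, HasDerivWithinAt (ν η) (Ψ η • perp x (c η • null η)) (Ici 0) 0 := by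
    intro η
    have h1 := (hPd η).smul_const (perp x (c η • null η))
    have h2 := (((hPd η).pow 2).div_const 4).smul_const (opp x (c η • null η))
    have h3 := (h1.const_add (c η • null η)).add h2
    refine h3.congr_deriv ?_
    rw [hP0]; simp
  have hν0 : ∀ η, ν η 0 = c η • null η := fun η => by
    simp only [ν]; rw [hP0]; simp [fvec]
  obtain ⟨y, hy⟩ := exists_vector_of_factorization (B := fun t => A t (stratum μ.support x))
    (g := fun η t => null (f t η)) (ν := ν) (α := α) (c := c) (φ := φ) (Ψ := Ψ) (x := x) ht₀
    (fun t ht _ => by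
      have hs : IsStratum (t.toNNReal • μ).support (stratum μ.support x) := by
        rw [support_smul_measure μ (by simpa using ht)]
        exact ⟨x, rfl⟩
      exact ((hA t ht.le).2.1 _ hs).1.1)
    (fun _ => rfl) hα (fun η => hasDerivWithinAt_null (hder η))
    hν (fun η => by
      have h0 := hf 0 le_rfl
      rw [hE0] at h0
      simp only [boundaryExtension_id h0 x η]) hν0
    (fun η t ht htt => by
      simp only [ν]
      rw [hP η t ht, ← LinearEquiv.map_smul, ← hαp η t ht htt, LinearEquiv.apply_symm_apply])
  refine ⟨y, fun η => ?_⟩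
  rw [hy η]
  refine tendsto_const_nhds.add (Tendsto.congr (fun r => ?_) ((hΨ η).div_const (c η)))
  rw [Frame.rayIntegral, ← integral_div]
  refine integral_congr_ae (.of_forall fun l => ?_)
  change |mink (c η • null η) l.nrm| / c η = _
  rw [mink_smul_left, abs_mul, abs_of_pos (hc η)]
  field_simp [(hc η).ne']

/-! ### The domain of a measured lamination -/

/-- The point `y₀ + ∫ σ dμ` at which the domain of `μ` has a support plane orthogonal to `x`. -/
noncomputable def messPoint (μ : Measure Geodesic) (x₀ : Hyp) (y₀ : V) (x : Hyp) : V :=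
  y₀ + ∫ l in meeting (seg x₀ x), sigma x₀ x l ∂μ

/-- The domain cut out by the support planes of a measured lamination. -/
def messDomain (μ : Measure Geodesic) (x₀ : Hyp) (y₀ : V) : Set V :=
  {p | ∀ x : Hyp, mink p x.1 ≤ mink (messPoint μ x₀ y₀ x) x.1}

/-- The linear form `⟨·, v⟩`. -/
noncomputable def minkCLM (v : V) : V →L[ℝ] ℝ :=
  LinearMap.toContinuousLinearMap
    { toFun := fun w => mink w v
      map_add' := fun a b => mink_add_left a b v
      map_smul' := fun c a => mink_smul_left c a v }

lemma minkCLM_apply (v w : V) : minkCLM v w = mink w v := rfl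

lemma integrableOn_mink_sigma (μ : Measure Geodesic) [IsLocallyFiniteMeasure μ] (x₀ x y z : Hyp)
    (v : V) : IntegrableOn (fun l => mink (sigma x₀ x l) v) (meeting (seg y z)) μ :=
  (minkCLM v).integrable_comp (integrableOn_sigma μ x₀ x y z)

lemma mink_messPoint (μ : Measure Geodesic) [IsLocallyFiniteMeasure μ] (x₀ : Hyp) (y₀ : V) (x : Hyp)
    (v : V) : mink (messPoint μ x₀ y₀ x) v =
      mink y₀ v + ∫ l in meeting (seg x₀ x), mink (sigma x₀ x l) v ∂μ := by
  rw [messPoint, mink_add_left]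
  congr 1
  exact ((minkCLM v).integral_comp_comm (integrableOn_sigma μ x₀ x x₀ x)).symm

lemma mink_sigma_of_nonpos {x₀ x : Hyp} {l : Geodesic} {v : V}
    (h : (mink x.1 l.nrm - mink x₀.1 l.nrm) * mink v l.nrm ≤ 0) : mink (sigma x₀ x l) v ≤ 0 := by
  rw [sigma_eq, mink_smul_left, mink_comm l.nrm]
  rcases lt_trichotomy (mink x.1 l.nrm - mink x₀.1 l.nrm) 0 with hs | hs | hs
  · rw [Real.sign_of_neg hs]; nlinarith
  · rw [hs, Real.sign_zero, zero_mul]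
  · rw [Real.sign_of_pos hs]; nlinarith

lemma mink_sigma_of_pos {x₀ x : Hyp} {l : Geodesic} {v : V}
    (h : 0 < (mink x.1 l.nrm - mink x₀.1 l.nrm) * mink v l.nrm ∨ mink v l.nrm = 0) :
    mink (sigma x₀ x l) v = |mink v l.nrm| := by
  rw [sigma_eq, mink_smul_left, mink_comm l.nrm]
  rcases h with h | h
  · rcases lt_trichotomy (mink x.1 l.nrm - mink x₀.1 l.nrm) 0 with hs | hs | hs
    · rw [Real.sign_of_neg hs, abs_of_neg (by nlinarith)]; ring
    · rw [hs] at h; simp at h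
    · rw [Real.sign_of_pos hs, abs_of_pos (by nlinarith)]; ring
  · rw [h]; simp

lemma mink_sigma_self {x₀ x : Hyp} {l : Geodesic} (hl : l ∈ meeting (seg x₀ x)) :
    mink (sigma x₀ x l) x.1 = |mink x.1 l.nrm| := by
  rw [mem_meeting_seg] at hl
  apply mink_sigma_of_pos
  by_cases h : mink x.1 l.nrm = 0
  · exact Or.inr h
  · left
    have := mul_self_pos.2 h
    nlinarith

lemma mink_messPoint_self (μ : Measure Geodesic) [IsLocallyFiniteMeasure μ] (x₀ : Hyp) (y₀ : V)
    (x : Hyp) : mink (messPoint μ x₀ y₀ x) x.1 =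
      mink y₀ x.1 + ∫ l in meeting (seg x₀ x), |mink x.1 l.nrm| ∂μ := by
  rw [mink_messPoint]
  congr 1
  exact setIntegral_congr_fun (measurableSet_meeting_seg _ _) fun l hl => mink_sigma_self hl

lemma ae_mem_support (μ : Measure Geodesic) : ∀ᵐ l ∂μ, l ∈ μ.support :=
  Measure.support_mem_ae

/-- The integrands of `⟨y(x), z⟩` and `⟨y(z), z⟩` are compared leaf by leaf. A leaf crossed by both
segments contributes at most its absolute value; a leaf crossed only on the way to `x` has `z` on
the side of `x₀`, where the outward normal is nonpositive; a leaf crossed only on the way to `z`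
contributes a nonnegative term to the right-hand side. Leaves through `x₀` are negligible. -/
lemma messPoint_mem {μ : Measure Geodesic} (hμ : IsMeasuredLamination μ) {x₀ : Hyp}
    (hx₀ : OffWeightedLeaves μ x₀) (y₀ : V) (x : Hyp) :
    messPoint μ x₀ y₀ x ∈ messDomain μ x₀ y₀ := by
  have := hμ.1
  intro z
  rw [mink_messPoint_self, mink_messPoint]
  gcongr
  rw [← integral_indicator (measurableSet_meeting_seg _ _),
    ← integral_indicator (measurableSet_meeting_seg _ _)]
  refine integral_mono_ae
    ((integrableOn_mink_sigma μ x₀ x x₀ x z.1).integrable_indicator (measurableSet_meeting_seg _ _))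
    ((integrableOn_abs_mink μ z.1 x₀ z).integrable_indicator (measurableSet_meeting_seg _ _)) ?_
  have h0 : ∀ᵐ l ∂μ, x₀ ∉ l.points := by
    rw [ae_iff]; simpa using measure_through_eq_zero hμ hx₀
  filter_upwards [h0] with l hl
  rw [Geodesic.mem_points_iff] at hl
  by_cases hx : l ∈ meeting (seg x₀ x)
  · rw [indicator_of_mem hx]
    by_cases hz : l ∈ meeting (seg x₀ z)
    · rw [indicator_of_mem hz]
      rw [sigma_eq, mink_smul_left, mink_comm l.nrm]
      refine (le_abs_self _).trans ?_
      rw [abs_mul]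
      refine mul_le_of_le_one_left (abs_nonneg _) ?_
      rcases Real.sign_apply_eq (mink x.1 l.nrm - mink x₀.1 l.nrm) with h | h | h <;> rw [h] <;>
        simp
    · rw [indicator_of_notMem hz]
      apply mink_sigma_of_nonpos
      rw [mem_meeting_seg] at hx hz
      push Not at hz
      rcases lt_or_gt_of_ne hl with h | h
      · have h1 : 0 ≤ mink x.1 l.nrm := by by_contra! hc; nlinarith
        have h2 : mink z.1 l.nrm < 0 := by by_contra! hc; nlinarith
        nlinarith
      · have h1 : mink x.1 l.nrm ≤ 0 := by by_contra! hc; nlinarith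
        have h2 : 0 < mink z.1 l.nrm := by by_contra! hc; nlinarith
        nlinarith
  · rw [indicator_of_notMem hx]
    exact indicator_nonneg (fun _ _ => abs_nonneg _) _

/-- If no leaf strictly separates `x` from `v`, the support plane at `x` also supports the domain in
the direction `v`. -/
lemma integral_le_of_not_separated {μ : Measure Geodesic} [IsLocallyFiniteMeasure μ] {x₀ x : Hyp}
    {v : V} (hv : ∀ l ∈ μ.support, mink v l.nrm = 0 ∨ 0 < mink x.1 l.nrm * mink v l.nrm) {z : Hyp}
    (hz : ∀ l ∈ meeting (seg x₀ z), mink x₀.1 l.nrm * mink v l.nrm ≤ 0) (y₀ : V) :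
    mink y₀ v + ∫ l in meeting (seg x₀ z), |mink v l.nrm| ∂μ ≤ mink (messPoint μ x₀ y₀ x) v := by
  rw [mink_messPoint]
  gcongr
  rw [← integral_indicator (measurableSet_meeting_seg _ _),
    ← integral_indicator (measurableSet_meeting_seg _ _)]
  refine integral_mono_ae
    ((integrableOn_abs_mink μ v x₀ z).integrable_indicator (measurableSet_meeting_seg _ _))
    ((integrableOn_mink_sigma μ x₀ x x₀ x v).integrable_indicator (measurableSet_meeting_seg _ _)) ?_
  filter_upwards [ae_mem_support μ] with l hl
  have hx : l ∈ meeting (seg x₀ x) → mink (sigma x₀ x l) v = |mink v l.nrm| := by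
    intro h
    rw [mem_meeting_seg] at h
    apply mink_sigma_of_pos
    rcases hv l hl with h1 | h1
    · exact Or.inr h1
    · left
      rcases lt_trichotomy (mink v l.nrm) 0 with h2 | h2 | h2
      · have h3 : mink x.1 l.nrm < 0 := by by_contra! hc; nlinarith
        have h4 : 0 ≤ mink x₀.1 l.nrm := by by_contra! hc; nlinarith
        nlinarith
      · rw [h2] at h1; simp at h1
      · have h3 : 0 < mink x.1 l.nrm := by by_contra! hc; nlinarith
        have h4 : mink x₀.1 l.nrm ≤ 0 := by by_contra! hc; nlinarith
        nlinarith
  by_cases hlx : l ∈ meeting (seg x₀ x)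
  · rw [indicator_of_mem hlx, hx hlx]
    exact indicator_le_self' (fun _ _ => abs_nonneg _) l
  · rw [indicator_of_notMem hlx]
    refine indicator_apply_nonpos fun hlz => ?_
    have h1 := hz l hlz
    rw [mem_meeting_seg] at hlx
    push Not at hlx
    rcases hv l hl with h2 | h2
    · rw [h2, abs_zero]
    · exfalso
      have : 0 < (mink x₀.1 l.nrm * mink x.1 l.nrm) * (mink x.1 l.nrm * mink v l.nrm) :=
        mul_pos hlx h2
      nlinarith [mul_nonneg (sq_nonneg (mink x.1 l.nrm)) (neg_nonneg.2 h1)]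

namespace Frame

variable {x₀ : Hyp} {N : V}

lemma mink_mul_of_mem_meeting (h : Frame x₀ N) {r : ℝ} (hr : 0 ≤ r) {l : Geodesic}
    (hl : l ∈ meeting (seg x₀ (h.pt r))) : mink x₀.1 l.nrm * mink N l.nrm ≤ 0 := by
  rw [mem_meeting_seg, h.pt_val, mink_add_left, mink_smul_left, mink_smul_left] at hl
  rcases hr.eq_or_lt with rfl | hr
  · have h0 : mink x₀.1 l.nrm = 0 := by
      simp only [neg_zero, Real.exp_zero, one_mul, Real.sinh_zero, zero_mul, add_zero] at hl
      exact mul_self_eq_zero.1 (le_antisymm hl (mul_self_nonneg _))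
    rw [h0, zero_mul]
  · have hs : 0 < Real.sinh r := Real.sinh_pos_iff.2 hr
    have he := Real.exp_pos (-r)
    by_contra! hc
    nlinarith [mul_pos hs hc, mul_nonneg he.le (mul_self_nonneg (mink x₀.1 l.nrm))]

/-- The direction of the ray has the sign of the jump of `⟨·, l⟩` along it. -/
lemma mink_sigma_pt (h : Frame x₀ N) {r : ℝ} (hr : 0 < r) {l : Geodesic}
    (hl : l ∈ meeting (seg x₀ (h.pt r))) : mink (sigma x₀ (h.pt r) l) N = |mink N l.nrm| := by
  have h1 := h.mink_mul_of_mem_meeting hr.le hl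
  apply mink_sigma_of_pos
  by_cases hN : mink N l.nrm = 0
  · exact Or.inr hN
  left
  have hs : 0 < Real.sinh r := Real.sinh_pos_iff.2 hr
  have he : Real.exp (-r) ≤ 1 := Real.exp_le_one_iff.2 (by linarith)
  rw [h.pt_val, mink_add_left, mink_smul_left, mink_smul_left]
  nlinarith [mul_pos hs (mul_self_pos.2 hN), mul_nonneg (sub_nonneg.2 he) (neg_nonneg.2 h1)]

/-- The opposite null vector is the backward end of the geodesic, which lies on the side of `x₀` of
every leaf crossed by the ray. This bounds the error when a support plane at a far point is compared
with the null plane. -/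
lemma mink_sigma_pt_opp (h : Frame x₀ N) {r : ℝ} (hr : 0 < r) {l : Geodesic}
    (hl : l ∈ meeting (seg x₀ (h.pt r))) : mink (sigma x₀ (h.pt r) l) (opp x₀ N) ≤ 0 := by
  have h1 := h.mink_mul_of_mem_meeting hr.le hl
  apply mink_sigma_of_nonpos
  have hs : 0 < Real.sinh r := Real.sinh_pos_iff.2 hr
  have he : Real.exp (-r) ≤ 1 := Real.exp_le_one_iff.2 (by linarith)
  rw [h.pt_val, mink_add_left, mink_smul_left, mink_smul_left, opp, mink_sub_left, mink_smul_left]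
  nlinarith [mul_nonneg hs.le (mul_self_nonneg (mink N l.nrm)),
    mul_nonneg (sub_nonneg.2 he) (neg_nonneg.2 h1), mul_nonneg hs.le (neg_nonneg.2 h1),
    mul_nonneg (sub_nonneg.2 he) (mul_self_nonneg (mink x₀.1 l.nrm))]

lemma mink_messPoint_pt (μ : Measure Geodesic) [IsLocallyFiniteMeasure μ] (h : Frame x₀ N) (y₀ : V)
    {r : ℝ} (hr : 0 < r) : mink (messPoint μ x₀ y₀ (h.pt r)) N =
      mink y₀ N + ∫ l in meeting (seg x₀ (h.pt r)), |mink N l.nrm| ∂μ := by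
  rw [mink_messPoint]
  congr 1
  exact setIntegral_congr_fun (measurableSet_meeting_seg _ _) fun l hl => h.mink_sigma_pt hr hl

lemma mink_messPoint_pt_opp (μ : Measure Geodesic) [IsLocallyFiniteMeasure μ] (h : Frame x₀ N)
    (y₀ : V) {r : ℝ} (hr : 0 < r) :
    mink (messPoint μ x₀ y₀ (h.pt r)) (opp x₀ N) ≤ mink y₀ (opp x₀ N) := by
  rw [mink_messPoint]
  have := setIntegral_nonpos (μ := μ) (measurableSet_meeting_seg x₀ (h.pt r)) fun l hl =>
    h.mink_sigma_pt_opp hr hl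
  linarith

end Frame

/-- The support function at infinity is at most the limit along rays. -/
lemma mink_null_le_of_mem {μ : Measure Geodesic} [IsLocallyFiniteMeasure μ] {x₀ : Hyp} {y₀ p : V}
    (hp : p ∈ messDomain μ x₀ y₀) {η : Circle} {k : ℝ}
    (hk : Tendsto (fun r => mink (messPoint μ x₀ y₀ ((frame_ofNull x₀ η).pt r)) (null η)) atTop
      (𝓝 k)) : mink p (null η) ≤ k := by
  set h := frame_ofNull x₀ η
  set c := (-mink x₀.1 (null η))⁻¹
  have hc : 0 < c := inv_pos.2 (neg_pos.2 (x₀.mink_null_neg η))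
  have h1 : Tendsto (fun r : ℝ => Real.exp (-(2 * r))) atTop (𝓝 0) :=
    Real.tendsto_exp_neg_atTop_nhds_zero.comp
      (tendsto_id.const_mul_atTop (show (0 : ℝ) < 2 by norm_num))
  -- Up to the factor `exp r / 2`, the point at distance `r` is `N + exp (-2r) ξ`, with `ξ` the
  -- opposite null vector. In the half-space condition there, the `ξ`-term of `y(x)` is at most that
  -- of `y₀` and disappears in the limit.
  have hl : Tendsto (fun r : ℝ => c * mink p (null η) +
      Real.exp (-(2 * r)) * (mink p (opp x₀ (c • null η)) - mink y₀ (opp x₀ (c • null η)))) atTop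
      (𝓝 (c * mink p (null η) + 0 * (mink p (opp x₀ (c • null η)) -
        mink y₀ (opp x₀ (c • null η))))) :=
    tendsto_const_nhds.add (h1.mul_const _)
  have := le_of_tendsto_of_tendsto hl (hk.const_mul c) (by
    filter_upwards [eventually_gt_atTop 0] with r hr
    have h2 := hp (h.pt r)
    have h3 := h.mink_messPoint_pt_opp μ y₀ hr
    have e : ∀ w, mink w (h.pt r).1 = Real.exp r / 2 * (c * mink w (null η) +
        Real.exp (-(2 * r)) * mink w (opp x₀ (c • null η))) := by
      intro w
      have : Real.exp (-r) = Real.exp r * Real.exp (-(2 * r)) := by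
        rw [← Real.exp_add]; ring_nf
      rw [h.pt_val_half, mink_add_right, mink_smul_right, mink_smul_right, mink_smul_right, this]
      ring
    rw [e, e] at h2
    have h4 := le_of_mul_le_mul_left h2 (by positivity)
    nlinarith [Real.exp_pos (-(2 * r)), mul_le_mul_of_nonneg_left h3 (Real.exp_pos (-(2 * r))).le])
  rw [zero_mul, add_zero] at this
  exact le_of_mul_le_mul_left this hc

lemma exists_smul_null {w : V} (hw : mink w w = 0) (hw2 : 0 < w 2) :
    ∃ η : Circle, w = w 2 • null η := by
  have hc : (⟨w 0 / w 2, w 1 / w 2⟩ : ℂ) ∈ Submonoid.unitSphere ℂ := by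
    change _ ∈ Metric.sphere (0 : ℂ) 1
    rw [mem_sphere_zero_iff_norm, ← sq_eq_sq₀ (norm_nonneg _) zero_le_one,
      ← Complex.normSq_eq_norm_sq, Complex.normSq_apply]
    simp only [mink] at hw
    field_simp
    linarith
  refine ⟨⟨_, hc⟩, ?_⟩
  ext i
  fin_cases i <;> simp [null] <;> field_simp

/-- On a leaf of the lamination, the support plane is determined by the endpoints of the leaf. -/
lemma mink_le_of_mem_leaf {μ : Measure Geodesic} (hμ : IsMeasuredLamination μ) {x₀ : Hyp}
    {y₀ : V} {φ : Circle → ℝ} (hφ : ∀ η, Tendsto (fun r => mink y₀ (null η) +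
      ∫ l in meeting (seg x₀ ((frame_ofNull x₀ η).pt r)), |mink (null η) l.nrm| ∂μ) atTop
      (𝓝 (φ η))) {p : V} (hp : ∀ η, mink p (null η) ≤ φ η) {l : Geodesic} (hl : l ∈ μ.support)
    {x : Hyp} (hx : x ∈ l.points) : mink p x.1 ≤ mink (messPoint μ x₀ y₀ x) x.1 := by
  have := hμ.1
  obtain ⟨a, b, hab, u, v, hu, hv, hxab⟩ := id hx
  -- no leaf separates `x` from the endpoints
  have key : ∀ e : Circle, (e = a ∨ e = b) → mink p (null e) ≤ mink (messPoint μ x₀ y₀ x) (null e) := by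
    intro e he
    refine (hp e).trans (le_of_tendsto (hφ e) ?_)
    filter_upwards [eventually_ge_atTop 0] with r hr
    refine integral_le_of_not_separated (fun l' hl' => ?_) (fun l' hl' => ?_) y₀
    · by_cases h0 : mink (null e) l'.nrm = 0
      · exact Or.inl h0
      right
      have hne : l' ≠ l := by
        rintro rfl
        apply h0
        have hn : mink (null e) (normal a b) = 0 := by
          rcases he with rfl | rfl
          · exact mink_normal_left _ _
          · exact mink_normal_right _ _
        rcases Geodesic.nrm_eq_or hab with h | h
        · rwa [h] at hn
        · rw [h, mink_neg_right] at hn; linarith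
      have hdis := hμ.2.2 hl hl' hne.symm
      have hpos : ∀ z ∈ l.points, 0 < mink x.1 l'.nrm * mink z.1 l'.nrm := fun z hz =>
        mink_mul_pos_of_disjoint hdis hx hz
      have hend := Geodesic.endpoints_nonpos (l := l) (σ := (-mink x.1 l'.nrm) • l'.nrm) (by
        intro z hz
        rw [mink_smul_right]
        linarith [hpos z hz])
      have hend' : mink (null e) ((-mink x.1 l'.nrm) • l'.nrm) ≤ 0 := by
        have hs := l.mk_fst_snd
        rw [hab, Sym2.eq_iff] at hs
        rcases hs with ⟨h1, h2⟩ | ⟨h1, h2⟩ <;> rcases he with rfl | rfl <;> simp only [h1, h2] <;>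
          first | exact hend.1 | exact hend.2
      rw [mink_smul_right] at hend'
      refine lt_of_le_of_ne (by linarith) (Ne.symm (mul_ne_zero ?_ h0))
      have := hpos x hx
      intro h; rw [h] at this; simp at this
    · have h1 := (frame_ofNull x₀ e).mink_mul_of_mem_meeting hr hl'
      rw [mink_smul_left, mul_left_comm] at h1
      have hc : 0 < (-mink x₀.1 (null e))⁻¹ := inv_pos.2 (neg_pos.2 (x₀.mink_null_neg e))
      by_contra! hcon
      nlinarith [mul_pos hc hcon]
  rw [hxab, mink_add_right, mink_add_right, mink_smul_right, mink_smul_right, mink_smul_right,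
    mink_smul_right]
  have h1 := mul_le_mul_of_nonneg_left (key a (Or.inl rfl)) hu.le
  have h2 := mul_le_mul_of_nonneg_left (key b (Or.inr rfl)) hv.le
  linarith

/-- In a complementary region, a point above the support plane at `x` stays below it in all
directions at infinity. -/
lemma mink_null_nonpos_of_pos {μ : Measure Geodesic} (hμ : IsMeasuredLamination μ) {x₀ : Hyp}
    {y₀ : V} {φ : Circle → ℝ} (hφ : ∀ η, Tendsto (fun r => mink y₀ (null η) +
      ∫ l in meeting (seg x₀ ((frame_ofNull x₀ η).pt r)), |mink (null η) l.nrm| ∂μ) atTop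
      (𝓝 (φ η))) {p : V} (hp : ∀ η, mink p (null η) ≤ φ η) {x : Hyp}
    (hx : ∀ l ∈ μ.support, x ∉ l.points)
    (hpos : 0 < mink (p - messPoint μ x₀ y₀ x) x.1) (η : Circle) :
    mink (p - messPoint μ x₀ y₀ x) (null η) ≤ 0 := by
  have := hμ.1
  set h := frame_ofNull x η
  set c := (-mink x.1 (null η))⁻¹
  have hc : 0 < c := inv_pos.2 (neg_pos.2 (x.mink_null_neg η))
  by_cases hmeet : ∃ r, 0 < r ∧ ∃ l ∈ μ.support, l ∈ meeting (seg x (h.pt r))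
  -- At the first leaf met by the ray, at `z`, the point `p` satisfies the half-space condition, and
  -- there the plane at `x` is no lower than the plane at `z`. So `p - y(x)` is positive on `x` and
  -- nonpositive on the combination `z` of `x` and `null η`, which forces its sign on `null η`.
  · obtain ⟨r, hr, hmeet⟩ := hmeet
    obtain ⟨l, hl, z, hz, hzl, hfirst⟩ := exists_first_leaf hμ.2 hx hmeet
    have h1 := mink_le_of_mem_leaf hμ hφ hp hl hzl
    have h2 : mink (messPoint μ x₀ y₀ z) z.1 ≤ mink (messPoint μ x₀ y₀ x) z.1 := by
      rw [mink_messPoint_self]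
      refine integral_le_of_not_separated (fun l' hl' => ?_)
        (fun l' hl' => mem_meeting_seg.1 hl') y₀
      by_cases he : l' = l
      · left; rw [he]; exact Geodesic.mem_points_iff.1 hzl
      · right
        have := hfirst l' hl' he
        rw [mem_meeting_seg] at this
        exact not_le.1 this
    obtain ⟨a, b, ha, hb, hzab⟩ := hz
    have hb' : 0 < b := by
      refine lt_of_le_of_ne hb fun hb0 => ?_
      rw [← hb0, zero_smul, add_zero] at hzab
      exact hx l hl (Hyp.eq_of_smul hzab ▸ hzl)
    have hq : mink (p - messPoint μ x₀ y₀ x) z.1 ≤ 0 := by rw [mink_sub_left]; linarith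
    rw [hzab, h.pt_val, mink_add_right, mink_smul_right, mink_smul_right, mink_add_right,
      mink_smul_right, mink_smul_right, mink_smul_right] at hq
    have hs : 0 < Real.sinh r := Real.sinh_pos_iff.2 hr
    by_contra! hcon
    have h3 : 0 < b * (Real.exp (-r) * mink (p - messPoint μ x₀ y₀ x) x.1 +
        Real.sinh r * (c * mink (p - messPoint μ x₀ y₀ x) (null η))) := by positivity
    linarith [mul_nonneg ha hpos.le]
  · push Not at hmeet
    rw [mink_sub_left, sub_nonpos]
    refine (hp η).trans (le_of_tendsto (hφ η) ?_)
    filter_upwards [eventually_ge_atTop 0] with r hr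
    refine integral_le_of_not_separated (fun l' hl' => ?_) (fun l' hl' => ?_) y₀
    · by_cases h0 : mink (null η) l'.nrm = 0
      · exact Or.inl h0
      right
      have h1 : ∀ s, 0 < s → 0 < Real.exp (-s) * (mink x.1 l'.nrm * mink x.1 l'.nrm) +
          Real.sinh s * c * (mink x.1 l'.nrm * mink (null η) l'.nrm) := by
        intro s hs
        have := hmeet s hs l' hl'
        rw [mem_meeting_seg, h.pt_val, mink_add_left, mink_smul_left, mink_smul_left,
          mink_smul_left, not_le] at this
        linarith
      have hx0 : mink x.1 l'.nrm ≠ 0 := fun h0 => hx l' hl' (Geodesic.mem_points_iff.2 h0)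
      refine lt_of_le_of_ne ?_ (Ne.symm (mul_ne_zero hx0 h0))
      by_contra! hneg
      -- If `η` were strictly on the other side of `l'`, the `sinh` term would dominate far out and
      -- the ray would cross `l'`.
      have hlim : Tendsto (fun s => Real.exp (-s) * (mink x.1 l'.nrm * mink x.1 l'.nrm) +
          Real.sinh s * (c * (mink x.1 l'.nrm * mink (null η) l'.nrm))) atTop atBot := by
        refine Tendsto.add_atBot (Real.tendsto_exp_neg_atTop_nhds_zero.mul_const _) ?_
        exact Real.sinhOrderIso.tendsto_atTop.atTop_mul_const_of_neg (mul_neg_of_pos_of_neg hc hneg)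
      obtain ⟨s, hs1, hs2⟩ := ((hlim.eventually (eventually_lt_atBot 0)).and
        (eventually_gt_atTop 0)).exists
      linarith [h1 s hs2, mul_assoc (Real.sinh s) c (mink x.1 l'.nrm * mink (null η) l'.nrm)]
    · have h1 := (frame_ofNull x₀ η).mink_mul_of_mem_meeting hr hl'
      rw [mink_smul_left, mul_left_comm] at h1
      have hc : 0 < (-mink x₀.1 (null η))⁻¹ := inv_pos.2 (neg_pos.2 (x₀.mink_null_neg η))
      by_contra! hcon
      nlinarith [mul_pos hc hcon]

/-- The domain of a measured lamination is an intersection of null half-spaces. -/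
lemma mem_messDomain_of_forall_null {μ : Measure Geodesic} (hμ : IsMeasuredLamination μ) {x₀ : Hyp}
    {y₀ : V} {φ : Circle → ℝ} (hφ : ∀ η, Tendsto (fun r => mink y₀ (null η) +
      ∫ l in meeting (seg x₀ ((frame_ofNull x₀ η).pt r)), |mink (null η) l.nrm| ∂μ) atTop
      (𝓝 (φ η))) {p : V} (hp : ∀ η, mink p (null η) ≤ φ η) : p ∈ messDomain μ x₀ y₀ := by
  intro x
  by_cases hx : ∃ l ∈ μ.support, x ∈ l.points
  · obtain ⟨l, hl, hxl⟩ := hx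
    exact mink_le_of_mem_leaf hμ hφ hp hl hxl
  push Not at hx
  by_contra! hcon
  have hpos : 0 < mink (p - messPoint μ x₀ y₀ x) x.1 := by rw [mink_sub_left]; linarith
  have hN := mink_null_nonpos_of_pos hμ hφ hp hx hpos
  -- Twice `x` is a sum of two future null vectors, so a vector nonpositive on all null directions
  -- is nonpositive on `x`. Any boundary point may serve; `1` is taken.
  have h := frame_ofNull x 1
  obtain ⟨η, hη⟩ := exists_smul_null h.mink_opp_self h.opp_two_pos
  have h2 : (2 : ℝ) • x.1 = (-mink x.1 (null 1))⁻¹ • null 1 +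
      opp x ((-mink x.1 (null 1))⁻¹ • null 1) := by rw [opp]; module
  have h3 := congrArg (mink (p - messPoint μ x₀ y₀ x)) h2
  rw [hη, mink_smul_right, mink_add_right, mink_smul_right, mink_smul_right] at h3
  have h4 := mul_nonneg (inv_pos.2 (neg_pos.2 (x.mink_null_neg 1))).le (neg_nonneg.2 (hN 1))
  have h5 := mul_nonneg h.opp_two_pos.le (neg_nonneg.2 (hN η))
  linarith

/-! ### Future-convex sets -/

lemma IsFutureConvex.add_causal_mem {D : Set V} (hD : IsFutureConvex D) {p v : V} (hp : p ∈ D)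
    (hv : mink v v ≤ 0) (hv2 : 0 ≤ v 2) : p + v ∈ D := by
  obtain ⟨-, -, C, rfl⟩ := hD
  intro c hc
  have := mink_nonpos_of_causal hv (by rw [c.1.mink_self]; norm_num) hv2 c.1.two_pos.le
  rw [mink_add_left]
  linarith [hp c hc]

lemma IsFutureConvex.isClosed {D : Set V} (hD : IsFutureConvex D) : IsClosed D := by
  obtain ⟨-, -, C, rfl⟩ := hD
  simp only [ofPred_forall]
  exact isClosed_biInter fun c _ =>
    isClosed_le (Continuous.mink continuous_id continuous_const) continuous_const

lemma IsFutureConvex.convex_mem {D : Set V} (hD : IsFutureConvex D) {p q : V} (hp : p ∈ D)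
    (hq : q ∈ D) {a b : ℝ} (ha : 0 ≤ a) (hb : 0 ≤ b) (hab : a + b = 1) : a • p + b • q ∈ D := by
  obtain ⟨-, -, C, rfl⟩ := hD
  intro c hc
  rw [mink_add_left, mink_smul_left, mink_smul_left]
  have h1 := mul_le_mul_of_nonneg_left (hp c hc) ha
  have h2 := mul_le_mul_of_nonneg_left (hq c hc) hb
  linear_combination h1 + h2 + c.2 * hab

lemma IsFutureConvex.exists_bound {D : Set V} (hD : IsFutureConvex D) :
    ∃ (x : Hyp) (k : ℝ), ∀ p ∈ D, mink p x.1 ≤ k := by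
  obtain ⟨-, hne, C, rfl⟩ := hD
  obtain ⟨c, hc⟩ : C.Nonempty := by
    by_contra! h
    apply hne
    simp [h]
  exact ⟨c.1, c.2, fun p hp => hp c hc⟩

lemma isOpen_timelike (p : V) : IsOpen {q : V | mink (q - p) (q - p) < 0 ∧ 0 < (q - p) 2} := by
  have h1 : Continuous fun q : V => q - p := by fun_prop
  exact (isOpen_lt (Continuous.mink h1 h1) continuous_const).inter
    (isOpen_lt continuous_const ((continuous_apply 2).comp h1))

lemma IsFutureConvex.mem_interior {D : Set V} (hD : IsFutureConvex D) {p q : V} (hp : p ∈ D)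
    (h : mink (q - p) (q - p) < 0) (h2 : 0 < (q - p) 2) : q ∈ interior D := by
  refine _root_.mem_interior.2 ⟨_, fun r hr => ?_, isOpen_timelike p, ⟨h, h2⟩⟩
  have := hD.add_causal_mem hp hr.1.le hr.2.le
  rwa [add_sub_cancel] at this

lemma IsFutureConvex.add_causal_mem_interior {D : Set V} (hD : IsFutureConvex D) {p v : V}
    (hp : p ∈ interior D) (hv : mink v v ≤ 0) (hv2 : 0 ≤ v 2) : p + v ∈ interior D := by
  have hc : Continuous fun q : V => q - v := by fun_prop
  refine _root_.mem_interior.2 ⟨(fun q : V => q - v) ⁻¹' interior D, fun r hr => ?_,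
    isOpen_interior.preimage hc, by simpa using hp⟩
  have := hD.add_causal_mem (interior_subset hr) hv hv2
  rwa [sub_add_cancel] at this

/-- A spacelike plane bounds the time component of the causal vectors that lie before it. -/
lemma two_le_of_causal (x : Hyp) {w : V} (hw : mink w w ≤ 0) (hw2 : 0 ≤ w 2) :
    w 2 ≤ 2 * x.1 2 * (-mink w x.1) := by
  have hx := x.mink_self
  have hx2 := x.two_pos
  -- This `k` bounds the horizontal length `√(x₂² - 1)` of `x` from above, and its gap `1 / (2 x₂)`
  -- to the height gives the stated factor `2 x₂`.
  set k := x.1 2 - 1 / (2 * x.1 2)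
  have hk2 : x.1 2 ^ 2 - 1 ≤ k ^ 2 := by
    have : k ^ 2 = x.1 2 ^ 2 - 1 + (1 / (2 * x.1 2)) ^ 2 := by
      simp only [k]; field_simp; ring
    rw [this]; linarith [sq_nonneg (1 / (2 * x.1 2))]
  have hk0 : 0 ≤ k := by
    simp only [k]
    have h1 : 1 ≤ x.1 2 := by
      simp only [mink] at hx
      nlinarith [sq_nonneg (x.1 0), sq_nonneg (x.1 1)]
    rw [sub_nonneg, div_le_iff₀ (by positivity)]
    nlinarith
  have hin : w 0 * x.1 0 + w 1 * x.1 1 ≤ k * w 2 := by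
    refine abs_le_of_sq_le_sq' ?_ (mul_nonneg hk0 hw2) |>.2
    simp only [mink] at hx hw
    have h1 : (w 0 * x.1 0 + w 1 * x.1 1) ^ 2 ≤ (w 0 ^ 2 + w 1 ^ 2) * (x.1 0 ^ 2 + x.1 1 ^ 2) := by
      nlinarith [sq_nonneg (w 0 * x.1 1 - w 1 * x.1 0)]
    have h2 : (w 0 ^ 2 + w 1 ^ 2) * (x.1 0 ^ 2 + x.1 1 ^ 2) ≤ w 2 ^ 2 * k ^ 2 := by
      apply mul_le_mul <;> nlinarith
    linarith [mul_pow k (w 2) 2]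
  have e : 2 * x.1 2 * (-mink w x.1) = 2 * x.1 2 * (x.1 2 * w 2 - (w 0 * x.1 0 + w 1 * x.1 1)) := by
    simp only [mink]; ring
  rw [e]
  have h3 : 2 * x.1 2 * (x.1 2 * w 2 - k * w 2) = w 2 := by
    simp only [k]; field_simp; ring
  have := mul_le_mul_of_nonneg_left (sub_le_sub_left hin (x.1 2 * w 2)) (by positivity : 0 ≤ 2 * x.1 2)
  linarith

/-! ### The domain of a measured lamination has the expected properties -/

lemma isFutureConvex_messDomain {μ : Measure Geodesic} (hμ : IsMeasuredLamination μ) {x₀ : Hyp}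
    (hx₀ : OffWeightedLeaves μ x₀) (y₀ : V) : IsFutureConvex (messDomain μ x₀ y₀) := by
  refine ⟨⟨_, messPoint_mem hμ hx₀ y₀ x₀⟩, fun h => ?_,
    range fun x : Hyp => (x, mink (messPoint μ x₀ y₀ x) x.1), ?_⟩
  · have := (h ▸ mem_univ _ : messPoint μ x₀ y₀ x₀ - x₀.1 ∈ messDomain μ x₀ y₀) x₀
    rw [mink_sub_left, x₀.mink_self] at this
    linarith
  · ext p
    simp only [messDomain, mem_ofPred_eq, forall_mem_range]

lemma isSupportPlane_messPoint {μ : Measure Geodesic} (hμ : IsMeasuredLamination μ) {x₀ : Hyp}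
    (hx₀ : OffWeightedLeaves μ x₀) (y₀ : V) (x : Hyp) :
    IsSupportPlane (messDomain μ x₀ y₀) (messPoint μ x₀ y₀ x) x := by
  constructor
  · intro p hp h0
    have hlim : Tendsto (fun ε : ℝ => p - ε • x.1) (𝓝[>] 0) (𝓝 p) := by
      have : Continuous fun ε : ℝ => p - ε • x.1 := by fun_prop
      simpa using (this.tendsto 0).mono_left nhdsWithin_le_nhds
    obtain ⟨ε, hε, hε0⟩ := ((hlim.eventually (mem_interior_iff_mem_nhds.1 hp)).and
      self_mem_nhdsWithin).exists
    have := hε x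
    rw [mink_sub_left, mink_smul_left, x.mink_self] at this
    rw [mink_sub_left] at h0
    have : (0 : ℝ) < ε := hε0
    linarith
  · intro v hv
    refine ⟨messPoint μ x₀ y₀ x + (-mink v x.1) • x.1, ?_, ?_⟩
    · refine (isFutureConvex_messDomain hμ hx₀ y₀).mem_interior (messPoint_mem hμ hx₀ y₀ x) ?_ ?_
      · rw [add_sub_cancel_left, mink_smul_left, mink_smul_right, x.mink_self]
        nlinarith [mul_self_pos.2 hv.ne]
      · rw [add_sub_cancel_left, Pi.smul_apply, smul_eq_mul]
        exact mul_pos (neg_pos.2 hv) x.two_pos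
    · rw [mink_sub_left, mink_add_left, mink_add_left, mink_smul_left, x.mink_self]
      ring

lemma isMessDomain_messDomain {μ : Measure Geodesic} (hμ : IsMeasuredLamination μ) {x₀ : Hyp}
    (hx₀ : OffWeightedLeaves μ x₀) (y₀ : V) : IsMessDomain μ x₀ y₀ (messDomain μ x₀ y₀) := by
  have := hμ.1
  intro x
  have hs := isSupportPlane_messPoint hμ hx₀ y₀ x
  refine ⟨integrableOn_sigma μ x₀ x x₀ x, ⟨?_, messPoint μ x₀ y₀ x, x, hs, ?_⟩, hs⟩
  · refine ⟨subset_closure (messPoint_mem hμ hx₀ y₀ x), fun h => hs.1 _ h ?_⟩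
    change mink (messPoint μ x₀ y₀ x - messPoint μ x₀ y₀ x) x.1 = 0
    rw [sub_self, mink_zero_left]
  · change mink (messPoint μ x₀ y₀ x - messPoint μ x₀ y₀ x) x.1 = 0
    rw [sub_self, mink_zero_left]

/-- The upper bound is `mink_null_le_of_mem`. The points `y(x)` along the ray to `η` belong to the
domain and realize the limit. -/
lemma supportFunction_messDomain {μ : Measure Geodesic} (hμ : IsMeasuredLamination μ) {x₀ : Hyp}
    (hx₀ : OffWeightedLeaves μ x₀) {y₀ : V} {η : Circle} {k : ℝ}
    (hk : Tendsto (fun r => mink (messPoint μ x₀ y₀ ((frame_ofNull x₀ η).pt r)) (null η)) atTop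
      (𝓝 k)) : supportFunction (messDomain μ x₀ y₀) (null η) = (k : EReal) := by
  have := hμ.1
  apply le_antisymm
  · refine iSup₂_le fun p hp => EReal.coe_le_coe_iff.2 (mink_null_le_of_mem hp hk)
  · refine le_of_tendsto ((continuous_coe_real_ereal.tendsto k).comp hk) (.of_forall fun r => ?_)
    exact le_iSup₂_of_le _ (messPoint_mem hμ hx₀ y₀ _) le_rfl

/-! ### The surface at unit distance from the boundary of a future-convex set -/

lemma horiz_add (v w : V) : horiz (v + w) = horiz v + horiz w := by
  apply Complex.ext <;> simp [horiz]

lemma horiz_sub (v w : V) : horiz (v - w) = horiz v - horiz w := by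
  apply Complex.ext <;> simp [horiz]

lemma horiz_smul (c : ℝ) (v : V) : horiz (c • v) = c • horiz v := by
  apply Complex.ext <;> simp [horiz]

lemma continuous_horiz : Continuous horiz := by
  have : horiz = fun p : V => (p 0 : ℂ) + (p 1 : ℂ) * Complex.I := by
    funext p; apply Complex.ext <;> simp [horiz]
  rw [this]; fun_prop

lemma mink_self_eq (v : V) : mink v v = ‖horiz v‖ ^ 2 - v 2 ^ 2 := by
  rw [← Complex.normSq_eq_norm_sq, Complex.normSq_apply]
  simp only [mink, horiz]; ring

lemma mink_self_nonpos {v : V} (h : ‖horiz v‖ ≤ v 2) : mink v v ≤ 0 := by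
  rw [mink_self_eq]
  nlinarith [norm_nonneg (horiz v)]

lemma mink_self_neg {v : V} (h : ‖horiz v‖ < v 2) : mink v v < 0 := by
  rw [mink_self_eq]
  nlinarith [norm_nonneg (horiz v)]

lemma norm_horiz_le {v : V} (h : mink v v ≤ 0) (h2 : 0 ≤ v 2) : ‖horiz v‖ ≤ v 2 := by
  rw [mink_self_eq] at h
  exact abs_le_of_sq_le_sq' (by linarith) h2 |>.2

/-- The height of the unit hyperboloid. -/
noncomputable def hgt (w : ℂ) : ℝ := √(1 + ‖w‖ ^ 2)

lemma hgt_sq (w : ℂ) : hgt w ^ 2 = 1 + ‖w‖ ^ 2 := Real.sq_sqrt (by positivity)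

lemma hgt_pos (w : ℂ) : 0 < hgt w := Real.sqrt_pos.2 (by positivity)

lemma one_le_hgt (w : ℂ) : 1 ≤ hgt w := by
  have := hgt_sq w
  nlinarith [hgt_pos w, sq_nonneg ‖w‖]

lemma norm_lt_hgt (w : ℂ) : ‖w‖ < hgt w := by
  have := hgt_sq w
  nlinarith [hgt_pos w, norm_nonneg w]

lemma continuous_hgt : Continuous hgt := by unfold hgt; fun_prop

lemma one_add_inner_le (a b : ℂ) : 1 + inner ℝ a b ≤ hgt a * hgt b := by
  have h1 := real_inner_le_norm a b
  have h2 : 1 + ‖a‖ * ‖b‖ ≤ hgt a * hgt b := by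
    refine abs_le_of_sq_le_sq' ?_ (mul_pos (hgt_pos a) (hgt_pos b)).le |>.2
    rw [mul_pow, hgt_sq, hgt_sq]
    nlinarith [sq_nonneg (‖a‖ - ‖b‖)]
  linarith

lemma hgt_sub_lt {a b : ℂ} (h : a ≠ b) : hgt a - hgt b < ‖a - b‖ := by
  have h1 : (hgt a - hgt b) * (hgt a + hgt b) = (‖a‖ - ‖b‖) * (‖a‖ + ‖b‖) := by
    linear_combination hgt_sq a - hgt_sq b
  have h2 : 0 < ‖a - b‖ := norm_pos_iff.2 (sub_ne_zero.2 h)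
  have h3 := norm_sub_norm_le a b
  have h4 := norm_lt_hgt a
  have h5 := norm_lt_hgt b
  by_contra! hc
  have h6 : ‖a - b‖ * (hgt a + hgt b) ≤ (hgt a - hgt b) * (hgt a + hgt b) :=
    mul_le_mul_of_nonneg_right hc (by linarith [hgt_pos a, hgt_pos b])
  have h7 : (‖a‖ - ‖b‖) * (‖a‖ + ‖b‖) ≤ ‖a - b‖ * (‖a‖ + ‖b‖) :=
    mul_le_mul_of_nonneg_right h3 (by positivity)
  nlinarith

/-- The tangent at `w` with a quadratic correction: `2 ab ≤ a² + b²` for the two heights, divided by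
`2 hgt w ≥ 2`. -/
lemma hgt_add_le (w h : ℂ) : hgt (w + h) ≤ hgt w + (hgt w)⁻¹ * inner ℝ w h + ‖h‖ ^ 2 / 2 := by
  have h1 := hgt_sq (w + h)
  rw [norm_add_sq_real] at h1
  have h2 := hgt_sq w
  have h3 := one_le_hgt w
  have h4 : 2 * hgt w * hgt (w + h) ≤ 2 * hgt w ^ 2 + 2 * inner ℝ w h + ‖h‖ ^ 2 := by
    nlinarith [sq_nonneg (hgt w - hgt (w + h))]
  have h5 : hgt (w + h) ≤ hgt w + (hgt w)⁻¹ * inner ℝ w h + (hgt w)⁻¹ * (‖h‖ ^ 2 / 2) := by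
    refine le_of_mul_le_mul_left ?_ (show 0 < 2 * hgt w by linarith)
    refine h4.trans_eq ?_
    field_simp [(hgt_pos w).ne']
  have h6 : (hgt w)⁻¹ * (‖h‖ ^ 2 / 2) ≤ 1 * (‖h‖ ^ 2 / 2) :=
    mul_le_mul_of_nonneg_right (inv_le_one_of_one_le₀ h3) (by positivity)
  linarith

lemma hgt_combination_le {s t : ℝ} (hs : 0 ≤ s) (ht : 0 ≤ t) (hst : s + t = 1) (a b : ℂ) :
    hgt (s • a + t • b) ≤ s * hgt a + t * hgt b := by
  set w := s • a + t • b with hw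
  refine le_of_mul_le_mul_left ?_ (hgt_pos w)
  have h1 := mul_le_mul_of_nonneg_left (one_add_inner_le w a) hs
  have h2 := mul_le_mul_of_nonneg_left (one_add_inner_le w b) ht
  have h3 : s * inner ℝ w a + t * inner ℝ w b = ‖w‖ ^ 2 := by
    rw [← real_inner_self_eq_norm_sq, hw, inner_add_right, inner_smul_right, inner_smul_right]
  have h4 := hgt_sq w
  nlinarith

/-- The graph of `f` is the set of points at distance one in the future of the boundary of `D`. -/
structure IsUnitLevel (D : Set V) (f : ℂ → ℝ) : Prop where
  attained : ∀ z, ∃ p ∈ D, f z = p 2 + hgt (z - horiz p)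
  le : ∀ z, ∀ p ∈ D, f z ≤ p 2 + hgt (z - horiz p)

/-- One spacelike half-space containing `D` bounds how far back in time the causal past of `u` can
go inside `D`, and causality then bounds the horizontal extent. -/
lemma isCompact_past {D : Set V} (hD : IsFutureConvex D) (u : V) :
    IsCompact {p ∈ D | mink (u - p) (u - p) ≤ 0 ∧ 0 ≤ (u - p) 2} := by
  obtain ⟨x, k, hk⟩ := hD.exists_bound
  have hc : Continuous fun p : V => u - p := by fun_prop
  have hcl : IsClosed {p ∈ D | mink (u - p) (u - p) ≤ 0 ∧ 0 ≤ (u - p) 2} :=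
    hD.isClosed.inter ((isClosed_le (Continuous.mink hc hc) continuous_const).inter
      (isClosed_le continuous_const ((continuous_apply 2).comp hc)))
  refine Metric.isCompact_of_isClosed_isBounded hcl ?_
  refine Bornology.IsBounded.subset (Metric.isBounded_closedBall (x := u)
    (r := 2 * x.1 2 * (k - mink u x.1))) ?_
  rintro p ⟨hp, h1, h2⟩
  have h3 := two_le_of_causal x h1 h2
  have h4 : -mink (u - p) x.1 ≤ k - mink u x.1 := by rw [mink_sub_left]; linarith [hk p hp]
  have h5 : (u - p) 2 ≤ 2 * x.1 2 * (k - mink u x.1) :=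
    h3.trans (mul_le_mul_of_nonneg_left h4 (by linarith [x.two_pos]))
  have h6 := norm_horiz_le h1 h2
  rw [Metric.mem_closedBall, dist_comm, dist_eq_norm, pi_norm_le_iff_of_nonneg (h2.trans h5)]
  intro i
  rw [Real.norm_eq_abs]
  fin_cases i
  · exact (Complex.abs_re_le_norm (horiz (u - p))).trans (h6.trans h5)
  · exact (Complex.abs_im_le_norm (horiz (u - p))).trans (h6.trans h5)
  · exact (abs_of_nonneg h2).trans_le h5

/-- The minimum of `p ↦ p 2 + hgt (z - horiz p)` exists because a competitor no worse than a given
`p₀` lies in the causal past of the point `u` above `z`, a compact part of `D`. -/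
lemma IsFutureConvex.exists_isUnitLevel {D : Set V} (hD : IsFutureConvex D) :
    ∃ f, IsUnitLevel D f := by
  have key : ∀ z : ℂ, ∃ p ∈ D, ∀ q ∈ D, p 2 + hgt (z - horiz p) ≤ q 2 + hgt (z - horiz q) := by
    intro z
    obtain ⟨p₀, hp₀⟩ := hD.1
    set g : V → ℝ := fun p => p 2 + hgt (z - horiz p)
    have hg : Continuous g :=
      (continuous_apply 2).add (continuous_hgt.comp (continuous_const.sub continuous_horiz))
    set u : V := ![z.re, z.im, g p₀]
    have hu : horiz u = z := by apply Complex.ext <;> simp [horiz, u]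
    have hmem : ∀ q ∈ D, g q ≤ g p₀ → q ∈ {p ∈ D | mink (u - p) (u - p) ≤ 0 ∧ 0 ≤ (u - p) 2} := by
      intro q hq hqg
      have h2 : (u - q) 2 = g p₀ - q 2 := by simp [u]
      have h3 : hgt (z - horiz q) ≤ (u - q) 2 := by
        rw [h2]; simp only [g] at hqg ⊢; linarith
      have h4 : ‖horiz (u - q)‖ ≤ (u - q) 2 := by
        rw [horiz_sub, hu]; exact (norm_lt_hgt _).le.trans h3
      exact ⟨hq, mink_self_nonpos h4, (norm_nonneg _).trans h4⟩
    obtain ⟨p, hp, hmin⟩ := (isCompact_past hD u).exists_isMinOn ⟨p₀, hmem p₀ hp₀ le_rfl⟩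
      hg.continuousOn
    refine ⟨p, hp.1, fun q hq => ?_⟩
    by_cases hqg : g q ≤ g p₀
    · exact hmin (hmem q hq hqg)
    · exact (hmin (hmem p₀ hp₀ le_rfl)).trans (not_le.1 hqg).le
  choose p hp hmin using key
  exact ⟨fun z => p z 2 + hgt (z - horiz (p z)), fun z => ⟨p z, hp z, rfl⟩, hmin⟩

namespace IsUnitLevel

variable {D : Set V} {f : ℂ → ℝ}

lemma sub_lt (h : IsUnitLevel D f) {z w : ℂ} (hzw : w ≠ z) : f w - f z < ‖w - z‖ := by
  obtain ⟨p, hp, hz⟩ := h.attained z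
  have h1 := h.le w p hp
  have h2 := hgt_sub_lt (a := w - horiz p) (b := z - horiz p) (by simpa using hzw)
  rw [sub_sub_sub_cancel_right] at h2
  linarith

/-- The level function is convex: convex combinations of minimizers stay in `D`, and the hyperboloid
height is convex. -/
lemma combination_le (h : IsUnitLevel D f) (hD : IsFutureConvex D) {s t : ℝ} (hs : 0 ≤ s)
    (ht : 0 ≤ t) (hst : s + t = 1) (z w : ℂ) : f (s • z + t • w) ≤ s * f z + t * f w := by
  obtain ⟨p, hp, hz⟩ := h.attained z
  obtain ⟨q, hq, hw⟩ := h.attained w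
  have h1 := h.le (s • z + t • w) _ (hD.convex_mem hp hq hs ht hst)
  have h2 := hgt_combination_le hs ht hst (z - horiz p) (w - horiz q)
  have e : s • z + t • w - horiz (s • p + t • q) = s • (z - horiz p) + t • (w - horiz q) := by
    rw [horiz_add, horiz_smul, horiz_smul]; module
  rw [e] at h1
  simp only [Pi.add_apply, Pi.smul_apply, smul_eq_mul] at h1
  rw [hz, hw]
  linarith

/-- The hyperboloid above a minimizer touches the graph from above, giving a spacelike slope and the
quadratic upper bound. Convexity applied between `z + k` and `z - t k`, with `t → 0`, turns the same
slope into a global lower bound. -/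
lemma exists_gradient (h : IsUnitLevel D f) (hD : IsFutureConvex D) (z : ℂ) : ∃ G : ℂ, ‖G‖ < 1 ∧
    ∀ k, f z + inner ℝ G k ≤ f (z + k) ∧ f (z + k) ≤ f z + inner ℝ G k + ‖k‖ ^ 2 / 2 := by
  obtain ⟨p, hp, hz⟩ := h.attained z
  set u := z - horiz p
  have hu := hgt_pos u
  have upper : ∀ k, f (z + k) ≤ f z + inner ℝ ((hgt u)⁻¹ • u) k + ‖k‖ ^ 2 / 2 := by
    intro k
    have h1 := h.le (z + k) p hp
    have h2 := hgt_add_le u k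
    rw [show z + k - horiz p = u + k by simp only [u]; ring] at h1
    rw [real_inner_smul_left, hz]
    linarith
  refine ⟨(hgt u)⁻¹ • u, ?_, fun k => ⟨?_, upper k⟩⟩
  · rw [norm_smul, Real.norm_eq_abs, abs_of_pos (inv_pos.2 hu), inv_mul_lt_iff₀ hu, mul_one]
    exact norm_lt_hgt u
  · set I := inner ℝ ((hgt u)⁻¹ • u) k with hI
    have key : ∀ t : ℝ, 0 < t → f z + I ≤ f (z + k) + t * (‖k‖ ^ 2 / 2) := by
      intro t ht
      have h1 := upper (-(t • k))
      rw [inner_neg_right, inner_smul_right, norm_neg, norm_smul, Real.norm_eq_abs, abs_of_pos ht]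
        at h1
      have h2 := h.combination_le hD (s := t / (1 + t)) (t := 1 / (1 + t)) (by positivity)
        (by positivity) (by field_simp; ring) (z + k) (z + -(t • k))
      have e : (t / (1 + t)) • (z + k) + (1 / (1 + t)) • (z + -(t • k)) = z := by
        have e1 : t / (1 + t) + 1 / (1 + t) = 1 := by field_simp; ring
        have e2 : 1 / (1 + t) * t = t / (1 + t) := by ring
        calc _ = (t / (1 + t) + 1 / (1 + t)) • z + (t / (1 + t) - 1 / (1 + t) * t) • k := by module
          _ = z := by rw [e1, e2, sub_self]; simp
      rw [e] at h2
      have h3 : (1 + t) * f z ≤ t * f (z + k) + f (z + -(t • k)) := by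
        have := mul_le_mul_of_nonneg_left h2 (show 0 ≤ 1 + t by linarith)
        refine this.trans_eq ?_
        field_simp
      refine le_of_mul_le_mul_left ?_ ht
      rw [← hI] at h1
      nlinarith
    have hlim : Tendsto (fun t : ℝ => f (z + k) + t * (‖k‖ ^ 2 / 2)) (𝓝[>] 0)
        (𝓝 (f (z + k) + 0 * (‖k‖ ^ 2 / 2))) :=
      tendsto_const_nhds.add ((tendsto_id.mono_left nhdsWithin_le_nhds).mul_const _)
    rw [zero_mul, add_zero] at hlim
    refine ge_of_tendsto hlim ?_
    filter_upwards [self_mem_nhdsWithin] with t ht using key t ht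

end IsUnitLevel

/-- A function with affine lower and quadratic upper bounds at all points is of class `C¹`. -/
lemma contDiff_of_gradient {f : ℂ → ℝ} {G : ℂ → ℂ} (hG : ∀ z k, f z + inner ℝ (G z) k ≤ f (z + k) ∧
    f (z + k) ≤ f z + inner ℝ (G z) k + ‖k‖ ^ 2 / 2) :
    ContDiff ℝ 1 f ∧ ∀ z, fderiv ℝ f z = innerSL ℝ (G z) := by
  have hd : ∀ z, HasFDerivAt f (innerSL ℝ (G z)) z := by
    intro z
    rw [hasFDerivAt_iff_isLittleO_nhds_zero]
    have hO : (fun k => f (z + k) - f z - innerSL ℝ (G z) k) =O[𝓝 0] fun k : ℂ => ‖k‖ ^ 2 := by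
      refine Asymptotics.IsBigO.of_bound 1 (.of_forall fun k => ?_)
      rw [innerSL_apply_apply, Real.norm_eq_abs, Real.norm_eq_abs, abs_of_nonneg (sq_nonneg ‖k‖),
        abs_of_nonneg (by linarith [(hG z k).1])]
      nlinarith [(hG z k).2, sq_nonneg ‖k‖]
    exact hO.trans_isLittleO (Asymptotics.isLittleO_norm_pow_id (by norm_num))
  have hfd : ∀ z, fderiv ℝ f z = innerSL ℝ (G z) := fun z => (hd z).fderiv
  -- The lower bound at `w` in the direction of `G w - G z`, over a distance `‖w - z‖`, is played
  -- against the upper bound at `z` for the same endpoint and the lower bound at `z` for `w`.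
  have hlip : ∀ z w, ‖G w - G z‖ ≤ 2 * ‖w - z‖ := by
    intro z w
    by_cases h0 : G w - G z = 0
    · rw [h0, norm_zero]; positivity
    have hpos : 0 < ‖G w - G z‖ := norm_pos_iff.2 h0
    rcases eq_or_ne w z with rfl | hne
    · simp at h0
    have hδ : 0 < ‖w - z‖ := norm_pos_iff.2 (sub_ne_zero.2 hne)
    set k : ℂ := (‖w - z‖ / ‖G w - G z‖) • (G w - G z)
    have hk : ‖k‖ = ‖w - z‖ := by
      rw [norm_smul, Real.norm_eq_abs, abs_of_nonneg (by positivity)]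
      field_simp
    have h1 := (hG w k).1
    have h2 := (hG z (w - z + k)).2
    have h3 := (hG z (w - z)).1
    rw [show z + (w - z + k) = w + k by ring, inner_add_right] at h2
    rw [add_sub_cancel] at h3
    have h4 : ‖w - z + k‖ ≤ 2 * ‖w - z‖ := (norm_add_le _ _).trans (by rw [hk]; linarith)
    have h5 : inner ℝ (G w - G z) k = ‖w - z‖ * ‖G w - G z‖ := by
      rw [inner_smul_right, real_inner_self_eq_norm_sq]
      field_simp
    rw [inner_sub_left] at h5
    have h6 : ‖w - z‖ * ‖G w - G z‖ ≤ ‖w - z‖ * (2 * ‖w - z‖) := by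
      nlinarith [norm_nonneg (w - z + k)]
    exact le_of_mul_le_mul_left h6 hδ
  have hGc : Continuous G := by
    refine LipschitzWith.continuous (K := 2) (LipschitzWith.of_dist_le_mul fun w z => ?_)
    rw [dist_eq_norm, dist_eq_norm]
    exact hlip z w
  refine ⟨contDiff_one_iff_fderiv.2 ⟨fun z => (hd z).differentiableAt, ?_⟩, hfd⟩
  simp only [funext hfd]
  exact (innerSL ℝ).continuous.comp hGc

lemma IsUnitLevel.isSpacelikeSurface {D : Set V} {f : ℂ → ℝ} (h : IsUnitLevel D f)
    (hD : IsFutureConvex D) : IsSpacelikeSurface {p | p 2 = f (horiz p)} := by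
  choose G hG1 hG using h.exists_gradient hD
  obtain ⟨h1, h2⟩ := contDiff_of_gradient hG
  refine ⟨f, h1, fun z => ?_, rfl⟩
  rw [h2, innerSL_apply_norm]
  exact hG1 z

/-! ### Causal paths -/

/-- A vector that is nonpositive on the light cone is future causal. -/
lemma norm_horiz_le_of_null {v : V} (h : ∀ η, mink v (null η) ≤ 0) : ‖horiz v‖ ≤ v 2 := by
  by_cases h0 : ‖horiz v‖ = 0
  · rw [h0]
    have h1 : horiz v = 0 := norm_eq_zero.1 h0
    have h2 : v 0 = 0 := congrArg Complex.re h1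
    have h3 : v 1 = 0 := congrArg Complex.im h1
    have := h 1
    simp [mink, null, h2, h3] at this
    exact this
  have hpos : 0 < ‖horiz v‖ := lt_of_le_of_ne (norm_nonneg _) (Ne.symm h0)
  have hsq : ‖horiz v‖ ^ 2 = v 0 ^ 2 + v 1 ^ 2 := by
    rw [← Complex.normSq_eq_norm_sq, Complex.normSq_apply]; simp only [horiz]; ring
  obtain ⟨η, hη⟩ := exists_smul_null (w := ![v 0, v 1, ‖horiz v‖])
    (by simp [mink]; nlinarith) (by simpa using hpos)
  have h1 := congrArg (mink v) hη
  rw [mink_smul_right] at h1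
  have h2 : mink v ![v 0, v 1, ‖horiz v‖] = ‖horiz v‖ * (‖horiz v‖ - v 2) := by
    simp [mink]; linear_combination -hsq
  have h3 : (![v 0, v 1, ‖horiz v‖] : V) 2 = ‖horiz v‖ := by simp
  rw [h2, h3] at h1
  have h4 := mul_left_cancel₀ h0 h1
  linarith [h η]

/-- A future causal path: later points lie in the causal future of earlier ones. -/
def IsFuturePath (γ : ℝ → V) : Prop :=
  Continuous γ ∧ ∀ s t, s < t → ‖horiz (γ t - γ s)‖ ≤ (γ t - γ s) 2 ∧ 0 < (γ t - γ s) 2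

lemma two_ne_zero_of_causal {v : V} (h0 : v ≠ 0) (h : mink v v ≤ 0) : v 2 ≠ 0 := by
  intro h2
  apply h0
  simp only [mink, h2] at h
  have h3 : v 0 = 0 := by nlinarith [sq_nonneg (v 0), sq_nonneg (v 1)]
  have h4 : v 1 = 0 := by nlinarith [sq_nonneg (v 0), sq_nonneg (v 1)]
  ext i; fin_cases i <;> simp [h2, h3, h4]

/-- A future causal velocity pairs nonpositively with every null direction, so each of these linear
functions decreases along the path, and they characterize the future cone. No integrability of the
derivative is needed. -/
lemma isFuturePath_of_deriv_pos {γ : ℝ → V} (hd : Differentiable ℝ γ)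
    (hc : ∀ t, mink (deriv γ t) (deriv γ t) ≤ 0) (hpos : ∀ t, 0 < deriv γ t 2) :
    IsFuturePath γ := by
  refine ⟨hd.continuous, fun s t hst => ?_⟩
  have hcomp : ∀ (L : V →L[ℝ] ℝ) u, HasDerivAt (fun t => L (γ t)) (L (deriv γ u)) u := fun L u =>
    L.hasFDerivAt.comp_hasDerivAt u (hd u).hasDerivAt
  constructor
  · apply norm_horiz_le_of_null
    intro η
    have hanti : Antitone fun t => minkCLM (null η) (γ t) :=
      antitone_of_deriv_nonpos (fun u => (hcomp _ u).differentiableAt) fun u => by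
        rw [(hcomp _ u).deriv, minkCLM_apply]
        exact mink_nonpos_of_causal (hc u) (mink_null_self η).le (hpos u).le (null_two_pos η).le
    have := hanti hst.le
    simp only [minkCLM_apply] at this
    rw [mink_sub_left]; linarith
  · have hmono : StrictMono fun t => γ t 2 := strictMono_of_deriv_pos fun u => by
      have := hcomp (ContinuousLinearMap.proj (R := ℝ) (2 : Fin 3)) u
      simp only [ContinuousLinearMap.proj_apply] at this
      rw [this.deriv]
      exact hpos u
    have := hmono hst
    simpa using this

/-- The time component of the velocity of a causal path does not change sign. -/
lemma isFuturePath_or_reverse {γ : ℝ → V} (hd : Differentiable ℝ γ)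
    (hc : ∀ t, deriv γ t ≠ 0 ∧ mink (deriv γ t) (deriv γ t) ≤ 0) :
    IsFuturePath γ ∨ IsFuturePath fun t => γ (-t) := by
  have hder : ∀ u ∈ (univ : Set ℝ), HasDerivWithinAt (fun t => γ t 2) (deriv γ u 2) univ u :=
    fun u _ => ((hasDerivAt_pi.1 (hd u).hasDerivAt) 2).hasDerivWithinAt
  -- The velocity need not be continuous, but a derivative without zeros has constant sign by
  -- Darboux's theorem.
  rcases hasDerivWithinAt_forall_lt_or_forall_gt_of_forall_ne convex_univ hder
    (m := 0) (fun u _ => two_ne_zero_of_causal (hc u).1 (hc u).2) with h | h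
  · right
    have hneg : ∀ t, HasDerivAt (fun t => γ (-t)) (-deriv γ (-t)) t := fun t =>
      ((hd (-t)).hasDerivAt.scomp t (hasDerivAt_neg t)).congr_deriv (by simp)
    refine isFuturePath_of_deriv_pos (fun t => (hneg t).differentiableAt) (fun t => ?_) fun t => ?_
    · rw [(hneg t).deriv, mink_neg_left, mink_neg_right, neg_neg]
      exact (hc (-t)).2
    · rw [(hneg t).deriv]
      simpa using h (-t) (mem_univ _)
  · left
    exact isFuturePath_of_deriv_pos hd (fun t => (hc t).2) fun t => h t (mem_univ _)

namespace IsFuturePath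

variable {γ : ℝ → V}

lemma abs_sub_le (h : IsFuturePath γ) {s t : ℝ} (hst : s ≤ t) (i : Fin 3) :
    |γ t i - γ s i| ≤ γ t 2 - γ s 2 := by
  rcases hst.eq_or_lt with rfl | hst
  · simp
  obtain ⟨h1, h2⟩ := h.2 s t hst
  fin_cases i
  · exact (Complex.abs_re_le_norm (horiz (γ t - γ s))).trans h1
  · exact (Complex.abs_im_le_norm (horiz (γ t - γ s))).trans h1
  · exact (abs_of_pos h2).le

lemma mono (h : IsFuturePath γ) : Monotone fun t => γ t 2 := fun s t hst => by
  have := (abs_nonneg _).trans (h.abs_sub_le hst 0)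
  simpa using this

/-- The coordinates `γ i + γ 2` of a future path are monotone. -/
lemma mono_add (h : IsFuturePath γ) (i : Fin 3) : Monotone fun t => γ t i + γ t 2 :=
  fun s t hst => by
    have := neg_le_of_abs_le (h.abs_sub_le hst i)
    change γ s i + γ s 2 ≤ γ t i + γ t 2
    linarith

/-- Each `γ i + γ 2` is monotone and, when time is bounded, bounded, as is time itself. -/
lemma exists_tendsto_atTop (h : IsFuturePath γ) {B : ℝ} (hB : ∀ t, γ t 2 ≤ B) :
    ∃ p, Tendsto γ atTop (𝓝 p) := by
  obtain ⟨l, hl⟩ : ∃ l, Tendsto (fun t => γ t 2) atTop (𝓝 l) :=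
    ⟨_, tendsto_atTop_ciSup h.mono ⟨B, by rintro _ ⟨t, rfl⟩; exact hB t⟩⟩
  have key : ∀ i, ∃ l, Tendsto (fun t => γ t i) atTop (𝓝 l) := by
    intro i
    have hb : BddAbove (range fun t => γ t i + γ t 2) := by
      refine ⟨|γ 0 i| + γ 0 2 + 2 * (B - γ 0 2), ?_⟩
      rintro _ ⟨t, rfl⟩
      have hB0 := hB 0
      refine (h.mono_add i (le_max_left t 0)).trans ?_
      have h1 := h.abs_sub_le (le_max_right t 0) i
      have h2 := hB (max t 0)
      change γ (max t 0) i + γ (max t 0) 2 ≤ _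
      linarith [le_abs_self (γ (max t 0) i - γ 0 i), le_abs_self (γ 0 i)]
    exact ⟨_, by simpa using (tendsto_atTop_ciSup (h.mono_add i) hb).sub hl⟩
  choose p hp using key
  exact ⟨p, tendsto_pi_nhds.2 hp⟩

lemma exists_tendsto_atBot (h : IsFuturePath γ) {B : ℝ} (hB : ∀ t ≤ 0, B ≤ γ t 2) :
    ∃ p, Tendsto γ atBot (𝓝 p) := by
  have hB' : ∀ t, B ≤ γ t 2 := fun t => (hB _ (min_le_right t 0)).trans (h.mono (min_le_left t 0))
  obtain ⟨l, hl⟩ : ∃ l, Tendsto (fun t => γ t 2) atBot (𝓝 l) :=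
    ⟨_, tendsto_atBot_ciInf h.mono ⟨B, by rintro _ ⟨t, rfl⟩; exact hB' t⟩⟩
  have key : ∀ i, ∃ l, Tendsto (fun t => γ t i) atBot (𝓝 l) := by
    intro i
    have hb : BddBelow (range fun t => γ t i + γ t 2) := by
      refine ⟨-|γ 0 i| + γ 0 2 - 2 * (γ 0 2 - B), ?_⟩
      rintro _ ⟨t, rfl⟩
      refine le_trans ?_ (h.mono_add i (min_le_left t 0))
      have h1 := h.abs_sub_le (min_le_right t 0) i
      have h2 := hB' (min t 0)
      change _ ≤ γ (min t 0) i + γ (min t 0) 2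
      linarith [le_abs_self (γ 0 i - γ (min t 0) i), neg_abs_le (γ 0 i)]
    exact ⟨_, by simpa using (tendsto_atBot_ciInf (h.mono_add i) hb).sub hl⟩
  choose p hp using key
  exact ⟨p, tendsto_pi_nhds.2 hp⟩

end IsFuturePath

/-! ### Cauchy surfaces -/

lemma _root_.MapClusterPt.prodMk_of_tendsto {ι X Y : Type*} [TopologicalSpace X]
    [TopologicalSpace Y] {F : Filter ι} {u : ι → X} {v : ι → Y} {x : X} {y : Y}
    (hu : MapClusterPt x F u) (hv : Tendsto v F (𝓝 y)) :
    MapClusterPt (x, y) F fun i => (u i, v i) := by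
  rw [mapClusterPt_iff_ultrafilter] at hu ⊢
  obtain ⟨U, hU, hux⟩ := hu
  exact ⟨U, hU, hux.prodMk_nhds (hv.mono_left hU)⟩

namespace IsUnitLevel

variable {D : Set V} {f : ℂ → ℝ}

lemma continuous (h : IsUnitLevel D f) : Continuous f := by
  have key : ∀ w z, f w - f z ≤ ‖w - z‖ := fun w z => by
    rcases eq_or_ne w z with rfl | hne
    · simp
    · exact (h.sub_lt hne).le
  refine LipschitzWith.continuous (K := 1) (LipschitzWith.of_dist_le_mul fun w z => ?_)
  rw [NNReal.coe_one, one_mul, dist_eq_norm, dist_eq_norm, Real.norm_eq_abs, abs_sub_le_iff]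
  exact ⟨key w z, by rw [norm_sub_rev]; exact key z w⟩

/-- Points above the surface are interior points. -/
lemma mem_interior_of_le (h : IsUnitLevel D f) (hD : IsFutureConvex D) {q : V}
    (hq : f (horiz q) ≤ q 2) : q ∈ interior D := by
  obtain ⟨p, hp, hz⟩ := h.attained (horiz q)
  have h1 : ‖horiz (q - p)‖ < (q - p) 2 := by
    rw [horiz_sub, Pi.sub_apply]
    linarith [norm_lt_hgt (horiz q - horiz p)]
  exact hD.mem_interior hp (mink_self_neg h1) ((norm_nonneg _).trans_lt h1)

/-- Moving in a future direction increases the height above the surface. -/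
lemma height_lt (h : IsUnitLevel D f) {p q : V} (h1 : ‖horiz (q - p)‖ ≤ (q - p) 2)
    (h2 : 0 < (q - p) 2) : p 2 - f (horiz p) < q 2 - f (horiz q) := by
  rw [horiz_sub, Pi.sub_apply] at h1
  rw [Pi.sub_apply] at h2
  rcases eq_or_ne (horiz q) (horiz p) with he | he
  · rw [he]; linarith
  · linarith [h.sub_lt he]

/-- A future path that never goes above the surface has an endpoint in the domain. -/
lemma exists_tendsto_of_below (h : IsUnitLevel D f) (hD : IsFutureConvex D)
    (hS : ∀ p ∈ interior D, ∀ η, ∃ q : V, q 2 = f (horiz q) ∧ mink p (null η) < mink q (null η))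
    {γ : ℝ → V} (hγ : IsFuturePath γ) (hU : γ 0 ∈ interior D)
    (hbelow : ∀ t, γ t 2 ≤ f (horiz (γ t))) : ∃ p ∈ interior D, Tendsto γ atTop (𝓝 p) := by
  have hcausal : ∀ t, 0 < t → mink (γ t - γ 0) (γ t - γ 0) ≤ 0 ∧ 0 < (γ t - γ 0) 2 :=
    fun t ht => ⟨mink_self_nonpos (hγ.2 0 t ht).1, (hγ.2 0 t ht).2⟩
  by_cases hB : ∃ B, ∀ t, γ t 2 ≤ B
  · obtain ⟨B, hB⟩ := hB
    obtain ⟨p, hp⟩ := hγ.exists_tendsto_atTop hB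
    refine ⟨p, ?_, hp⟩
    have hsub : Tendsto (fun t => γ t - γ 0) atTop (𝓝 (p - γ 0)) := hp.sub_const _
    have hc1 : mink (p - γ 0) (p - γ 0) ≤ 0 := by
      have hcm : Continuous fun w : V => mink w w := Continuous.mink continuous_id continuous_id
      refine le_of_tendsto ((hcm.tendsto _).comp hsub) ?_
      filter_upwards [eventually_gt_atTop 0] with t ht using (hcausal t ht).1
    have hc2 : 0 ≤ (p - γ 0) 2 := by
      refine ge_of_tendsto (((continuous_apply (2 : Fin 3)).tendsto _).comp hsub) ?_
      filter_upwards [eventually_gt_atTop 0] with t ht using (hcausal t ht).2.le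
    have := hD.add_causal_mem_interior hU hc1 hc2
    rwa [add_sub_cancel] at this
  -- With unbounded time the path will be found in the timelike future of a point of the surface,
  -- hence above the surface.
  exfalso
  push Not at hB
  have htop : Tendsto (fun t => γ t 2) atTop atTop :=
    tendsto_atTop_atTop_of_monotone hγ.mono fun B => (hB B).imp fun _ h => h.le
  set v : ℝ → V := fun t => γ t - γ 0
  have hv2 : Tendsto (fun t => v t 2) atTop atTop := by
    simpa [v, sub_eq_add_neg] using tendsto_atTop_add_const_right atTop (-γ 0 2) htop
  -- a limit direction of the path
  have hball : ∀ᶠ t in atTop, (v t 2)⁻¹ • v t ∈ Metric.closedBall (0 : V) 1 := by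
    filter_upwards [eventually_gt_atTop 0] with t ht
    rw [mem_closedBall_zero_iff, pi_norm_le_iff_of_nonneg zero_le_one]
    intro i
    rw [Pi.smul_apply, smul_eq_mul, norm_mul, norm_inv, Real.norm_eq_abs, Real.norm_eq_abs,
      abs_of_pos (hcausal t ht).2, inv_mul_le_iff₀ (hcausal t ht).2, mul_one]
    exact hγ.abs_sub_le ht.le i
  obtain ⟨u, -, hu⟩ := (isCompact_closedBall (0 : V) 1).exists_mapClusterPt_of_frequently
    hball.frequently
  have hu2 : u 2 = 1 := by
    have h1 : MapClusterPt (u 2) atTop fun t => ((v t 2)⁻¹ • v t) 2 :=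
      hu.continuousAt_comp (continuous_apply (2 : Fin 3)).continuousAt
    have h2 : Tendsto (fun t => ((v t 2)⁻¹ • v t) 2) atTop (𝓝 1) := by
      refine Tendsto.congr' ?_ tendsto_const_nhds
      filter_upwards [eventually_gt_atTop 0] with t ht
      rw [Pi.smul_apply, smul_eq_mul, inv_mul_cancel₀ (hcausal t ht).2.ne']
    exact eq_of_nhds_neBot (ClusterPt.mono h1 h2)
  have huu : mink u u ≤ 0 := by
    have hcm : Continuous fun w : V => mink w w := Continuous.mink continuous_id continuous_id
    have h1 := hu.continuousAt_comp hcm.continuousAt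
    by_contra! hpos
    obtain ⟨t, ht1, ht2⟩ := ((h1.frequently (lt_mem_nhds hpos)).and_eventually
      (eventually_gt_atTop 0)).exists
    simp only [Function.comp, mink_smul_left, mink_smul_right] at ht1
    have h2 := inv_pos.2 (hcausal t ht2).2
    nlinarith [mul_pos h2 h2, (hcausal t ht2).1, mul_nonneg h2.le (mul_nonneg h2.le (neg_nonneg.2 (hcausal t ht2).1))]
  -- a point of the surface in the past of the path
  obtain ⟨q, hq, hqu⟩ : ∃ q : V, q 2 = f (horiz q) ∧
      (mink u u < 0 ∨ mink (γ 0 - q) u < 0) := by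
    -- For a timelike limit direction any point of the surface will do. For a null one the surface
    -- must reach beyond the null plane through `γ 0`, and here the hypothesis `hS` is needed.
    rcases huu.lt_or_eq with hlt | heq
    · obtain ⟨q, hq, -⟩ := hS _ hU 1
      exact ⟨q, hq, Or.inl hlt⟩
    · obtain ⟨η, hη⟩ := exists_smul_null heq (by rw [hu2]; norm_num)
      rw [hu2, one_smul] at hη
      obtain ⟨q, hq, hlt⟩ := hS _ hU η
      refine ⟨q, hq, Or.inr ?_⟩
      rw [hη, mink_sub_left]; linarith
  set w := γ 0 - q
  -- In `⟨v + w, v + w⟩` the leading term over `v₂²` clusters at `⟨u, u⟩`. When only `⟨w, u⟩ < 0` is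
  -- known, `⟨v, v⟩ ≤ 0` is discarded, and the rest divided by `v₂` clusters at `2 ⟨w, u⟩`. Since
  -- `u` is only a cluster point, the inequality holds frequently, which suffices.
  have hfreq : ∃ᶠ t in atTop, mink (v t + w) (v t + w) < 0 := by
    have hinv : Tendsto (fun t => (v t 2)⁻¹) atTop (𝓝 0) := tendsto_inv_atTop_zero.comp hv2
    rcases hqu with hlt | hlt
    · have hcm : Continuous fun z : V × ℝ => mink (z.1 + z.2 • w) (z.1 + z.2 • w) := by
        have : Continuous fun z : V × ℝ => z.1 + z.2 • w := by fun_prop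
        exact Continuous.mink this this
      have hcl : MapClusterPt (u, (0 : ℝ)) atTop fun t => ((v t 2)⁻¹ • v t, (v t 2)⁻¹) :=
        MapClusterPt.prodMk_of_tendsto hu hinv
      have h1 := hcl.continuousAt_comp hcm.continuousAt
      have h2 := h1.frequently (gt_mem_nhds (show mink (u + (0 : ℝ) • w) (u + (0 : ℝ) • w) < 0 by
        simpa using hlt))
      refine (h2.and_eventually (eventually_gt_atTop 0)).mono fun t ⟨ht1, ht2⟩ => ?_
      simp only [Function.comp, ← smul_add, mink_smul_left, mink_smul_right] at ht1
      have h3 := inv_pos.2 (hcausal t ht2).2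
      by_contra! hc
      exact absurd ht1 (not_lt.2 (mul_nonneg h3.le (mul_nonneg h3.le hc)))
    · have hcm : Continuous fun z : V × ℝ => 2 * mink w z.1 + z.2 * mink w w :=
        (continuous_const.mul (Continuous.mink continuous_const continuous_fst)).add
          (continuous_snd.mul continuous_const)
      have hcl : MapClusterPt (u, (0 : ℝ)) atTop fun t => ((v t 2)⁻¹ • v t, (v t 2)⁻¹) :=
        MapClusterPt.prodMk_of_tendsto hu hinv
      have h1 := hcl.continuousAt_comp hcm.continuousAt
      have h2 := h1.frequently (gt_mem_nhds (show 2 * mink w u + 0 * mink w w < 0 by linarith))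
      refine (h2.and_eventually (eventually_gt_atTop 0)).mono fun t ⟨ht1, ht2⟩ => ?_
      simp only [Function.comp, mink_smul_right] at ht1
      have h3 := inv_pos.2 (hcausal t ht2).2
      have h4 := (hcausal t ht2).1
      change mink (v t) (v t) ≤ 0 at h4
      simp only [mink_add_left, mink_add_right, mink_comm (v t) w]
      by_contra! hc
      nlinarith
  obtain ⟨t, ht1, ht2⟩ := (hfreq.and_eventually (hv2.eventually (eventually_gt_atTop (-w 2)))).exists
  have he : v t + w = γ t - q := by simp only [v, w]; abel
  have hpos : 0 < (γ t - q) 2 := by rw [← he, Pi.add_apply]; linarith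
  rw [he] at ht1
  have := h.height_lt (norm_horiz_le ht1.le hpos.le) hpos
  linarith [hbelow t]

/-- A future path that stays above the surface has a past endpoint in the domain. -/
lemma exists_tendsto_of_above (h : IsUnitLevel D f) (hD : IsFutureConvex D) {γ : ℝ → V}
    (hγ : IsFuturePath γ) (hU : ∀ t, γ t ∈ interior D)
    (habove : ∀ t, f (horiz (γ t)) ≤ γ t 2) : ∃ p ∈ interior D, Tendsto γ atBot (𝓝 p) := by
  have hpast : ∀ t ≤ 0, γ t ∈ {p ∈ D | mink (γ 0 - p) (γ 0 - p) ≤ 0 ∧ 0 ≤ (γ 0 - p) 2} := by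
    intro t ht
    refine ⟨interior_subset (hU t), ?_⟩
    rcases ht.eq_or_lt with rfl | ht
    · simp [mink_zero_left]
    · exact ⟨mink_self_nonpos (hγ.2 t 0 ht).1, (hγ.2 t 0 ht).2.le⟩
  obtain ⟨B, hB⟩ := (isCompact_past hD (γ 0)).bddBelow_image (f := fun p : V => p 2)
    (continuous_apply 2).continuousOn
  obtain ⟨p, hp⟩ := hγ.exists_tendsto_atBot (B := B) fun t ht => hB ⟨γ t, hpast t ht, rfl⟩
  refine ⟨p, h.mem_interior_of_le hD ?_, hp⟩
  exact le_of_tendsto_of_tendsto ((h.continuous.comp continuous_horiz).tendsto p |>.comp hp)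
    (((continuous_apply (2 : Fin 3)).tendsto p).comp hp) (.of_forall habove)

/-- The height above the surface is continuous and strictly increasing along the path. If it never
became positive, or never negative, the path would have an endpoint in the domain. -/
lemma existsUnique_of_isFuturePath (h : IsUnitLevel D f) (hD : IsFutureConvex D)
    (hS : ∀ p ∈ interior D, ∀ η, ∃ q : V, q 2 = f (horiz q) ∧ mink p (null η) < mink q (null η))
    {γ : ℝ → V} (hγ : IsFuturePath γ) (hU : ∀ t, γ t ∈ interior D)
    (htop : ∀ p ∈ interior D, ¬ Tendsto γ atTop (𝓝 p))
    (hbot : ∀ p ∈ interior D, ¬ Tendsto γ atBot (𝓝 p)) : ∃! t, γ t 2 = f (horiz (γ t)) := by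
  set F : ℝ → ℝ := fun t => γ t 2 - f (horiz (γ t))
  have hF : Continuous F := ((continuous_apply (2 : Fin 3)).comp hγ.1).sub
    (h.continuous.comp (continuous_horiz.comp hγ.1))
  have hmono : StrictMono F := fun s t hst => h.height_lt (hγ.2 s t hst).1 (hγ.2 s t hst).2
  obtain ⟨a, ha⟩ : ∃ a, 0 < F a := by
    by_contra! hc
    obtain ⟨p, hp, hlim⟩ := h.exists_tendsto_of_below hD hS hγ (hU 0) fun t => sub_nonpos.1 (hc t)
    exact htop p hp hlim
  obtain ⟨b, hb⟩ : ∃ b, F b < 0 := by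
    by_contra! hc
    obtain ⟨p, hp, hlim⟩ := h.exists_tendsto_of_above hD hγ hU fun t => sub_nonneg.1 (hc t)
    exact hbot p hp hlim
  obtain ⟨t, ht⟩ := mem_range_of_exists_le_of_exists_ge hF ⟨b, hb.le⟩ ⟨a, ha.le⟩
  exact ⟨t, sub_eq_zero.1 ht, fun s hs => hmono.injective ((sub_eq_zero.2 hs).trans ht.symm)⟩

lemma isCauchySurface (h : IsUnitLevel D f) (hD : IsFutureConvex D)
    (hS : ∀ p ∈ interior D, ∀ η, ∃ q : V, q 2 = f (horiz q) ∧ mink p (null η) < mink q (null η)) :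
    IsCauchySurface {p | p 2 = f (horiz p)} D := by
  refine ⟨h.isSpacelikeSurface hD, fun p hp => interior_subset (h.mem_interior_of_le hD (le_of_eq
    (Eq.symm hp))), fun γ ⟨hd, hU, hc, htop, hbot⟩ => ?_⟩
  rcases isFuturePath_or_reverse hd hc with hγ | hγ
  · exact h.existsUnique_of_isFuturePath hD hS hγ hU htop hbot
  · obtain ⟨t, ht, huniq⟩ := h.existsUnique_of_isFuturePath hD hS hγ (fun t => hU (-t))
      (fun p hp hlim => hbot p hp (by simpa [Function.comp_def] using hlim.comp tendsto_neg_atBot_atTop))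
      (fun p hp hlim => htop p hp (by simpa [Function.comp_def] using hlim.comp tendsto_neg_atTop_atBot))
    refine ⟨-t, ht, fun s hs => ?_⟩
    rw [← huniq (-s) (by simpa using hs), neg_neg]

end IsUnitLevel

/-! ### Maximality -/

/-- The null lines of a future-convex domain, in a suitable parametrization. -/
lemma IsFutureConvex.exists_null_path {D : Set V} (hD : IsFutureConvex D) {p : V}
    (hp : p ∈ interior D) (η : Circle) : ∃ τ : ℝ → ℝ,
      IsInextensibleCausalPath (interior D) fun t => p + τ t • null η := by
  have hup : ∀ s s' : ℝ, s ≤ s' → p + s • null η ∈ interior D → p + s' • null η ∈ interior D := by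
    intro s s' hs h
    have := hD.add_causal_mem_interior h (v := (s' - s) • null η)
      (by rw [mink_smul_left, mink_smul_right, mink_null_self]; simp)
      (by rw [Pi.smul_apply, null_two]; simpa using hs)
    rwa [add_assoc, ← add_smul, add_sub_cancel] at this
  -- a reparametrization that is monotone and ends outside the domain gives an inextensible path
  have key : ∀ τ τ' : ℝ → ℝ, (∀ t, HasDerivAt τ (τ' t) t) → (∀ t, 0 < τ' t) →
      (∀ t, p + τ t • null η ∈ interior D) → Tendsto τ atTop atTop →
      (∀ q ∈ interior D, ¬ Tendsto (fun t => p + τ t • null η) atBot (𝓝 q)) →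
      IsInextensibleCausalPath (interior D) fun t => p + τ t • null η := by
    intro τ τ' hτ hpos hmem htop hbot
    have hd : ∀ t, HasDerivAt (fun t => p + τ t • null η) (τ' t • null η) t := fun t =>
      ((hτ t).smul_const (null η)).const_add p
    refine ⟨fun t => (hd t).differentiableAt, hmem, fun t => ?_, fun q _ hlim => ?_, hbot⟩
    · rw [(hd t).deriv]
      refine ⟨fun h0 => ?_, by rw [mink_smul_left, mink_smul_right, mink_null_self]; simp⟩
      have := congrFun h0 2
      rw [Pi.smul_apply, null_two] at this
      simp only [smul_eq_mul, mul_one, Pi.zero_apply] at this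
      exact (hpos t).ne' this
    · have h2 := ((continuous_apply (2 : Fin 3)).tendsto q).comp hlim
      have h3 : Tendsto (fun t => p 2 + τ t) atTop atTop := tendsto_atTop_add_const_left _ _ htop
      refine not_tendsto_atTop_of_tendsto_nhds (h2.congr fun t => ?_) h3
      simp [null_two]
  by_cases hall : ∀ s : ℝ, p + s • null η ∈ interior D
  · refine ⟨id, key id (fun _ => 1) hasDerivAt_id (fun _ => one_pos) hall tendsto_id ?_⟩
    intro q _ hlim
    have h2 := ((continuous_apply (2 : Fin 3)).tendsto q).comp hlim
    have h3 : Tendsto (fun t : ℝ => p 2 + t) atBot atBot := tendsto_atBot_add_const_left _ _ tendsto_id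
    refine not_tendsto_atBot_of_tendsto_nhds (h2.congr fun t => ?_) h3
    simp [null_two]
  · push Not at hall
    obtain ⟨s₁, hs₁⟩ := hall
    set T : Set ℝ := {s | p + s • null η ∈ interior D}
    have hTb : BddBelow T := ⟨s₁, fun s hs => by
      by_contra! hlt
      exact hs₁ (hup s s₁ hlt.le hs)⟩
    have hTne : T.Nonempty := ⟨0, by simpa [T] using hp⟩
    have hTo : IsOpen T := by
      have : Continuous fun s : ℝ => p + s • null η := by fun_prop
      exact isOpen_interior.preimage this
    set s₀ := sInf T
    have hs₀ : s₀ ∉ T := fun hmem => by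
      obtain ⟨ε, hε, hball⟩ := Metric.isOpen_iff.1 hTo s₀ hmem
      have h1 : s₀ - ε / 2 ∈ T := hball (by
        rw [Metric.mem_ball, Real.dist_eq, show s₀ - ε / 2 - s₀ = -(ε / 2) by ring, abs_neg,
          abs_of_pos (by linarith)]
        linarith)
      linarith [csInf_le hTb h1]
    have hgt : ∀ s, s₀ < s → s ∈ T := fun s hs => by
      obtain ⟨s', hs', hlt⟩ := exists_lt_of_csInf_lt hTne hs
      exact hup s' s hlt.le hs'
    -- The line is inside the domain exactly for parameters above `s₀`. The exponential maps the
    -- real line onto that ray, so the point on the boundary is only approached at `-∞`.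
    refine ⟨fun t => s₀ + Real.exp t, key _ Real.exp (fun t => (Real.hasDerivAt_exp t).const_add s₀)
      Real.exp_pos (fun t => hgt _ (by linarith [Real.exp_pos t]))
      (tendsto_atTop_add_const_left _ _ Real.tendsto_exp_atTop) fun q hq hlim => ?_⟩
    have h1 : Tendsto (fun t => p + (s₀ + Real.exp t) • null η) atBot
        (𝓝 (p + (s₀ + 0) • null η)) :=
      tendsto_const_nhds.add ((tendsto_const_nhds.add Real.tendsto_exp_atBot).smul_const _)
    rw [add_zero] at h1
    rw [tendsto_nhds_unique hlim h1] at hq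
    exact hs₀ hq

lemma IsFutureConvex.subset_closure_interior {D : Set V} (hD : IsFutureConvex D) :
    D ⊆ closure (interior D) := by
  intro p hp
  have hlim : Tendsto (fun ε : ℝ => p + ε • (![0, 0, 1] : V)) (𝓝[>] 0) (𝓝 p) := by
    have : Continuous fun ε : ℝ => p + ε • (![0, 0, 1] : V) := by fun_prop
    simpa using (this.tendsto 0).mono_left nhdsWithin_le_nhds
  refine mem_closure_of_tendsto hlim ?_
  filter_upwards [self_mem_nhdsWithin] with ε hε
  have hε' : (0 : ℝ) < ε := hε
  refine hD.mem_interior hp ?_ ?_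
  · rw [add_sub_cancel_left]
    simp [mink]; positivity
  · rw [add_sub_cancel_left]
    simpa using hε'

/-- A future-convex domain cut out by null half-spaces, whose support function at infinity is
approached along its unit level surface, is a domain of dependence. -/
lemma IsFutureConvex.isDomainOfDependence {D : Set V} (hD : IsFutureConvex D) {f : ℂ → ℝ}
    (h : IsUnitLevel D f)
    (hS : ∀ p ∈ interior D, ∀ η, ∃ q : V, q 2 = f (horiz q) ∧ mink p (null η) < mink q (null η))
    {φ : Circle → ℝ} (hφ : D = {p | ∀ η, mink p (null η) ≤ φ η}) : IsDomainOfDependence D := by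
  have hC := h.isCauchySurface hD hS
  refine ⟨_, hD, hC, fun D' hD' hC' => ?_⟩
  refine hD'.subset_closure_interior.trans (closure_minimal (fun p hp => ?_) hD.isClosed)
  by_contra hpD
  obtain ⟨η, hη⟩ : ∃ η, φ η < mink p (null η) := by
    by_contra! hc
    exact hpD (hφ ▸ hc)
  obtain ⟨τ, hτ⟩ := hD'.exists_null_path hp η
  -- The null line in direction `η` must meet the surface, which lies in `D`; but `⟨·, η⟩` is
  -- constant along the line and exceeds `φ η`.
  obtain ⟨t, ht, -⟩ := hC'.2.2 _ hτ
  have h1 : p + τ t • null η ∈ D := hC.2.1 ht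
  rw [hφ] at h1
  have h2 := h1 η
  rw [mink_add_left, mink_smul_left, mink_null_self, mul_zero, add_zero] at h2
  linarith

/-- The unit level surface of the domain of a lamination contains the points `y(x) + x`. -/
lemma IsUnitLevel.messPoint_add {μ : Measure Geodesic} (hμ : IsMeasuredLamination μ) {x₀ : Hyp}
    (hx₀ : OffWeightedLeaves μ x₀) {y₀ : V} {f : ℂ → ℝ} (h : IsUnitLevel (messDomain μ x₀ y₀) f)
    (x : Hyp) : (messPoint μ x₀ y₀ x + x.1) 2 = f (horiz (messPoint μ x₀ y₀ x + x.1)) := by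
  set q := messPoint μ x₀ y₀ x + x.1 with hq
  have hgx : hgt (horiz x.1) = x.1 2 := by
    have h1 := x.mink_self
    rw [mink_self_eq] at h1
    rw [hgt, show 1 + ‖horiz x.1‖ ^ 2 = x.1 2 ^ 2 by linarith, Real.sqrt_sq x.two_pos.le]
  apply le_antisymm
  · obtain ⟨p, hp, hf⟩ := h.attained (horiz q)
    -- This is the unit timelike vector from the minimizer `p` up to the surface over `q`. If `q`
    -- were strictly above the surface, reversed Cauchy-Schwarz would give `⟨q - p, x⟩ < -1`,
    -- against the half-space condition for `p` at `x`.
    set w : V := ![(horiz q - horiz p).re, (horiz q - horiz p).im, hgt (horiz q - horiz p)]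
    have hw : horiz w = horiz q - horiz p := by apply Complex.ext <;> simp [horiz, w]
    have hww : mink w w = -1 := by
      have := hgt_sq (horiz q - horiz p)
      rw [mink_self_eq, hw]
      simp only [w, Matrix.cons_val]
      linarith
    have hw2 : 0 < w 2 := by simpa [w] using hgt_pos _
    -- reversed Cauchy-Schwarz for the unit timelike vectors `w` and `x`
    have hrev : mink w x.1 ≤ -1 := by
      have h1 := one_add_inner_le (horiz q - horiz p) (horiz x.1)
      rw [hgx] at h1
      have h2 : inner ℝ (horiz q - horiz p) (horiz x.1) = w 0 * x.1 0 + w 1 * x.1 1 := by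
        simp [Complex.inner, horiz, w]; ring
      have h3 : hgt (horiz q - horiz p) = w 2 := by simp [w]
      rw [h2, h3] at h1
      simp only [mink]; linarith
    have hd : q - p = w + (q 2 - f (horiz q)) • (![0, 0, 1] : V) := by
      ext i
      fin_cases i
      · simp [w, horiz]
      · simp [w, horiz]
      · simp [w, hf]; ring
    have h4 := hp x
    have h5 : mink (q - p) x.1 = mink w x.1 - (q 2 - f (horiz q)) * x.1 2 := by
      rw [hd, mink_add_left, mink_smul_left]; simp [mink]; ring
    have h6 : -1 ≤ mink (q - p) x.1 := by
      rw [mink_sub_left, hq, mink_add_left, x.mink_self]; linarith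
    by_contra! hc
    nlinarith [mul_pos (sub_pos.2 hc) x.two_pos]
  · have h1 := h.le (horiz q) _ (messPoint_mem hμ hx₀ y₀ x)
    rw [hq, horiz_add, add_sub_cancel_left, hgx] at h1
    rw [hq, horiz_add]
    exact h1

/-- The points `y(x) + x` of the unit level surface along the ray to `η` have `⟨y(x) + x, η⟩ →
φ(η)`, because `⟨x, η⟩` decays like `exp (-r)`. Interior points of the domain have `⟨p, η⟩ < φ(η)`,
so the surface passes beyond each of them. -/
lemma isDomainOfDependence_messDomain {μ : Measure Geodesic} (hμ : IsMeasuredLamination μ)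
    {x₀ : Hyp} (hx₀ : OffWeightedLeaves μ x₀) {y₀ : V} {φ : Circle → ℝ}
    (hφ : ∀ η, Tendsto (fun r => mink y₀ (null η) +
      ∫ l in meeting (seg x₀ ((frame_ofNull x₀ η).pt r)), |mink (null η) l.nrm| ∂μ) atTop
      (𝓝 (φ η)))
    (hk : ∀ η, Tendsto (fun r => mink (messPoint μ x₀ y₀ ((frame_ofNull x₀ η).pt r)) (null η)) atTop
      (𝓝 (φ η))) : IsDomainOfDependence (messDomain μ x₀ y₀) := by
  have := hμ.1
  have hD := isFutureConvex_messDomain hμ hx₀ y₀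
  obtain ⟨f, hf⟩ := hD.exists_isUnitLevel
  refine hD.isDomainOfDependence hf (fun p hp η => ?_) (φ := φ) ?_
  · have hlt : mink p (null η) < φ η := by
      have hlim : Tendsto (fun ε : ℝ => p - ε • x₀.1) (𝓝[>] 0) (𝓝 p) := by
        have : Continuous fun ε : ℝ => p - ε • x₀.1 := by fun_prop
        simpa using (this.tendsto 0).mono_left nhdsWithin_le_nhds
      obtain ⟨ε, hε, hε0⟩ := ((hlim.eventually (mem_interior_iff_mem_nhds.1 hp)).and
        self_mem_nhdsWithin).exists
      have h1 := mink_null_le_of_mem hε (hk η)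
      rw [mink_sub_left, mink_smul_left] at h1
      have : (0 : ℝ) < ε := hε0
      nlinarith [x₀.mink_null_neg η]
    have hpt : Tendsto (fun r => mink ((frame_ofNull x₀ η).pt r).1 (null η)) atTop (𝓝 0) := by
      have h1 : Tendsto (fun r => Real.exp (-r) * mink x₀.1 (null η)) atTop
          (𝓝 (0 * mink x₀.1 (null η))) := Real.tendsto_exp_neg_atTop_nhds_zero.mul_const _
      rw [zero_mul] at h1
      refine h1.congr fun r => ?_
      rw [Frame.pt_val, mink_add_left, mink_smul_left, mink_smul_left, mink_smul_left,
        mink_null_self]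
      ring
    have hsum := (hk η).add hpt
    rw [add_zero] at hsum
    obtain ⟨r, hr⟩ := (hsum.eventually (lt_mem_nhds hlt)).exists
    rw [← mink_add_left] at hr
    exact ⟨_, hf.messPoint_add hμ hx₀ _, hr⟩
  · ext p
    exact ⟨fun hp η => mink_null_le_of_mem hp (hk η), fun hp => mem_messDomain_of_forall_null hμ hφ hp⟩

end Mink

theorem proposition4p2 (μ : MeasureTheory.Measure Mink.Geodesic)
    (hμ : Mink.IsMeasuredLamination μ) (hbdd : Mink.thurstonNorm μ < ⊤)
    (φ : Circle → ℝ) (hφ : Mink.IsInfinitesimalEarthquake μ φ) :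
    ∃ D : Set Mink.V, Mink.IsDomainOfDependence D ∧ Mink.HasDualLamination D μ ∧
      ∀ η : Circle, Mink.supportFunction D (Mink.null η) = (φ η : EReal) := by
  have := hμ.1
  obtain ⟨x₀, hx₀⟩ := Mink.exists_offWeightedLeaves μ
  obtain ⟨y₀, hy₀⟩ := hφ.exists_tendsto hμ hbdd hx₀
  have hk : ∀ η, Tendsto (fun r => Mink.mink (Mink.messPoint μ x₀ y₀
      ((Mink.frame_ofNull x₀ η).pt r)) (Mink.null η)) atTop (𝓝 (φ η)) := by
    intro η
    refine (hy₀ η).congr' ?_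
    filter_upwards [eventually_gt_atTop 0] with r hr
    have hc : 0 < (-Mink.mink x₀.1 (Mink.null η))⁻¹ := inv_pos.2 (neg_pos.2 (x₀.mink_null_neg η))
    -- This is the identity for the normalized null vector; its positive scale is cancelled from
    -- both sides.
    have h1 := (Mink.frame_ofNull x₀ η).mink_messPoint_pt μ y₀ hr
    simp only [Mink.mink_smul_left, Mink.mink_smul_right, abs_mul, abs_of_pos hc] at h1
    rw [integral_const_mul, ← mul_add] at h1
    exact (mul_left_cancel₀ hc.ne' h1).symm
  exact ⟨Mink.messDomain μ x₀ y₀, Mink.isDomainOfDependence_messDomain hμ hx₀ hy₀ hk,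
    ⟨x₀, y₀, hx₀, Mink.isMessDomain_messDomain hμ hx₀ y₀⟩,
    fun η => Mink.supportFunction_messDomain hμ hx₀ (hk η)⟩
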